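/- By a curve over a field $k$ we mean an integral separated $k$-scheme of finite type and of dimension $1$; its (geometric) genus is the genus of its function field $F$ over $k$, i.e. $\max_D\,(\deg D-\dim_k L(D)+1)$ over all divisors $D$ of $F/k$ (formal $\mathbb{Z}$-linear combinations of places of $F/k$). A point of a scheme is nonsingular if its local ring is regular. Let $p$ be a prime, and let $J\subseteq\mathbb{Z}[x_0,\dots,x_n]$ be a homogeneous ideal. For a commutative ring $A$ write $X_A=\operatorname{Proj}\bigl(A[x_0,\dots,x_n]/J\,A[x_0,\dots,x_n]\bigr)\subseteq\mathbb{P}^n_A$ for the closed subscheme cut out by $J$. Let $X=X_{\mathbb{Q}}$ and let $\tilde X=X_{\mathbb{F}_p}$ be the reduction of $X$ mod $p$. Let $Y$ be a geometrically irreducible curve over $\mathbb{Q}$, and suppose that $X$ is a nonsingular projective model of $Y$, that is, $X$ is a curve over $\mathbb{Q}$, all points of $X$ are nonsingular, and $X$ is birational to $Y$ over $\mathbb{Q}$. Suppose that $\tilde X$ is an integral (i.e. reduced and irreducible) curve over $\mathbb{F}_p$, that $\tilde X$ has a nonsingular $\mathbb{F}_p$-point, and that the geometric genus of $\tilde X$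 equals the genus of $Y$. Then $X$ has good reduction at $p$: the model $X_{\mathbb{Z}_{(p)}}$ is smooth over $\mathbb{Z}_{(p)}$, and its special fibre $\tilde X$ is smooth over $\mathbb{F}_p$. -/

import Mathlib

open CategoryTheory AlgebraicGeometry

noncomputable section

/-! ### The graded ring `S / I` for a homogeneous ideal `I` -/

namespace GradedQuotient

open DirectSum

variable {R S : Type*} [CommRing R] [CommRing S] [Algebra R S]
  (𝒜 : ℕ → Submodule R S) [GradedAlgebra 𝒜] (I : HomogeneousIdeal 𝒜)

/-- The degree `d` part of `S / I`: the image of the degree `d` part of `S`. -/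
def grading (d : ℕ) : Submodule R (S ⧸ I.toIdeal) :=
  (𝒜 d).map (Ideal.Quotient.mkₐ R I.toIdeal).toLinearMap

instance gradedMonoid : SetLike.GradedMonoid (grading 𝒜 I) where
  one_mem := ⟨1, SetLike.GradedOne.one_mem, map_one (Ideal.Quotient.mkₐ R I.toIdeal)⟩
  mul_mem := by
    rintro i j _ _ ⟨a, ha, rfl⟩ ⟨b, hb, rfl⟩
    exact ⟨a * b, SetLike.GradedMul.mul_mem ha hb, map_mul (Ideal.Quotient.mkₐ R I.toIdeal) a b⟩

/-- The quotient map in degree `d`. -/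
def mkDeg (d : ℕ) : 𝒜 d →+ grading 𝒜 I d where
  toFun a := ⟨Ideal.Quotient.mk I.toIdeal a, ⟨a, a.2, rfl⟩⟩
  map_zero' := Subtype.ext (by simp)
  map_add' a b := Subtype.ext (by simp)

/-- Decompose an element of `S` and reduce its components modulo `I`. -/
def preDecompose : S →+ ⨁ d, grading 𝒜 I d :=
  (DirectSum.map (mkDeg 𝒜 I)).comp (decomposeAddEquiv 𝒜).toAddMonoidHom

theorem preDecompose_of_mem {d : ℕ} {a : S} (ha : a ∈ 𝒜 d) :
    preDecompose 𝒜 I a =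
      DirectSum.of (fun d => grading 𝒜 I d) d ⟨Ideal.Quotient.mk I.toIdeal a, ⟨a, ha, rfl⟩⟩ := by
  simp only [preDecompose, AddMonoidHom.comp_apply, AddEquiv.coe_toAddMonoidHom,
    decomposeAddEquiv_apply]
  rw [decompose_of_mem 𝒜 ha, DirectSum.map_of]
  rfl

theorem preDecompose_eq_zero {a : S} (ha : a ∈ I.toIdeal) : preDecompose 𝒜 I a = 0 := by
  ext d
  simp only [preDecompose, AddMonoidHom.comp_apply, AddEquiv.coe_toAddMonoidHom,
    decomposeAddEquiv_apply, DirectSum.map_apply, DirectSum.zero_apply, ZeroMemClass.coe_zero]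
  exact Ideal.Quotient.eq_zero_iff_mem.mpr (I.isHomogeneous d ha)

/-- The decomposition of an element of `S / I` into its homogeneous components. -/
def quotDecompose : S ⧸ I.toIdeal →+ ⨁ d, grading 𝒜 I d :=
  QuotientAddGroup.lift I.toIdeal.toAddSubgroup (preDecompose 𝒜 I)
    (fun _ ha => AddMonoidHom.mem_ker.mpr (preDecompose_eq_zero 𝒜 I ha))

theorem quotDecompose_mk (a : S) :
    quotDecompose 𝒜 I (Ideal.Quotient.mk I.toIdeal a) = preDecompose 𝒜 I a := rfl

theorem coe_quotDecompose (x : S ⧸ I.toIdeal) :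
    DirectSum.coeAddMonoidHom (grading 𝒜 I) (quotDecompose 𝒜 I x) = x := by
  obtain ⟨a, rfl⟩ := Ideal.Quotient.mk_surjective x
  rw [quotDecompose_mk]
  induction a using DirectSum.Decomposition.inductionOn 𝒜 with
  | zero => simp
  | homogeneous m => rw [preDecompose_of_mem 𝒜 I m.2, DirectSum.coeAddMonoidHom_of]
  | add a b ha hb => rw [map_add, map_add, map_add, ha, hb]

theorem quotDecompose_of (d : ℕ) (x : grading 𝒜 I d) :
    quotDecompose 𝒜 I x = DirectSum.of (fun d => grading 𝒜 I d) d x := by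
  obtain ⟨_, a, ha, rfl⟩ := x
  exact preDecompose_of_mem 𝒜 I ha

instance gradedAlgebra : GradedAlgebra (grading 𝒜 I) :=
  { gradedMonoid 𝒜 I with
    toDecomposition := Decomposition.ofAddHom _ (quotDecompose 𝒜 I)
      (AddMonoidHom.ext (coe_quotDecompose 𝒜 I))
      (DirectSum.addHom_ext fun d x => by
        rw [AddMonoidHom.comp_apply, DirectSum.coeAddMonoidHom_of, quotDecompose_of]
        rfl) }

end GradedQuotient

/-! ### The subscheme of projective space cut out by integral homogeneous equations -/

namespace ProjectiveModel

open MvPolynomial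

instance mvPolynomialGradedAlgebra (σ R : Type*) [CommRing R] :
    GradedAlgebra (homogeneousSubmodule σ R) :=
  MvPolynomial.gradedAlgebra

/-- A homogeneous ideal of `ℤ[x₀, …, xₙ]`. -/
abbrev Equations (n : ℕ) := HomogeneousIdeal (homogeneousSubmodule (Fin (n + 1)) ℤ)

/-- The graded ring homomorphism `ℤ[x₀, …, xₙ] → A[x₀, …, xₙ]`. -/
def coeffHom (n : ℕ) (A : Type) [CommRing A] :
    homogeneousSubmodule (Fin (n + 1)) ℤ →+*ᵍ homogeneousSubmodule (Fin (n + 1)) A where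
  toRingHom := MvPolynomial.map (Int.castRingHom A)
  map_mem h := IsHomogeneous.map h _

variable {n : ℕ} (J : Equations n) (A : Type) [CommRing A]

/-- The homogeneous ideal `J · A[x₀, …, xₙ]`. -/
abbrev idealOver : HomogeneousIdeal (homogeneousSubmodule (Fin (n + 1)) A) :=
  J.map (coeffHom n A)

/-- The grading of `A[x₀, …, xₙ] / J · A[x₀, …, xₙ]` by degree. -/
abbrev coordGrading : ℕ → Submodule A (MvPolynomial (Fin (n + 1)) A ⧸ (idealOver J A).toIdeal) :=
  GradedQuotient.grading (homogeneousSubmodule (Fin (n + 1)) A) (idealOver J A)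

/-- The closed subscheme `V(J)_A` of `ℙⁿ_A` cut out by `J`, that is
`Proj (A[x₀, …, xₙ] / J · A[x₀, …, xₙ])`. -/
abbrev scheme : Scheme.{0} := Proj (coordGrading J A)

/-- The structure morphism `V(J)_A ⟶ Spec A`. -/
def toSpec : scheme J A ⟶ Spec (.of A) :=
  Proj.toSpecZero (coordGrading J A) ≫
    Spec.map (CommRingCat.ofHom (algebraMap A (coordGrading J A 0)))

end ProjectiveModel

/-! ### Genus of a function field of one variable -/

namespace FunctionField1

variable (k F : Type*) [Field k] [Field F] [Algebra k F]

/-- A place of `F / k`: a discrete valuation ring of `F` (with fraction field `F`)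
that contains `k`. -/
structure Place where
  ring : ValuationSubring F
  dvr : IsDiscreteValuationRing ring
  algebraMap_mem : ∀ c : k, algebraMap k F c ∈ ring

attribute [instance] Place.dvr

variable {k F}

/-- The normalised valuation of a place, written multiplicatively: `v_P f = exp (-ord_P f)`. -/
def Place.valuation (P : Place k F) : Valuation F (WithZero (Multiplicative ℤ)) :=
  (IsDiscreteValuationRing.maximalIdeal P.ring).valuation F

/-- The embedding of `k` into the residue field of a place. -/
def Place.residueHom (P : Place k F) : k →+* IsLocalRing.ResidueField P.ring :=
  (IsLocalRing.residue P.ring).comp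
    ((algebraMap k F).codRestrict P.ring.toSubring P.algebraMap_mem)

/-- The degree of a place: the degree of its residue field over `k`. -/
def Place.degree (P : Place k F) : ℕ :=
  letI : Algebra k (IsLocalRing.ResidueField P.ring) := P.residueHom.toAlgebra
  Module.finrank k (IsLocalRing.ResidueField P.ring)

variable (k F) in
/-- Divisors: finite formal `ℤ`-linear combinations of places. -/
abbrev Divisor := Place k F →₀ ℤ

/-- The degree of a divisor. -/
def Divisor.degree (D : Divisor k F) : ℤ := D.sum fun P m => m * P.degree

theorem Place.valuation_algebraMap_le_one (P : Place k F) (c : k) :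
    P.valuation (algebraMap k F c) ≤ 1 :=
  (IsDiscreteValuationRing.maximalIdeal P.ring).valuation_le_one (K := F)
    ⟨algebraMap k F c, P.algebraMap_mem c⟩

/-- The Riemann–Roch space `L(D) = {f ∈ F : ord_P f ≥ -D(P) for all P}`. -/
def riemannRochSpace (D : Divisor k F) : Submodule k F where
  carrier := {f | ∀ P : Place k F, P.valuation f ≤ WithZero.exp (D P)}
  zero_mem' P := by simp
  add_mem' hf hg P := (P.valuation.map_add _ _).trans (max_le (hf P) (hg P))
  smul_mem' c f hf P := by
    rw [Algebra.smul_def, map_mul]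
    exact (mul_le_of_le_one_left' (P.valuation_algebraMap_le_one c)).trans (hf P)

variable (k F) in
/-- The genus of `F / k`: the maximum over all divisors `D` of `deg D - dim_k L(D) + 1`. -/
def genus : ℤ :=
  sSup (Set.range fun D : Divisor k F => D.degree - Module.finrank k (riemannRochSpace D) + 1)

end FunctionField1

/-! ### Curves over a field -/

namespace AlgebraicCurve

/-- A curve over a field `k`: an integral separated `k`-scheme of finite type and dimension `1`. -/
structure IsCurve {k : Type} [Field k] {X : Scheme.{0}} (f : X ⟶ Spec (.of k)) : Prop where
  isIntegral : IsIntegral X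
  isSeparated : IsSeparated f
  locallyOfFiniteType : LocallyOfFiniteType f
  quasiCompact : QuasiCompact f
  dim_eq_one : topologicalKrullDim X = 1

/-- A point of a scheme is nonsingular if its local ring is regular. -/
def IsNonsingularAt (X : Scheme.{0}) (x : X) : Prop :=
  IsRegularLocalRing (X.presheaf.stalk x)

/-- The ring homomorphism from `k` to the function field of an irreducible `k`-scheme. -/
def constantsHom {k : Type} [Field k] {X : Scheme.{0}} [IrreducibleSpace X]
    (f : X ⟶ Spec (.of k)) : k →+* X.functionField :=
  ((Scheme.ΓSpecIso (.of k)).inv ≫ f.appTop ≫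
    X.presheaf.germ ⊤ (genericPoint X) trivial).hom

/-- The (geometric) genus of a curve over `k`: the genus of its function field over `k`
(equivalently, of the regular projective curve with this function field). -/
def geometricGenus {k : Type} [Field k] {X : Scheme.{0}} (f : X ⟶ Spec (.of k))
    (hf : IsCurve f) : ℤ :=
  haveI := hf.isIntegral
  letI : Algebra k X.functionField := (constantsHom f).toAlgebra
  FunctionField1.genus k X.functionField

end AlgebraicCurve

/-! ### Reduction modulo `p` -/

namespace ProjectiveModel

theorem isPrime_span (p : ℕ) [hp : Fact p.Prime] : (Ideal.span {(p : ℤ)}).IsPrime :=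
  (Ideal.span_singleton_prime (Int.natCast_ne_zero.mpr hp.out.ne_zero)).mpr
    (Nat.prime_iff_prime_int.mp hp.out)

/-- The local ring `ℤ_(p)`. -/
abbrev ZAt (p : ℕ) [Fact p.Prime] : Type :=
  haveI := isPrime_span p
  Localization.AtPrime (Ideal.span {(p : ℤ)})

/-- The projective model given by `J` has good reduction at `p`: the closed subscheme of
projective space over `ℤ_(p)` cut out by `J` is smooth over `ℤ_(p)`. -/
def HasGoodReduction {n : ℕ} (J : Equations n) (p : ℕ) [Fact p.Prime] : Prop :=
  Smooth (toSpec J (ZAt p))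

end ProjectiveModel

end

/-!
A generic point of a projective curve over `k`, written in homogeneous coordinates in its function
field `F`, turns forms of degree `d` into elements of `F`; they span a subspace `V_d` of the
Riemann–Roch space `L(d H)`, where `H` is the hyperplane divisor. By Riemann's theorem
`dim L(d H) = d deg H + 1 - g` for large `d`, and the curve is normal if and only if
`V_d = L(d H)` for all large `d`.

Over a discrete valuation ring, the forms of degree `d` vanishing at the generic point of the
generic fibre also vanish on the special fibre: otherwise the Hilbert function of the generic fibre
would be bounded. Hence `dim V_d` is the same for both fibres when `d` is large. The generic fibre
is normal, so this dimension is `d deg H + 1 - g`; as the special fibre has the same genus, its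
`V_d` is also the whole of `L(d H)`, and the special fibre is normal. Over perfect fields normal
curves are smooth. By Nakayama's lemma the model is torsion-free in high degrees, hence flat on
every chart, and a flat model with smooth fibres is smooth.
-/

/-! ### Subalgebras of function fields of one variable -/

namespace FunctionField1

open IntermediateField WithZero
open scoped IntermediateField.algebraAdjoinAdjoin

/-- `F / k` is a function field of one variable: it has transcendental elements, and is finite
over the rational function field generated by any of them. The field of constants may be larger
than `k`. -/
class IsFunctionField (k F : Type*) [Field k] [Field F] [Algebra k F] : Prop where
  exists_transcendental : ∃ x : F, Transcendental k x
  finite_adjoin : ∀ x : F, Transcendental k x → FiniteDimensional k⟮x⟯ F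

section AdjoinSingleton

open Polynomial

theorem X_pow_dvd_of_sum_aeval_mul_eq_zero {k O ι : Type*} [CommRing k] [CommRing O] [IsDomain O]
    [Algebra k O] [Fintype ι] {x : O} (hx : x ≠ 0) {v : ι → O}
    (hv : LinearIndependent k fun i => Ideal.Quotient.mk (Ideal.span {x}) (v i)) (N : ℕ) :
    ∀ {p : ι → k[X]}, ∑ i, aeval x (p i) * v i = 0 → ∀ i, X ^ N ∣ p i := by
  induction N with
  | zero => simp
  | succ N ih =>
    intro p hp
    have constantCoeff (i : ι) : Ideal.Quotient.mk (Ideal.span {x}) (aeval x (p i) * v i) =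
        (p i).coeff 0 • Ideal.Quotient.mk (Ideal.span {x}) (v i) := by
      have hx0 : Ideal.Quotient.mkₐ k (Ideal.span {x}) x = 0 :=
        Ideal.Quotient.eq_zero_iff_mem.mpr (Ideal.mem_span_singleton_self x)
      have h := (aeval_algHom_apply (Ideal.Quotient.mkₐ k (Ideal.span {x})) x (p i)).symm
      rw [hx0, ← coeff_zero_eq_aeval_zero', Ideal.Quotient.mkₐ_eq_mk] at h
      rw [map_mul, h, Algebra.smul_def]
    have hp0 : ∀ i, (p i).coeff 0 = 0 := Fintype.linearIndependent_iff.mp hv _ <| by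
      rw [← map_zero (Ideal.Quotient.mk (Ideal.span {x})), ← hp, map_sum]
      exact Finset.sum_congr rfl fun i _ => (constantCoeff i).symm
    choose q hq using fun i => X_dvd_iff.mpr (hp0 i)
    have hsum : ∑ i, aeval x (q i) * v i = 0 := by
      refine (mul_eq_zero.mp ?_).resolve_left hx
      rw [← hp, Finset.mul_sum]
      exact Finset.sum_congr rfl fun i _ => by rw [hq i, map_mul, aeval_X, mul_assoc]
    intro i
    rw [hq i, pow_succ']
    exact mul_dvd_mul_left X (ih hsum i)

variable {k F : Type*} [Field k] [Field F] [Algebra k F]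

theorem linearIndependent_adjoin_of_quotient {ι : Type*} (O : Subalgebra k F) {x : O}
    (hx : Transcendental k (x : F)) {v : ι → O}
    (hv : LinearIndependent k fun i => Ideal.Quotient.mk (Ideal.span {x}) (v i)) :
    LinearIndependent k⟮(x : F)⟯ fun i => (v i : F) := by
  have hx0 : x ≠ 0 := fun h => hx (by simpa [h] using isAlgebraic_zero)
  rw [← LinearIndependent.iff_fractionRing (Algebra.adjoin k {(x : F)}) k⟮(x : F)⟯,
    linearIndependent_iff_finset_linearIndependent]
  refine fun s => Fintype.linearIndependent_iff.mpr fun g hg => ?_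
  choose p hp using fun i => (Algebra.adjoin_singleton_eq_range_aeval k (x : F)).le (g i).2
  replace hp : ∀ i, aeval (x : F) (p i) = (g i : F) := hp
  have hsum : ∑ i, aeval x (p i) * v i = 0 := Subtype.ext <| by
    have hcoe (q : k[X]) : ((aeval x q : O) : F) = aeval (x : F) q :=
      (aeval_algHom_apply O.val x q).symm
    simpa [Subalgebra.smul_def, hp, hcoe] using hg
  have hv' := hv.comp (Subtype.val : s → ι) Subtype.val_injective
  intro i
  have hpi : p i = 0 := by
    by_contra hne
    have h := natDegree_le_of_dvd
      (X_pow_dvd_of_sum_aeval_mul_eq_zero hx0 hv' ((p i).natDegree + 1) hsum i) hne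
    rw [natDegree_X_pow] at h
    omega
  exact Subtype.ext (by rw [← hp i, hpi]; simp)

end AdjoinSingleton

variable {k F : Type*} [Field k] [Field F] [Algebra k F]

theorem rank_quotient_span_le [IsFunctionField k F] (O : Subalgebra k F) {x : O}
    (hx : Transcendental k (x : F)) :
    Module.rank k (O ⧸ Ideal.span {x}) ≤ Module.finrank k⟮(x : F)⟯ F := by
  have := IsFunctionField.finite_adjoin (x : F) hx
  refine rank_le fun s hs => ?_
  choose v hv using fun i : s => Ideal.Quotient.mk_surjective (I := Ideal.span {x}) i.1
  rw [← Fintype.card_coe]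
  refine (linearIndependent_adjoin_of_quotient O hx (v := v) ?_).fintype_card_le_finrank
  simpa only [hv] using hs

theorem finite_quotient_span [IsFunctionField k F] (O : Subalgebra k F) {x : O}
    (hx : Transcendental k (x : F)) : Module.Finite k (O ⧸ Ideal.span {x}) :=
  haveI : Module.Free k (O ⧸ Ideal.span {x}) := Module.Free.of_divisionRing k _
  Module.rank_lt_aleph0_iff.mp ((rank_quotient_span_le O hx).trans_lt Cardinal.natCast_lt_aleph0)

theorem finrank_le_finrank_adjoin [IsFunctionField k F] (O : Subalgebra k F) {x : O}
    (hx : Transcendental k (x : F)) {V : Submodule k F} (hVO : V ≤ O.toSubmodule)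
    (hVx : ∀ f ∈ V, ∀ g ∈ O, f = x * g → f = 0) :
    Module.finrank k V ≤ Module.finrank k⟮(x : F)⟯ F := by
  have := finite_quotient_span O hx
  let φ : V →ₗ[k] O ⧸ Ideal.span {x} :=
    (Ideal.Quotient.mkₐ k (Ideal.span {x})).toLinearMap ∘ₗ Submodule.inclusion hVO
  have hφ : Function.Injective φ := (injective_iff_map_eq_zero φ).mpr fun f hf => by
    obtain ⟨g, hg⟩ := Ideal.mem_span_singleton.mp (Ideal.Quotient.eq_zero_iff_mem.mp hf)
    exact Subtype.ext (hVx f f.2 g g.2 (congrArg Subtype.val hg))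
  exact (LinearMap.finrank_le_finrank_of_injective hφ).trans
    (Module.finrank_le_of_rank_le (rank_quotient_span_le O hx))

theorem isNoetherianRing_subalgebra [IsFunctionField k F] (O : Subalgebra k F) :
    IsNoetherianRing O := by
  refine ⟨fun I => ?_⟩
  obtain rfl | hI := eq_or_ne I ⊥
  · exact Submodule.fg_bot
  obtain ⟨x, hxI, hx0⟩ := Submodule.exists_mem_ne_zero_of_ne_bot hI
  by_cases hx : IsAlgebraic k (x : F)
  · have hu : IsUnit x := IsUnit.of_mul_eq_one ⟨_, O.inv_mem_of_algebraic hx⟩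
      (Subtype.ext (mul_inv_cancel₀ (by simpa using hx0)))
    rw [Ideal.eq_top_of_isUnit_mem I hxI hu]
    exact Module.Finite.fg_top
  have := finite_quotient_span O hx
  have hN : IsNoetherian O (O ⧸ Ideal.span {x}) :=
    isNoetherian_of_tower k (inferInstance : IsNoetherian k (O ⧸ Ideal.span {x}))
  refine Submodule.fg_of_fg_map_of_fg_inf_ker (Ideal.span {x}).mkQ (hN.noetherian _) ?_
  rw [Submodule.ker_mkQ, inf_eq_right.mpr ((Ideal.span_singleton_le_iff_mem _).mpr hxI)]
  exact ⟨{x}, by simp⟩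

/-- A valuation subring of `F` containing `k`, as a `k`-subalgebra. -/
def toSubalgebra (V : ValuationSubring F) (hV : ∀ c : k, algebraMap k F c ∈ V) :
    Subalgebra k F :=
  { V.toSubring with algebraMap_mem' := hV }

theorem eq_top_of_isField {V : ValuationSubring F} (h : IsField V) : V = ⊤ := by
  refine eq_top_iff.mpr fun x _ => ?_
  obtain ⟨y, rfl⟩ := (h.localization_map_bijective (Rₘ := F) zero_notMem_nonZeroDivisors).2 x
  exact y.2

theorem isDiscreteValuationRing_of_ne_top [IsFunctionField k F] (V : ValuationSubring F)
    (hV : ∀ c : k, algebraMap k F c ∈ V) (htop : V ≠ ⊤) : IsDiscreteValuationRing V := by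
  have : IsNoetherianRing V := isNoetherianRing_subalgebra (toSubalgebra V hV)
  have hdvr := (IsDiscreteValuationRing.TFAE V fun h => htop (eq_top_of_isField h)).out 0 1
  exact hdvr.mpr inferInstance

/-! ### Places and weak approximation -/

theorem lt_exp_iff_le_exp {v : WithZero (Multiplicative ℤ)} {m : ℤ} :
    v < exp m ↔ v ≤ exp (m - 1) := by
  rw [← lt_mul_exp_iff_le exp_ne_zero, ← exp_add, sub_add_cancel]

theorem lt_one_iff_le_exp {v : WithZero (Multiplicative ℤ)} : v < 1 ↔ v ≤ exp (-1) := by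
  rw [← exp_zero, lt_exp_iff_le_exp, zero_sub]

namespace Place

theorem ext_ring {P Q : Place k F} (h : P.ring = Q.ring) : P = Q := by
  cases P; cases Q; cases h; rfl

theorem valuation_le_one_iff (P : Place k F) (f : F) : P.valuation f ≤ 1 ↔ f ∈ P.ring := by
  refine ⟨fun h => ?_, fun h => (IsDiscreteValuationRing.maximalIdeal P.ring).valuation_le_one
    (K := F) ⟨f, h⟩⟩
  obtain ⟨a, rfl⟩ := IsDiscreteValuationRing.exists_lift_of_le_one h
  exact a.2

/-- The valuation ring of a place, as a `k`-subalgebra. -/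
def subalgebra (P : Place k F) : Subalgebra k F := toSubalgebra P.ring P.algebraMap_mem

theorem mem_subalgebra {P : Place k F} {f : F} : f ∈ P.subalgebra ↔ P.valuation f ≤ 1 :=
  (P.valuation_le_one_iff f).symm

theorem valuation_pos (P : Place k F) {f : F} (hf : f ≠ 0) : 0 < P.valuation f :=
  zero_lt_iff.mpr ((Valuation.ne_zero_iff _).mpr hf)

theorem valuation_lt_one_iff (P : Place k F) (f : F) :
    P.valuation f < 1 ↔ f ∈ P.ring.nonunits := by
  rw [ValuationSubring.mem_nonunits_iff_or, ← P.valuation_le_one_iff, map_inv₀]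
  obtain rfl | hf := eq_or_ne f 0
  · simp
  · simp [hf, inv_le_one₀ (P.valuation_pos hf)]

/-- A chosen uniformizer. -/
noncomputable def uniformizer (P : Place k F) : F :=
  ((IsDiscreteValuationRing.maximalIdeal P.ring).valuation_exists_uniformizer F).choose

theorem valuation_uniformizer (P : Place k F) : P.valuation P.uniformizer = exp (-1) :=
  ((IsDiscreteValuationRing.maximalIdeal P.ring).valuation_exists_uniformizer F).choose_spec

theorem uniformizer_ne_zero (P : Place k F) : P.uniformizer ≠ 0 := by
  rw [← Valuation.ne_zero_iff P.valuation, valuation_uniformizer]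
  exact exp_ne_zero

theorem valuation_uniformizer_zpow (P : Place k F) (m : ℤ) :
    P.valuation (P.uniformizer ^ m) = exp (-m) := by
  rw [map_zpow₀, valuation_uniformizer, ← exp_zsmul, smul_neg, smul_eq_mul, mul_one]

theorem valuation_uniformizer_lt_one (P : Place k F) : P.valuation P.uniformizer < 1 := by
  rw [valuation_uniformizer, ← exp_zero, exp_lt_exp]
  omega

theorem ring_ne_top (P : Place k F) : P.ring ≠ ⊤ := fun h => by
  have hmem : P.uniformizer⁻¹ ∈ P.ring := h ▸ trivial
  rw [← valuation_le_one_iff, map_inv₀, inv_le_one₀ (P.valuation_pos P.uniformizer_ne_zero)] at hmem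
  exact hmem.not_gt P.valuation_uniformizer_lt_one

theorem eq_of_ring_le {P Q : Place k F} (h : P.ring ≤ Q.ring) : P = Q :=
  ext_ring (ValuationSubring.eq_of_le_of_ne_top _ h Q.ring_ne_top)

theorem valuation_eq_one_of_isAlgebraic (P : Place k F) {f : F} (hf0 : f ≠ 0)
    (hf : IsAlgebraic k f) : P.valuation f = 1 := by
  have mem_of_inv_mem {g : F} (hg : IsAlgebraic k g) (h : g⁻¹ ∈ P.ring) : g ∈ P.ring := by
    have hinv : IsAlgebraic k ((⟨g⁻¹, h⟩ : P.subalgebra) : F) := hg.inv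
    have hmem := P.subalgebra.inv_mem_of_algebraic hinv
    rwa [inv_inv] at hmem
  have le_one {g : F} (hg : IsAlgebraic k g) : P.valuation g ≤ 1 :=
    (P.valuation_le_one_iff g).mpr ((P.ring.mem_or_inv_mem g).elim id (mem_of_inv_mem hg))
  refine le_antisymm (le_one hf) ?_
  have hinv := le_one hf.inv
  rwa [map_inv₀, inv_le_one₀ (P.valuation_pos hf0)] at hinv

theorem transcendental_of_valuation_ne_one (P : Place k F) {f : F} (hf0 : f ≠ 0)
    (h : P.valuation f ≠ 1) : Transcendental k f :=
  fun hf => h (P.valuation_eq_one_of_isAlgebraic hf0 hf)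

theorem transcendental_uniformizer (P : Place k F) : Transcendental k P.uniformizer :=
  P.transcendental_of_valuation_ne_one P.uniformizer_ne_zero P.valuation_uniformizer_lt_one.ne

/-- The place given by a nontrivial valuation subring containing `k`. -/
def ofValuationSubring [IsFunctionField k F] (V : ValuationSubring F)
    (hV : ∀ c : k, algebraMap k F c ∈ V) (htop : V ≠ ⊤) : Place k F where
  ring := V
  dvr := isDiscreteValuationRing_of_ne_top V hV htop
  algebraMap_mem := hV

theorem exists_valuation_lt_one [IsFunctionField k F] {f : F} (hf : Transcendental k f) :
    ∃ P : Place k F, P.valuation f < 1 := by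
  let A : Subalgebra k F := Algebra.adjoin k {f}
  let f' : A.toSubring := ⟨f, Algebra.self_mem_adjoin_singleton k f⟩
  have hI : Ideal.span {f'} ≠ ⊤ := by
    rw [Ne, Ideal.span_singleton_eq_top]
    intro hu
    obtain ⟨g, hg⟩ := hu.exists_right_inv
    obtain ⟨p, hp⟩ := (Algebra.adjoin_singleton_eq_range_aeval k f).le g.2
    have hfg : f * (g : F) = 1 := congrArg Subtype.val hg
    refine hf ⟨Polynomial.X * p - 1, fun h0 => ?_, ?_⟩
    · simpa using congrArg (Polynomial.eval 0) h0
    · rw [map_sub, map_mul, Polynomial.aeval_X, map_one, sub_eq_zero, ← hfg]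
      exact congrArg (f * ·) hp
  obtain ⟨V, hAV, hV⟩ := Ideal.image_subset_nonunits_valuationSubring (Ideal.span {f'}) hI
  have hfV : f ∈ V.nonunits := hV ⟨f', Ideal.mem_span_singleton_self f', rfl⟩
  have htop : V ≠ ⊤ := by
    rintro rfl
    rw [ValuationSubring.mem_nonunits_iff_or] at hfV
    exact hfV.elim (fun h => hf (h ▸ isAlgebraic_zero)) fun h => h trivial
  exact ⟨ofValuationSubring V (fun c => hAV (A.algebraMap_mem c)) htop,
    (valuation_lt_one_iff _ _).mpr hfV⟩

variable (k F) in
theorem nonempty [IsFunctionField k F] : Nonempty (Place k F) := by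
  obtain ⟨x, hx⟩ := IsFunctionField.exists_transcendental (k := k) (F := F)
  exact ⟨(exists_valuation_lt_one hx).choose⟩

/-- The absolute value `f ↦ 2 ^ (-ord_P f)`; the base is irrelevant. -/
noncomputable def absoluteValue (P : Place k F) : AbsoluteValue F ℝ :=
  (IsDiscreteValuationRing.maximalIdeal P.ring).adicAbv one_lt_two

theorem absoluteValue_le_iff (P : Place k F) {f g : F} :
    P.absoluteValue f ≤ P.absoluteValue g ↔ P.valuation f ≤ P.valuation g :=
  NNReal.coe_le_coe.trans (WithZeroMulInt.toNNReal_strictMono one_lt_two).le_iff_le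

theorem absoluteValue_isNontrivial (P : Place k F) : P.absoluteValue.IsNontrivial := by
  refine ⟨P.uniformizer, P.uniformizer_ne_zero, fun h => P.valuation_uniformizer_lt_one.ne ?_⟩
  rw [← map_one P.absoluteValue] at h
  rw [← map_one P.valuation]
  exact le_antisymm (P.absoluteValue_le_iff.mp h.le) (P.absoluteValue_le_iff.mp h.ge)

theorem eq_of_absoluteValue_isEquiv {P Q : Place k F}
    (h : P.absoluteValue.IsEquiv Q.absoluteValue) : P = Q := by
  refine eq_of_ring_le fun f hf => ?_
  have hle := (P.valuation_le_one_iff f).mpr hf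
  rw [← map_one P.valuation, ← absoluteValue_le_iff, h, absoluteValue_le_iff, map_one] at hle
  exact (Q.valuation_le_one_iff f).mp hle

theorem exists_forall_valuation_sub_le (s : Finset (Place k F)) (u : Place k F → F)
    (D : Place k F → ℤ) : ∃ f : F, ∀ P ∈ s, P.valuation (f - u P) ≤ exp (D P) := by
  have hdense := AbsoluteValue.denseRange_algebraMap_pi (v := fun P : s => P.1.absoluteValue)
    (fun P => P.1.absoluteValue_isNontrivial)
    fun P Q hPQ h => hPQ (Subtype.ext (eq_of_absoluteValue_isEquiv h))
  let radius (P : s) : ℝ := P.1.absoluteValue (P.1.uniformizer ^ (-D P))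
  let center (P : s) : WithAbs P.1.absoluteValue := WithAbs.toAbs _ (u P)
  have hopen : IsOpen (Set.univ.pi fun P : s => Metric.ball (center P) (radius P)) :=
    isOpen_set_pi Set.finite_univ fun P _ => Metric.isOpen_ball
  have hradius (P : s) : 0 < radius P :=
    P.1.absoluteValue.pos (zpow_ne_zero _ P.1.uniformizer_ne_zero)
  obtain ⟨f, hf⟩ := hdense.exists_mem_open hopen
    ⟨center, fun P _ => Metric.mem_ball_self (hradius P)⟩
  refine ⟨f, fun P hP => ?_⟩
  have hdist : dist (WithAbs.toAbs P.absoluteValue f) (center ⟨P, hP⟩) < radius ⟨P, hP⟩ :=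
    hf ⟨P, hP⟩ trivial
  rw [dist_eq_norm, ← WithAbs.toAbs_sub, WithAbs.norm_toAbs_eq] at hdist
  have hle := P.absoluteValue_le_iff.mp hdist.le
  rwa [valuation_uniformizer_zpow, neg_neg] at hle

/-! ### Leading coefficients and residue fields -/

/-- The functions with a pole of order at most `m` at `P`. -/
def ball (P : Place k F) (m : ℤ) : Submodule k F where
  carrier := {f | P.valuation f ≤ exp m}
  zero_mem' := by simp
  add_mem' hf hg := (P.valuation.map_add _ _).trans (max_le hf hg)
  smul_mem' c f hf := by
    rw [Set.mem_ofPred_eq, Algebra.smul_def, map_mul]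
    exact (mul_le_of_le_one_left' (P.valuation_algebraMap_le_one c)).trans hf

theorem mem_ball {P : Place k F} {m : ℤ} {f : F} : f ∈ P.ball m ↔ P.valuation f ≤ exp m := Iff.rfl

theorem mul_zpow_mem_ring {P : Place k F} {m : ℤ} {f : F} (hf : f ∈ P.ball m) :
    f * P.uniformizer ^ m ∈ P.ring := by
  rw [← valuation_le_one_iff, map_mul, valuation_uniformizer_zpow, ← exp_zero,
    ← add_neg_cancel m, exp_add]
  exact mul_le_mul_left hf _

noncomputable instance residueAlgebra (P : Place k F) :
    Algebra k (IsLocalRing.ResidueField P.ring) :=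
  P.residueHom.toAlgebra

/-- The coefficient of `t ^ (-m)`, for `t` the chosen uniformizer at `P`, in the expansion of a
function with a pole of order at most `m`. -/
noncomputable def leadingCoeff (P : Place k F) (m : ℤ) :
    P.ball m →ₗ[k] IsLocalRing.ResidueField P.ring where
  toFun f := IsLocalRing.residue P.ring ⟨f * P.uniformizer ^ m, mul_zpow_mem_ring f.2⟩
  map_add' f g := by
    rw [← map_add]
    exact congrArg _ (Subtype.ext (add_mul _ _ _))
  map_smul' c f := by
    rw [RingHom.id_apply, Algebra.smul_def]
    change _ = IsLocalRing.residue P.ring _ * _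
    rw [← map_mul]
    refine congrArg _ (Subtype.ext ?_)
    change (c • (f : F)) * _ = algebraMap k F c * (f * _)
    rw [Algebra.smul_def, mul_assoc]

theorem leadingCoeff_eq_zero_iff {P : Place k F} {m : ℤ} (f : P.ball m) :
    P.leadingCoeff m f = 0 ↔ (f : F) ∈ P.ball (m - 1) := by
  change IsLocalRing.residue P.ring _ = 0 ↔ _
  rw [IsLocalRing.residue_eq_zero_iff, ← ValuationSubring.coe_mem_nonunits_iff,
    ← valuation_lt_one_iff]
  change P.valuation ((f : F) * _) < 1 ↔ _
  rw [map_mul, valuation_uniformizer_zpow, lt_one_iff_le_exp, exp_neg, ← div_eq_mul_inv,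
    div_le_iff₀ (by exact exp_pos), ← exp_add, neg_add_eq_sub, mem_ball]

theorem leadingCoeff_surjective (P : Place k F) (m : ℤ) :
    Function.Surjective (P.leadingCoeff m) := by
  intro z
  obtain ⟨u, rfl⟩ := IsLocalRing.residue_surjective z
  have hmem : (u : F) * P.uniformizer ^ (-m) ∈ P.ball m := by
    rw [mem_ball, map_mul, valuation_uniformizer_zpow, neg_neg]
    exact mul_le_of_le_one_left' ((P.valuation_le_one_iff _).mpr u.2)
  refine ⟨⟨_, hmem⟩, congrArg (IsLocalRing.residue P.ring) (Subtype.ext ?_)⟩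
  change (u : F) * P.uniformizer ^ (-m) * P.uniformizer ^ m = u
  rw [zpow_neg, inv_mul_cancel_right₀ (zpow_ne_zero m P.uniformizer_ne_zero)]

theorem exists_leadingCoeff_eq (P : Place k F) (s : Finset (Place k F)) (D : Place k F → ℤ)
    (z : IsLocalRing.ResidueField P.ring) :
    ∃ f : P.ball (D P), P.leadingCoeff (D P) f = z ∧ ∀ Q ∈ s, (f : F) ∈ Q.ball (D Q) := by
  classical
  obtain ⟨u, rfl⟩ := P.leadingCoeff_surjective (D P) z
  obtain ⟨f, hf⟩ := exists_forall_valuation_sub_le (insert P s)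
    (Function.update 0 P (u : F)) (fun Q => if Q = P then D P - 1 else D Q)
  have hfu : f - u ∈ P.ball (D P - 1) := by simpa [mem_ball] using hf P (Finset.mem_insert_self P s)
  have hle : P.ball (D P - 1) ≤ P.ball (D P) := fun g hg => hg.trans (exp_le_exp.mpr (by omega))
  have hfP : f ∈ P.ball (D P) := by simpa using add_mem (hle hfu) u.2
  refine ⟨⟨f, hfP⟩, ?_, fun Q hQ => ?_⟩
  · rw [← sub_eq_zero, ← map_sub, leadingCoeff_eq_zero_iff]
    exact hfu
  · obtain rfl | hne := eq_or_ne Q P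
    · exact hfP
    · simpa [mem_ball, hne] using hf Q (Finset.mem_insert_of_mem hQ)

theorem finite_residueField [IsFunctionField k F] (P : Place k F) :
    Module.Finite k (IsLocalRing.ResidueField P.ring) := by
  let π : P.subalgebra := ⟨P.uniformizer, mem_subalgebra.mpr P.valuation_uniformizer_lt_one.le⟩
  let residueₐ : P.subalgebra →ₐ[k] IsLocalRing.ResidueField P.ring :=
    { IsLocalRing.residue P.ring with commutes' := fun _ => rfl }
  have hπ : Ideal.span {π} ≤ RingHom.ker residueₐ :=
    (Ideal.span_singleton_le_iff_mem _).mpr <|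
      (IsLocalRing.residue_eq_zero_iff (R := P.ring) _).mpr <|
      ValuationSubring.coe_mem_nonunits_iff.mp
      ((P.valuation_lt_one_iff _).mp P.valuation_uniformizer_lt_one)
  have := finite_quotient_span P.subalgebra (x := π) P.transcendental_uniformizer
  exact Module.Finite.of_surjective
    (Ideal.Quotient.liftₐ (Ideal.span {π}) residueₐ hπ).toLinearMap
    (Ideal.Quotient.lift_surjective_of_surjective _ hπ
      (IsLocalRing.residue_surjective (R := P.ring)))

theorem degree_pos [IsFunctionField k F] (P : Place k F) : 0 < P.degree :=
  haveI := P.finite_residueField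
  Module.finrank_pos (R := k) (M := IsLocalRing.ResidueField P.ring)

end Place

end FunctionField1

/-! ### Divisors and the number of zeros -/

namespace FunctionField1

open IntermediateField WithZero

variable {k F : Type*} [Field k] [Field F] [Algebra k F]

namespace Divisor

theorem degree_add (D E : Divisor k F) : (D + E).degree = D.degree + E.degree :=
  Finsupp.sum_add_index' (fun _ => by simp) (fun _ _ _ => by ring)

theorem degree_zero : (0 : Divisor k F).degree = 0 := Finsupp.sum_zero_index

theorem degree_single (P : Place k F) (m : ℤ) :
    degree (Finsupp.single P m : Divisor k F) = m * P.degree :=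
  Finsupp.sum_single_index (by simp)

theorem degree_add_single_one (D : Divisor k F) (P : Place k F) :
    (D + Finsupp.single P 1).degree = D.degree + P.degree := by
  rw [degree_add, degree_single, one_mul]

theorem degree_neg (D : Divisor k F) : (-D).degree = -D.degree := by
  rw [eq_neg_iff_add_eq_zero, ← degree_add, neg_add_cancel, degree_zero]

theorem degree_sub (D E : Divisor k F) : (D - E).degree = D.degree - E.degree := by
  rw [sub_eq_add_neg, degree_add, degree_neg, sub_eq_add_neg]

theorem degree_nsmul (n : ℕ) (D : Divisor k F) : (n • D).degree = n * D.degree := by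
  induction n with
  | zero => simp [degree_zero]
  | succ n ih => rw [succ_nsmul, degree_add, ih, Nat.cast_succ, add_one_mul]

theorem degree_nonneg {D : Divisor k F} (h : 0 ≤ D) : 0 ≤ D.degree :=
  Finset.sum_nonneg fun P _ => mul_nonneg (h P) (by positivity)

theorem degree_pos [IsFunctionField k F] {D : Divisor k F} (h : 0 ≤ D) (h0 : D ≠ 0) :
    0 < D.degree := by
  obtain ⟨P, hP⟩ := Finsupp.ne_iff.mp h0
  have hpos : 0 < D P := (h P).lt_of_ne hP.symm
  exact Finset.sum_pos' (fun Q _ => mul_nonneg (h Q) (by positivity))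
    ⟨P, Finsupp.mem_support_iff.mpr hP, mul_pos hpos (by exact_mod_cast P.degree_pos)⟩

theorem exists_forall_apply_le (D : Divisor k F) : ∃ c : ℕ, ∀ P, D P ≤ c := by
  refine ⟨∑ P ∈ D.support, (D P).toNat, fun P => ?_⟩
  by_cases hP : P ∈ D.support
  · refine (Int.self_le_toNat _).trans (Nat.cast_le.mpr ?_)
    exact Finset.single_le_sum (f := fun P => (D P).toNat) (fun _ _ => zero_le) hP
  · rw [Finsupp.notMem_support_iff.mp hP]
    positivity

theorem le_add_single_one (D : Divisor k F) (P : Place k F) : D ≤ D + Finsupp.single P 1 :=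
  le_add_of_nonneg_right (Finsupp.single_nonneg.mpr zero_le_one)

theorem le_induction {D : Divisor k F} {motive : Divisor k F → Prop} (base : motive D)
    (add_place : ∀ E P, D ≤ E → motive E → motive (E + Finsupp.single P 1)) {E : Divisor k F}
    (h : D ≤ E) : motive E := by
  have add_effective (N : Place k F →₀ ℕ) : ∀ E, D ≤ E → motive E →
      motive (E + N.mapRange Nat.cast Nat.cast_zero) := by
    induction N using Finsupp.induction_linear with
    | zero => simp
    | add M N hM hN =>
      intro E hE h
      have hle : E ≤ E + M.mapRange Nat.cast Nat.cast_zero :=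
        le_add_of_nonneg_right fun P => by simp
      rw [Finsupp.mapRange_add Nat.cast_add, ← add_assoc]
      exact hN _ (hE.trans hle) (hM E hE h)
    | single P n =>
      rw [Finsupp.mapRange_single]
      induction n with
      | zero => simp
      | succ n ih =>
        intro E hE h
        rw [Nat.cast_succ, add_comm (n : ℤ), Finsupp.single_add, ← add_assoc]
        exact ih _ (hE.trans (le_add_single_one E P)) (add_place E P hE h)
  have hN : ((E - D).mapRange Int.toNat rfl).mapRange Nat.cast Nat.cast_zero = E - D :=
    Finsupp.ext fun P => by simpa using h P
  simpa only [hN, add_sub_cancel] using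
    add_effective ((E - D).mapRange Int.toNat rfl) D le_rfl base

end Divisor

/-- The functions whose poles at the places of the finite set `s` are bounded by `D`. -/
def semilocalSpace (s : Finset (Place k F)) (D : Divisor k F) : Submodule k F :=
  ⨅ P ∈ s, P.ball (D P)

theorem mem_semilocalSpace {s : Finset (Place k F)} {D : Divisor k F} {f : F} :
    f ∈ semilocalSpace s D ↔ ∀ P ∈ s, f ∈ P.ball (D P) := by
  simp only [semilocalSpace, Submodule.mem_iInf]

theorem semilocalSpace_mono (s : Finset (Place k F)) {D E : Divisor k F} (h : D ≤ E) :
    semilocalSpace s D ≤ semilocalSpace s E := fun _ hf =>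
  mem_semilocalSpace.mpr fun P hP =>
    (mem_semilocalSpace.mp hf P hP).trans (exp_le_exp.mpr (h P))

theorem exists_le_semilocalSpace_disjoint_sub_single [IsFunctionField k F]
    {s : Finset (Place k F)} {P : Place k F} (hP : P ∈ s) (D : Divisor k F) :
    ∃ U ≤ semilocalSpace s D, Module.Finite k U ∧ Module.finrank k U = P.degree ∧
      Disjoint U (semilocalSpace s (D - Finsupp.single P 1)) := by
  have := P.finite_residueField
  let coeff : semilocalSpace s D →ₗ[k] IsLocalRing.ResidueField P.ring :=
    P.leadingCoeff (D P) ∘ₗ Submodule.inclusion fun _ hf => mem_semilocalSpace.mp hf P hP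
  have hcoeff : Function.Surjective coeff := fun z => by
    obtain ⟨f, hfz, hf⟩ := P.exists_leadingCoeff_eq s D z
    exact ⟨⟨f, mem_semilocalSpace.mpr hf⟩, hfz⟩
  obtain ⟨lift, hlift⟩ :=
    coeff.exists_rightInverse_of_surjective (LinearMap.range_eq_top.mpr hcoeff)
  have hlift_apply (z) : coeff (lift z) = z := LinearMap.congr_fun hlift z
  have hinj : Function.Injective (Submodule.subtype _ ∘ₗ lift) :=
    Subtype.val_injective.comp (Function.LeftInverse.injective hlift_apply)
  refine ⟨LinearMap.range (Submodule.subtype _ ∘ₗ lift), ?_, inferInstance,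
    LinearMap.finrank_range_of_inj hinj, ?_⟩
  · rintro _ ⟨z, rfl⟩
    exact (lift z).2
  · rw [Submodule.disjoint_def]
    rintro _ ⟨z, rfl⟩ hz
    have hz0 : coeff (lift z) = 0 := (Place.leadingCoeff_eq_zero_iff _).mpr <| by
      simpa using mem_semilocalSpace.mp hz P hP
    rw [(hlift_apply z).symm.trans hz0, map_zero]

theorem exists_le_semilocalSpace_finrank_eq [IsFunctionField k F] (s : Finset (Place k F))
    {D : Divisor k F} (hD : 0 ≤ D) (hDs : D.support ⊆ s) :
    ∃ V ≤ semilocalSpace s (0 : Divisor k F), Module.Finite k V ∧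
      (Module.finrank k V : ℤ) = D.degree ∧ Disjoint V (semilocalSpace s (-D)) := by
  revert hDs
  refine Divisor.le_induction (motive := fun D => D.support ⊆ s →
    ∃ V ≤ semilocalSpace s 0, Module.Finite k V ∧
      (Module.finrank k V : ℤ) = D.degree ∧ Disjoint V (semilocalSpace s (-D)))
    (fun _ => ?_) (fun E P hE ih hDs => ?_) hD
  · exact ⟨⊥, bot_le, inferInstance, by simp [Divisor.degree_zero], disjoint_bot_left⟩
  · have hle (Q) : E Q ≤ (E + Finsupp.single P 1 : Divisor k F) Q :=
      Divisor.le_add_single_one E P Q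
    obtain ⟨V, hV, _, hVdeg, hVE⟩ := ih fun Q hQ => hDs <| Finsupp.mem_support_iff.mpr
      (((hE Q).lt_of_ne' (Finsupp.mem_support_iff.mp hQ)).trans_le (hle Q)).ne'
    have hPs : P ∈ s := hDs <| Finsupp.mem_support_iff.mpr <| ne_of_gt <| by
      simpa using Int.lt_add_one_of_le (hE P)
    obtain ⟨U, hU, _, hUdeg, hUE⟩ := exists_le_semilocalSpace_disjoint_sub_single hPs (-E)
    rw [← neg_add'] at hUE
    have hVU : Disjoint V (U ⊔ semilocalSpace s (-(E + Finsupp.single P 1))) := hVE.mono_right <|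
      sup_le hU (semilocalSpace_mono s (neg_le_neg (Divisor.le_add_single_one E P)))
    have hsum := Submodule.finrank_sup_add_finrank_inf_eq V U
    rw [(hVU.mono_right le_sup_left).eq_bot, finrank_bot, add_zero] at hsum
    refine ⟨V ⊔ U, sup_le hV (hU.trans (semilocalSpace_mono s (neg_nonpos.mpr hE))), inferInstance,
      ?_, hUE.disjoint_sup_left_of_disjoint_sup_right hVU⟩
    rw [Divisor.degree_add_single_one, hsum, Nat.cast_add, hVdeg, hUdeg]

theorem degree_le_finrank_adjoin [IsFunctionField k F] {x : F} (hx : Transcendental k x)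
    {D : Divisor k F} (hD : 0 ≤ D) (hxD : ∀ P ∈ D.support, P.valuation x ≤ exp (-D P)) :
    D.degree ≤ Module.finrank k⟮x⟯ F := by
  obtain ⟨V, hV, _, hVdeg, hVD⟩ := exists_le_semilocalSpace_finrank_eq D.support hD subset_rfl
  let O : Subalgebra k F := ⨅ P ∈ D.support, P.subalgebra
  have mem_O {f : F} : f ∈ O ↔ ∀ P ∈ D.support, P.valuation f ≤ 1 := by
    simp only [O, Algebra.mem_iInf, Place.mem_subalgebra]
  have hxO : x ∈ O := mem_O.mpr fun P hP => (hxD P hP).trans <| by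
    rw [← exp_zero, exp_le_exp]
    exact neg_nonpos.mpr (hD P)
  rw [← hVdeg, Nat.cast_le]
  refine finrank_le_finrank_adjoin O (x := ⟨x, hxO⟩) hx (fun f hf => ?_) fun f hf g hg hfg => ?_
  · exact mem_O.mpr (mem_semilocalSpace.mp (hV hf))
  · refine Submodule.disjoint_def.mp hVD f hf (mem_semilocalSpace.mpr fun P hP => ?_)
    rw [Place.mem_ball, hfg, map_mul]
    exact (mul_le_of_le_one_right' (mem_O.mp hg P hP)).trans (hxD P hP)

namespace Place

theorem finite_setOf_valuation_lt_one [IsFunctionField k F] {x : F} (hx0 : x ≠ 0) :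
    {P : Place k F | P.valuation x < 1}.Finite := by
  classical
  by_contra hinf
  obtain ⟨P, hP⟩ := Set.Infinite.nonempty hinf
  have hx : Transcendental k x := P.transcendental_of_valuation_ne_one hx0 (ne_of_lt hP)
  obtain ⟨t, hts, htc⟩ := Set.Infinite.exists_subset_card_eq hinf (Module.finrank k⟮x⟯ F + 1)
  let D : Divisor k F := Finsupp.indicator t fun _ _ => 1
  have hD_of_mem {Q : Place k F} (hQ : Q ∈ t) : D Q = 1 := Finsupp.indicator_of_mem hQ _
  have hDt : D.support = t := by
    ext Q
    by_cases hQ : Q ∈ t <;> simp [D, Finsupp.indicator_apply, hQ]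
  have hD : 0 ≤ D := fun Q => by by_cases hQ : Q ∈ t <;> simp [D, Finsupp.indicator_apply, hQ]
  have hle := degree_le_finrank_adjoin hx hD fun Q hQ => by
    rw [hDt] at hQ
    rw [hD_of_mem hQ]
    exact lt_one_iff_le_exp.mp (hts hQ)
  have hcard : (t.card : ℤ) ≤ D.degree := by
    rw [Divisor.degree, Finsupp.sum, hDt, Finset.card_eq_sum_ones, Nat.cast_sum]
    refine Finset.sum_le_sum fun Q hQ => ?_
    rw [hD_of_mem hQ, one_mul]
    exact_mod_cast Q.degree_pos
  omega

theorem finite_setOf_log_valuation_ne_zero [IsFunctionField k F] (x : F) :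
    {P : Place k F | log (P.valuation x) ≠ 0}.Finite := by
  obtain rfl | hx0 := eq_or_ne x 0
  · simp
  refine ((finite_setOf_valuation_lt_one hx0).union
    (finite_setOf_valuation_lt_one (inv_ne_zero hx0))).subset fun P hP => ?_
  have hne : P.valuation x ≠ 1 := fun h => hP (by rw [h, log_one])
  refine hne.lt_or_gt.imp id fun h => ?_
  rw [Set.mem_ofPred_eq, map_inv₀]
  exact inv_lt_one_of_one_lt₀ h

end Place

/-! ### Dimensions of Riemann–Roch spaces -/

theorem riemannRochSpace_mono {D E : Divisor k F} (h : D ≤ E) :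
    riemannRochSpace D ≤ riemannRochSpace E :=
  fun _ hf P => (hf P).trans (exp_le_exp.mpr (h P))

theorem finite_and_finrank_add_single_le [IsFunctionField k F] (D : Divisor k F) (P : Place k F)
    (hfin : Module.Finite k (riemannRochSpace D)) :
    Module.Finite k (riemannRochSpace (D + Finsupp.single P 1)) ∧
      Module.finrank k (riemannRochSpace (D + Finsupp.single P 1)) ≤
        Module.finrank k (riemannRochSpace D) + P.degree := by
  have := P.finite_residueField
  have hball : riemannRochSpace (D + Finsupp.single P 1) ≤ P.ball (D P + 1) := fun f hf => by
    have hfP := hf P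
    rwa [Finsupp.add_apply, Finsupp.single_eq_same] at hfP
  let coeff : riemannRochSpace (D + Finsupp.single P 1) →ₗ[k] IsLocalRing.ResidueField P.ring :=
    P.leadingCoeff (D P + 1) ∘ₗ Submodule.inclusion hball
  have hker : (LinearMap.ker coeff).map (Submodule.subtype _) ≤ riemannRochSpace D := by
    rintro _ ⟨f, hf, rfl⟩ Q
    obtain rfl | hQ := eq_or_ne Q P
    · simpa [Place.mem_ball] using (Place.leadingCoeff_eq_zero_iff _).mp hf
    · simpa [Finsupp.single_eq_of_ne hQ] using f.2 Q
  let ι : LinearMap.ker coeff →ₗ[k] riemannRochSpace D :=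
    Submodule.inclusion hker ∘ₗ
      (Submodule.equivMapOfInjective _ Subtype.val_injective _).toLinearMap
  have hι : Function.Injective ι :=
    (Submodule.inclusion_injective hker).comp (LinearEquiv.injective _)
  have := Module.Finite.of_injective ι hι
  have := Module.Finite.equiv coeff.quotKerEquivRange.symm
  have hfin' := Module.Finite.of_submodule_quotient (LinearMap.ker coeff)
  refine ⟨hfin', ?_⟩
  have hrange : Module.finrank k (LinearMap.range coeff) ≤ P.degree := Submodule.finrank_le _
  have hdim := coeff.finrank_range_add_finrank_ker
  have hdim_ker := LinearMap.finrank_le_finrank_of_injective hι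
  omega

theorem finite_and_finrank_le_of_le [IsFunctionField k F] {D D' : Divisor k F} (h : D ≤ D')
    (hD : Module.Finite k (riemannRochSpace D)) :
    Module.Finite k (riemannRochSpace D') ∧
      (Module.finrank k (riemannRochSpace D') : ℤ) ≤
        Module.finrank k (riemannRochSpace D) + (D'.degree - D.degree) := by
  refine Divisor.le_induction (motive := fun E => Module.Finite k (riemannRochSpace E) ∧
    (Module.finrank k (riemannRochSpace E) : ℤ) ≤
      Module.finrank k (riemannRochSpace D) + (E.degree - D.degree))
    ⟨hD, by simp⟩ (fun E P _ ih => ?_) h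
  · obtain ⟨hfin, hle⟩ := finite_and_finrank_add_single_le E P ih.1
    refine ⟨hfin, ?_⟩
    rw [Divisor.degree_add_single_one]
    have := ih.2
    omega

theorem riemannRochSpace_eq_bot [IsFunctionField k F] {D : Divisor k F} (hD : D ≤ 0)
    {P : Place k F} (hP : D P < 0) : riemannRochSpace D = ⊥ := by
  refine eq_bot_iff.mpr fun f hf => ?_
  by_contra hf0
  replace hf0 : f ≠ 0 := hf0
  have hlt : P.valuation f < 1 := (hf P).trans_lt (by rwa [← exp_zero, exp_lt_exp])
  have htr : Transcendental k f := P.transcendental_of_valuation_ne_one hf0 hlt.ne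
  obtain ⟨Q, hQ⟩ := Place.exists_valuation_lt_one (k := k) (f := f⁻¹)
    (fun h => htr (by simpa using h.inv))
  rw [map_inv₀, inv_lt_one₀ (Q.valuation_pos hf0)] at hQ
  refine hQ.not_ge ((hf Q).trans ?_)
  rw [← exp_zero, exp_le_exp]
  exact hD Q

instance finite_riemannRochSpace [IsFunctionField k F] (D : Divisor k F) :
    Module.Finite k (riemannRochSpace D) := by
  obtain ⟨P⟩ := Place.nonempty k F
  have hP : (-Finsupp.single P 1 : Divisor k F) ≤ 0 :=
    neg_nonpos.mpr (Finsupp.single_nonneg.mpr zero_le_one)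
  have hbot : riemannRochSpace (D ⊓ -Finsupp.single P 1) = ⊥ :=
    riemannRochSpace_eq_bot (P := P) (inf_le_right.trans hP) (by simp)
  refine (finite_and_finrank_le_of_le (D := D ⊓ -Finsupp.single P 1) inf_le_left ?_).1
  rw [hbot]
  infer_instance

theorem finrank_le_of_le [IsFunctionField k F] {D D' : Divisor k F} (h : D ≤ D') :
    (Module.finrank k (riemannRochSpace D') : ℤ) ≤
      Module.finrank k (riemannRochSpace D) + (D'.degree - D.degree) :=
  (finite_and_finrank_le_of_le h inferInstance).2

end FunctionField1

/-! ### Riemann's theorem -/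

namespace FunctionField1

open IntermediateField WithZero
open scoped IntermediateField.algebraAdjoinAdjoin

variable {k F : Type*} [Field k] [Field F] [Algebra k F]

theorem adjoin_inv (x : F) : k⟮x⁻¹⟯ = k⟮x⟯ :=
  le_antisymm (adjoin_simple_le_iff.mpr (inv_mem (mem_adjoin_simple_self k x)))
    (adjoin_simple_le_iff.mpr (by simpa using inv_mem (mem_adjoin_simple_self k x⁻¹)))

theorem Place.valuation_le_one_of_isIntegral (P : Place k F) {A : Subalgebra k F}
    (hA : A ≤ P.subalgebra) {f : F} (hf : IsIntegral A f) : P.valuation f ≤ 1 := by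
  have hfP : IsIntegral P.subalgebra f := by
    obtain ⟨p, hp, hpf⟩ := hf
    refine ⟨p.map (Subalgebra.inclusion hA).toRingHom, hp.map _, ?_⟩
    rw [Polynomial.eval₂_map]
    exact hpf
  obtain ⟨g, rfl⟩ := IsIntegrallyClosed.isIntegral_iff.mp (show IsIntegral P.ring f from hfP)
  exact (P.valuation_le_one_iff _).mpr g.2

theorem valuation_le_one_of_isIntegral_adjoin {x f : F}
    (hf : IsIntegral (Algebra.adjoin k {x}) f) {P : Place k F} (hP : P.valuation x ≤ 1) :
    P.valuation f ≤ 1 :=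
  P.valuation_le_one_of_isIntegral
    (Algebra.adjoin_le (by simpa using Place.mem_subalgebra.mpr hP)) hf

theorem linearIndependent_pow_of_transcendental {x : F} (hx : Transcendental k x) :
    LinearIndependent k fun n : ℕ => x ^ n := by
  have hker : LinearMap.ker (Polynomial.aeval (R := k) x).toLinearMap = ⊥ :=
    LinearMap.ker_eq_bot.mpr (transcendental_iff_injective.mp hx)
  simpa [Function.comp_def, Polynomial.aeval_monomial] using
    (Polynomial.basisMonomials k).linearIndependent.map' _ hker

theorem linearIndependent_pow_mul {x : F} (hx : Transcendental k x) {ι : Type*}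
    {u : ι → F} (hu : LinearIndependent k⟮x⟯ u) :
    LinearIndependent k (fun p : ℕ × ι => x ^ p.1 * u p.2) := by
  have hgen : LinearIndependent k fun n : ℕ => AdjoinSimple.gen k x ^ n :=
    linearIndependent_pow_of_transcendental <| by
      rwa [← transcendental_algebraMap_iff (FaithfulSMul.algebraMap_injective k⟮x⟯ F),
        AdjoinSimple.algebraMap_gen]
  exact linearIndependent_smul hgen hu

variable [IsFunctionField k F]

variable (k) in
/-- The divisor `∑ log (v_P x) P` of `x⁻¹`: valuations are multiplicative, so poles of `x` count
positively. -/
noncomputable def logDiv (x : F) : Divisor k F :=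
  Finsupp.ofSupportFinite (fun P => log (P.valuation x))
    (Place.finite_setOf_log_valuation_ne_zero x)

variable (k) in
/-- The divisor of poles of `x`. -/
noncomputable def poleDiv (x : F) : Divisor k F := logDiv k x ⊔ 0

theorem logDiv_apply (x : F) (P : Place k F) : logDiv k x P = log (P.valuation x) := rfl

theorem poleDiv_apply (x : F) (P : Place k F) : poleDiv k x P = max (log (P.valuation x)) 0 := rfl

theorem poleDiv_nonneg (x : F) : 0 ≤ poleDiv k x := le_sup_right

theorem valuation_le_exp_poleDiv (x : F) (P : Place k F) :
    P.valuation x ≤ exp (poleDiv k x P) := by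
  obtain rfl | hx := eq_or_ne x 0
  · simp
  · rw [← log_le_iff_le_exp (P.valuation_pos hx).ne']
    exact le_max_left _ _

theorem valuation_eq_exp_poleDiv {x : F} {P : Place k F} (h : poleDiv k x P ≠ 0) :
    P.valuation x = exp (poleDiv k x P) := by
  have hlog : poleDiv k x P = log (P.valuation x) :=
    max_eq_left (le_of_not_ge fun hle => h (max_eq_right hle))
  rw [hlog, exp_log fun h0 => h (by rw [hlog, h0, log_zero])]

theorem one_le_poleDiv {x : F} {P : Place k F} (h : 1 < P.valuation x) : 1 ≤ poleDiv k x P := by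
  have hlog : 0 < log (P.valuation x) := by
    rwa [← log_one, log_lt_log one_ne_zero (zero_lt_one.trans h).ne']
  exact Int.add_one_le_of_lt (hlog.trans_le (le_max_left _ _))

theorem logDiv_inv (x : F) : logDiv k x⁻¹ = -logDiv k x := by
  ext P
  rw [logDiv_apply, Finsupp.neg_apply, logDiv_apply, map_inv₀, log_inv]

theorem logDiv_eq_sub (x : F) : logDiv k x = poleDiv k x - poleDiv k x⁻¹ := by
  ext P
  rw [Finsupp.sub_apply, poleDiv_apply, poleDiv_apply, logDiv_apply, map_inv₀, log_inv]
  omega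

theorem degree_poleDiv_le {x : F} (hx : Transcendental k x) :
    (poleDiv k x).degree ≤ Module.finrank k⟮x⟯ F := by
  have hx_inv : Transcendental k x⁻¹ := fun h => hx (by simpa using h.inv)
  rw [← adjoin_inv]
  refine degree_le_finrank_adjoin hx_inv (poleDiv_nonneg x) fun P hP => ?_
  rw [map_inv₀, exp_neg, valuation_eq_exp_poleDiv (Finsupp.mem_support_iff.mp hP)]

theorem exists_forall_ge_mem_nsmul_poleDiv {x f : F}
    (hf : ∀ P : Place k F, P.valuation x ≤ 1 → P.valuation f ≤ 1) :
    ∃ c : ℕ, ∀ m ≥ c, f ∈ riemannRochSpace (m • poleDiv k x) := by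
  obtain ⟨c, hc⟩ := (poleDiv k f).exists_forall_apply_le
  refine ⟨c, fun m hm P => ?_⟩
  rw [Finsupp.smul_apply, nsmul_eq_mul]
  by_cases hP : P.valuation x ≤ 1
  · refine (hf P hP).trans ?_
    rw [← exp_zero, exp_le_exp]
    exact mul_nonneg (by positivity) (poleDiv_nonneg x P)
  · refine (valuation_le_exp_poleDiv f P).trans (exp_le_exp.mpr ?_)
    have hcm : poleDiv k f P ≤ m := (hc P).trans (by exact_mod_cast hm)
    exact hcm.trans (le_mul_of_one_le_right (by positivity) (one_le_poleDiv (not_le.mp hP)))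

theorem exists_linearIndependent_mem_nsmul_poleDiv {x : F} (hx : Transcendental k x) :
    ∃ (u : Fin (Module.finrank k⟮x⟯ F) → F) (c : ℕ), LinearIndependent k⟮x⟯ u ∧
      ∀ i, u i ∈ riemannRochSpace (c • poleDiv k x) := by
  have := IsFunctionField.finite_adjoin x hx
  let b := Module.finBasis k⟮x⟯ F
  have hint (i) : ∃ y : Algebra.adjoin k {x},
      y ≠ 0 ∧ IsIntegral (Algebra.adjoin k {x}) (y • b i) :=
    IsAlgebraic.exists_integral_multiple
      (isAlgebraic_adjoin_iff.mp (Algebra.IsAlgebraic.isAlgebraic (b i)))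
  choose y hy0 hy using hint
  have hy0' (i) : algebraMap (Algebra.adjoin k {x}) k⟮x⟯ (y i) ≠ 0 := fun h =>
    hy0 i ((map_eq_zero_iff _ (IsFractionRing.injective (Algebra.adjoin k {x}) k⟮x⟯)).mp h)
  have hpole (i) : ∃ c : ℕ, ∀ m ≥ c, y i • b i ∈ riemannRochSpace (m • poleDiv k x) :=
    exists_forall_ge_mem_nsmul_poleDiv fun P hP => valuation_le_one_of_isIntegral_adjoin (hy i) hP
  choose c hc using hpole
  refine ⟨fun i => y i • b i, ∑ i, c i, ?_, fun i => hc i _ ?_⟩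
  · convert b.linearIndependent.units_smul (fun i => Units.mk0 _ (hy0' i)) using 1
    funext i
    exact (algebraMap_smul k⟮x⟯ (y i) (b i)).symm
  · exact Finset.single_le_sum (f := c) (fun _ _ => Nat.zero_le _) (Finset.mem_univ i)

theorem exists_le_finrank_nsmul_poleDiv {x : F} (hx : Transcendental k x) :
    ∃ c : ℕ, ∀ l : ℕ, Module.finrank k⟮x⟯ F * (l + 1) ≤
      Module.finrank k (riemannRochSpace ((c + l) • poleDiv k x)) := by
  obtain ⟨u, c, hu, huc⟩ := exists_linearIndependent_mem_nsmul_poleDiv hx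
  refine ⟨c, fun l => ?_⟩
  have hmem (p : Fin (l + 1) × Fin (Module.finrank k⟮x⟯ F)) :
      x ^ (p.1 : ℕ) * u p.2 ∈ riemannRochSpace ((c + l) • poleDiv k x) := fun P => by
    have hpow := pow_le_pow_left₀ zero_le (valuation_le_exp_poleDiv x P) (p.1 : ℕ)
    rw [map_mul, map_pow]
    refine (mul_le_mul' hpow (huc p.2 P)).trans ?_
    rw [← exp_nsmul, ← exp_add, exp_le_exp, Finsupp.smul_apply, Finsupp.smul_apply, ← add_nsmul,
      add_comm]
    exact nsmul_le_nsmul_left (poleDiv_nonneg x P) (by omega)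
  have hli : LinearIndependent k (fun p => (⟨_, hmem p⟩ : riemannRochSpace _)) :=
    .of_comp (riemannRochSpace ((c + l) • poleDiv k x)).subtype <|
      (linearIndependent_pow_mul hx hu).comp (Prod.map Fin.val id)
        (Fin.val_injective.prodMap Function.injective_id)
  simpa [mul_comm] using hli.fintype_card_le_finrank

theorem degree_poleDiv {x : F} (hx : Transcendental k x) :
    (poleDiv k x).degree = Module.finrank k⟮x⟯ F := by
  refine le_antisymm (degree_poleDiv_le hx) ?_
  by_contra! hlt
  obtain ⟨c, hc⟩ := exists_le_finrank_nsmul_poleDiv hx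
  set n := Module.finrank k⟮x⟯ F
  set d := (poleDiv k x).degree
  set ℓ₀ := Module.finrank k (riemannRochSpace (0 : Divisor k F))
  have hd : 0 ≤ d := Divisor.degree_nonneg (poleDiv_nonneg x)
  have hgrowth (l : ℕ) : (n : ℤ) * (l + 1) ≤ ℓ₀ + (c + l) * d := by
    have hle := finrank_le_of_le (nsmul_nonneg (poleDiv_nonneg (k := k) x) (c + l))
    rw [Divisor.degree_nsmul, Divisor.degree_zero, sub_zero, Nat.cast_add] at hle
    exact le_trans (by exact_mod_cast hc l) hle
  have hl := hgrowth (ℓ₀ + c * d.toNat)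
  push_cast [Int.toNat_of_nonneg hd] at hl
  have hn : (d + 1) * (ℓ₀ + c * d + 1) ≤ n * (ℓ₀ + c * d + 1) :=
    mul_le_mul_of_nonneg_right (by omega) (by positivity)
  nlinarith

theorem degree_logDiv {x : F} (hx0 : x ≠ 0) : (logDiv k x).degree = 0 := by
  by_cases hx : IsAlgebraic k x
  · have hdiv : logDiv k x = 0 := Finsupp.ext fun P => by
      rw [logDiv_apply, P.valuation_eq_one_of_isAlgebraic hx0 hx, log_one, Finsupp.zero_apply]
    rw [hdiv, Divisor.degree_zero]
  · have hx_inv : Transcendental k x⁻¹ := fun h => hx (by simpa using h.inv)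
    rw [logDiv_eq_sub, Divisor.degree_sub, degree_poleDiv hx, degree_poleDiv hx_inv, adjoin_inv,
      sub_self]

theorem finrank_le_finrank_add_logDiv {z : F} (hz : z ≠ 0) (D : Divisor k F) :
    Module.finrank k (riemannRochSpace D) ≤
      Module.finrank k (riemannRochSpace (D + logDiv k z)) := by
  have hinj : Function.Injective (LinearMap.mulLeft k z) := mul_right_injective₀ hz
  rw [(Submodule.equivMapOfInjective _ hinj (riemannRochSpace D)).finrank_eq]
  refine Submodule.finrank_mono ?_
  rintro _ ⟨f, hf, rfl⟩ P
  rw [LinearMap.mulLeft_apply, map_mul, Finsupp.add_apply, logDiv_apply, exp_add,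
    exp_log (P.valuation_pos hz).ne', mul_comm]
  exact mul_le_mul_left (hf P) _

theorem finrank_add_logDiv {z : F} (hz : z ≠ 0) (D : Divisor k F) :
    Module.finrank k (riemannRochSpace (D + logDiv k z)) =
      Module.finrank k (riemannRochSpace D) := by
  refine le_antisymm ?_ (finrank_le_finrank_add_logDiv hz D)
  have h := finrank_le_finrank_add_logDiv (inv_ne_zero hz) (D + logDiv k z)
  rwa [logDiv_inv, add_neg_cancel_right] at h

theorem degree_sub_finrank_mono {D E : Divisor k F} (h : D ≤ E) :
    D.degree - Module.finrank k (riemannRochSpace D) ≤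
      E.degree - Module.finrank k (riemannRochSpace E) := by
  have := finrank_le_of_le h
  omega

theorem degree_sub_finrank_le_of_finrank_pos {D E : Divisor k F}
    (h : 0 < Module.finrank k (riemannRochSpace (E - D))) :
    D.degree - Module.finrank k (riemannRochSpace D) ≤
      E.degree - Module.finrank k (riemannRochSpace E) := by
  obtain ⟨⟨z, hz⟩, hz0⟩ := Module.finrank_pos_iff_exists_ne_zero.mp h
  replace hz0 : z ≠ 0 := fun h => hz0 (Subtype.ext h)
  have hle : D + logDiv k z ≤ E := fun P => by
    have hzP := hz P
    rw [← log_le_iff_le_exp (P.valuation_pos hz0).ne', Finsupp.sub_apply] at hzP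
    rw [Finsupp.add_apply, logDiv_apply]
    omega
  have hmono := degree_sub_finrank_mono hle
  rwa [Divisor.degree_add, degree_logDiv hz0, add_zero, finrank_add_logDiv hz0] at hmono

variable (k F) in
theorem exists_forall_degree_sub_finrank_le : ∃ γ : ℤ, ∀ D : Divisor k F,
    D.degree - Module.finrank k (riemannRochSpace D) ≤ γ := by
  obtain ⟨x, hx⟩ := IsFunctionField.exists_transcendental (k := k) (F := F)
  obtain ⟨c, hc⟩ := exists_le_finrank_nsmul_poleDiv hx
  have hn : 0 < Module.finrank k⟮x⟯ F := by
    have := IsFunctionField.finite_adjoin x hx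
    exact Module.finrank_pos
  set n := Module.finrank k⟮x⟯ F
  refine ⟨n * c, fun D => ?_⟩
  set l := (D ⊔ 0).degree.toNat
  have hD0 : 0 ≤ D ⊔ 0 := le_sup_right
  have hl : (l : ℤ) = (D ⊔ 0).degree := Int.toNat_of_nonneg (Divisor.degree_nonneg hD0)
  have hcl : (n : ℤ) * (l + 1) ≤ Module.finrank k (riemannRochSpace ((c + l) • poleDiv k x)) := by
    exact_mod_cast hc l
  have hpos : 0 < Module.finrank k (riemannRochSpace ((c + l) • poleDiv k x - D ⊔ 0)) := by
    have hle := finrank_le_of_le (sub_le_self ((c + l) • poleDiv k x) hD0)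
    rw [Divisor.degree_sub] at hle
    have : (0 : ℤ) < Module.finrank k (riemannRochSpace ((c + l) • poleDiv k x - D ⊔ 0)) := by
      nlinarith
    exact_mod_cast this
  calc D.degree - Module.finrank k (riemannRochSpace D)
      ≤ (D ⊔ 0).degree - Module.finrank k (riemannRochSpace (D ⊔ 0)) :=
        degree_sub_finrank_mono le_sup_left
    _ ≤ ((c + l) • poleDiv k x).degree -
          Module.finrank k (riemannRochSpace ((c + l) • poleDiv k x)) :=
        degree_sub_finrank_le_of_finrank_pos hpos
    _ ≤ n * c := by
        rw [Divisor.degree_nsmul, degree_poleDiv hx, Nat.cast_add]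
        nlinarith

theorem bddAbove_degree_sub_finrank_add_one : BddAbove (Set.range fun D : Divisor k F =>
    D.degree - Module.finrank k (riemannRochSpace D) + 1) := by
  obtain ⟨γ, hγ⟩ := exists_forall_degree_sub_finrank_le k F
  exact ⟨γ + 1, Set.forall_mem_range.mpr fun D => Int.add_le_add_right (hγ D) 1⟩

theorem degree_sub_finrank_add_one_le_genus (D : Divisor k F) :
    D.degree - Module.finrank k (riemannRochSpace D) + 1 ≤ genus k F :=
  le_csSup bddAbove_degree_sub_finrank_add_one ⟨D, rfl⟩

theorem eventually_finrank_nsmul_eq {E : Divisor k F} (hE : 0 < E.degree) :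
    ∀ᶠ d : ℕ in Filter.atTop,
      (Module.finrank k (riemannRochSpace (d • E)) : ℤ) = d * E.degree + 1 - genus k F := by
  obtain ⟨D, hD⟩ : genus k F ∈ _ :=
    Int.csSup_mem (Set.range_nonempty _) (bddAbove_degree_sub_finrank_add_one (k := k))
  dsimp only at hD
  obtain ⟨γ, hγ⟩ := exists_forall_degree_sub_finrank_le k F
  filter_upwards [Filter.eventually_ge_atTop (D.degree + γ + 1).toNat] with d hd
  have hpos : 0 < Module.finrank k (riemannRochSpace (d • E - D)) := by
    have hbound := hγ (d • E - D)
    rw [Divisor.degree_sub, Divisor.degree_nsmul] at hbound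
    have hd' : D.degree + γ + 1 ≤ d := by omega
    have : (0 : ℤ) < Module.finrank k (riemannRochSpace (d • E - D)) := by nlinarith
    exact_mod_cast this
  have hle := degree_sub_finrank_add_one_le_genus (d • E)
  have hge := degree_sub_finrank_le_of_finrank_pos hpos
  rw [Divisor.degree_nsmul] at hle hge
  omega

end FunctionField1

/-! ### Forms on a projectively embedded curve -/

namespace FunctionField1

open IntermediateField WithZero MvPolynomial

variable {k F : Type*} [Field k] [Field F] [Algebra k F] {σ : Type*}

variable (k) in
/-- The values of the forms of degree `d` at the point with homogeneous coordinates `y`: the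
degree `d` part of the homogeneous coordinate ring of the curve with generic point `y`. -/
noncomputable def formValues (y : σ → F) (d : ℕ) : Submodule k F :=
  (homogeneousSubmodule σ k d).map (aeval y).toLinearMap

variable (k) in
/-- The coordinate ring of the affine chart `y_j ≠ 0` of the curve with generic point `y`. -/
noncomputable def chart (y : σ → F) (j : σ) : Subalgebra k F :=
  Algebra.adjoin k (Set.range fun i => y i / y j)

section formValues

variable {y : σ → F}

theorem mem_formValues {d : ℕ} {f : F} :
    f ∈ formValues k y d ↔ ∃ p : MvPolynomial σ k, p.IsHomogeneous d ∧ aeval y p = f := Iff.rfl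

theorem mul_mem_formValues {a b : ℕ} {f g : F} (hf : f ∈ formValues k y a)
    (hg : g ∈ formValues k y b) : f * g ∈ formValues k y (a + b) := by
  obtain ⟨p, hp, rfl⟩ := mem_formValues.mp hf
  obtain ⟨q, hq, rfl⟩ := mem_formValues.mp hg
  exact mem_formValues.mpr ⟨p * q, hp.mul hq, map_mul _ _ _⟩

theorem pow_mem_formValues {a : ℕ} {f : F} (hf : f ∈ formValues k y a) (m : ℕ) :
    f ^ m ∈ formValues k y (a * m) := by
  obtain ⟨p, hp, rfl⟩ := mem_formValues.mp hf
  exact mem_formValues.mpr ⟨p ^ m, hp.pow m, map_pow _ _ _⟩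

theorem one_mem_formValues_zero : (1 : F) ∈ formValues k y 0 :=
  mem_formValues.mpr ⟨1, isHomogeneous_one σ k, map_one _⟩

theorem prod_mem_formValues {ι : Type*} (s : Finset ι) {a : ι → ℕ} {f : ι → F}
    (hf : ∀ i ∈ s, f i ∈ formValues k y (a i)) : ∏ i ∈ s, f i ∈ formValues k y (∑ i ∈ s, a i) := by
  classical
  induction s using Finset.induction_on with
  | empty => simpa using one_mem_formValues_zero
  | insert i s hi ih =>
    rw [Finset.prod_insert hi, Finset.sum_insert hi]
    exact mul_mem_formValues (hf i (Finset.mem_insert_self i s))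
      (ih fun j hj => hf j (Finset.mem_insert_of_mem hj))

theorem coord_mem_formValues (i : σ) : y i ∈ formValues k y 1 :=
  mem_formValues.mpr ⟨X i, isHomogeneous_X k i, aeval_X _ _⟩

theorem coord_pow_mem_formValues (i : σ) (m : ℕ) : y i ^ m ∈ formValues k y m := by
  simpa using pow_mem_formValues (k := k) (coord_mem_formValues i) m

theorem formValues_mono {i₀ : σ} (h : y i₀ = 1) {a b : ℕ} (hab : a ≤ b) :
    formValues k y a ≤ formValues k y b := fun f hf => by
  have hmul := mul_mem_formValues hf (coord_pow_mem_formValues (k := k) i₀ (b - a))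
  rwa [h, one_pow, mul_one, Nat.add_sub_cancel' hab] at hmul

theorem exists_mul_pow_mem_formValues {j : σ} (hj : y j ≠ 0) {f : F} (hf : f ∈ chart k y j) :
    ∃ N : ℕ, f * y j ^ N ∈ formValues k y N := by
  induction hf using Algebra.adjoin_induction with
  | mem f hf =>
    obtain ⟨i, rfl⟩ := hf
    refine ⟨1, ?_⟩
    rw [pow_one]
    simp only [div_mul_cancel₀ _ hj]
    exact coord_mem_formValues i
  | algebraMap c =>
    refine ⟨0, ?_⟩
    rw [pow_zero, mul_one, Algebra.algebraMap_eq_smul_one]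
    exact Submodule.smul_mem _ _ one_mem_formValues_zero
  | add f g _ _ hf hg =>
    obtain ⟨N, hN⟩ := hf
    obtain ⟨M, hM⟩ := hg
    refine ⟨N + M, ?_⟩
    have hfM := mul_mem_formValues hN (coord_pow_mem_formValues (k := k) j M)
    have hgN := mul_mem_formValues hM (coord_pow_mem_formValues (k := k) j N)
    rw [add_comm M N] at hgN
    convert add_mem hfM hgN using 1
    ring
  | mul f g _ _ hf hg =>
    obtain ⟨N, hN⟩ := hf
    obtain ⟨M, hM⟩ := hg
    refine ⟨N + M, ?_⟩
    convert mul_mem_formValues hN hM using 1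
    ring

theorem formValues_le_of_monomials {d : ℕ} {T : Submodule k F}
    (h : ∀ m : σ →₀ ℕ, m.degree = d → (m.prod fun i n => y i ^ n) ∈ T) :
    formValues k y d ≤ T := by
  intro f hf
  obtain ⟨p, hp, rfl⟩ := mem_formValues.mp hf
  rw [aeval_def, eval₂_eq]
  refine T.sum_mem fun m hm => ?_
  rw [← Algebra.smul_def]
  refine T.smul_mem _ (h m ?_)
  rw [Finsupp.degree_eq_weight_one]
  exact hp (mem_support_iff.mp hm)

theorem aeval_div_of_isHomogeneous (y : σ → F) (j : σ) {d : ℕ} {g : MvPolynomial σ k}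
    (hg : g.IsHomogeneous d) : aeval (fun i => y i / y j) g = aeval y g / y j ^ d := by
  rw [aeval_def, aeval_def, eval₂_eq, eval₂_eq, Finset.sum_div]
  refine Finset.sum_congr rfl fun m hm => ?_
  have hd : m.degree = d := by
    rw [Finsupp.degree_eq_weight_one]
    exact hg (mem_support_iff.mp hm)
  rw [mul_div_assoc, ← hd, Finsupp.degree_apply, ← Finset.prod_pow_eq_pow_sum,
    ← Finset.prod_div_distrib]
  simp_rw [div_pow]

theorem div_pow_mem_chart {j : σ} {d : ℕ} {f : F} (hf : f ∈ formValues k y d) :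
    f / y j ^ d ∈ chart k y j := by
  obtain ⟨p, hp, rfl⟩ := mem_formValues.mp hf
  rw [← aeval_div_of_isHomogeneous y j hp, chart, Algebra.adjoin_range_eq_range_aeval]
  exact ⟨p, rfl⟩

end formValues

/-- `D` is the divisor of poles of the linear system spanned by the coordinates `y`, that is, a
hyperplane section of the curve with generic point `y`. -/
structure IsHyperplaneDivisor (y : σ → F) (D : Divisor k F) : Prop where
  nonneg : 0 ≤ D
  le : ∀ P i, P.valuation (y i) ≤ exp (D P)
  eq : ∀ P, ∃ i, P.valuation (y i) = exp (D P)

theorem Place.valuation_pow_add_pow_eq (P : Place k F) {u w : F} {c : ℤᵐ⁰} {a b : ℕ} (ha : a ≠ 0)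
    (hu : P.valuation u = c ^ a) (hw : P.valuation w < c ^ b) :
    P.valuation (u ^ b + w ^ a) = c ^ (a * b) := by
  have hub : P.valuation (u ^ b) = c ^ (a * b) := by rw [map_pow, hu, pow_mul]
  rw [P.valuation.map_add_eq_of_lt_left, hub]
  rw [hub, map_pow, mul_comm, pow_mul]
  exact pow_lt_pow_left₀ hw zero_le ha

namespace IsHyperplaneDivisor

variable {y : σ → F} {D : Divisor k F}

theorem valuation_le (hD : IsHyperplaneDivisor y D) {d : ℕ} {f : F}
    (hf : f ∈ formValues k y d) (P : Place k F) : P.valuation f ≤ exp (D P) ^ d := by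
  have hle : formValues k y d ≤ P.ball (d • D P) := formValues_le_of_monomials fun m hm => by
    rw [Place.mem_ball, Finsupp.prod, map_prod, exp_nsmul, ← hm, Finsupp.degree_apply,
      ← Finset.prod_pow_eq_pow_sum]
    refine Finset.prod_le_prod' fun i _ => ?_
    rw [map_pow]
    exact pow_le_pow_left₀ zero_le (hD.le P i) _
  rw [← exp_nsmul]
  exact hle hf

theorem formValues_le (hD : IsHyperplaneDivisor y D) (d : ℕ) :
    formValues k y d ≤ riemannRochSpace (d • D) := fun f hf P => by
  rw [Finsupp.smul_apply, exp_nsmul]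
  exact hD.valuation_le hf P

theorem exists_form_forall_valuation_lt (hD : IsHyperplaneDivisor y D) (P : Place k F)
    {s : Finset (Place k F)}
    (hs : ∀ Q ∈ s, ∃ e, ∃ u ∈ formValues k y e,
      P.valuation u = exp (D P) ^ e ∧ Q.valuation u < exp (D Q) ^ e) :
    ∃ e, 0 < e ∧ ∃ u ∈ formValues k y e,
      P.valuation u = exp (D P) ^ e ∧ ∀ Q ∈ s, Q.valuation u < exp (D Q) ^ e := by
  classical
  induction s using Finset.induction_on with
  | empty =>
    obtain ⟨i, hi⟩ := hD.eq P
    exact ⟨1, one_pos, y i, coord_mem_formValues i, by rw [hi, pow_one], by simp⟩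
  | insert Q s _ ih =>
    obtain ⟨e, he, u, hu, huP, hus⟩ := ih fun R hR => hs R (Finset.mem_insert_of_mem hR)
    obtain ⟨e', u', hu', hu'P, hu'Q⟩ := hs Q (Finset.mem_insert_self Q s)
    refine ⟨e + e', by omega, u * u', mul_mem_formValues hu hu', ?_, fun R hR => ?_⟩
    · rw [map_mul, huP, hu'P, pow_add]
    · rw [map_mul, pow_add]
      obtain rfl | hRs := Finset.mem_insert.mp hR
      · exact mul_lt_mul_of_le_of_lt_of_nonneg_of_pos (hD.valuation_le hu R) hu'Q zero_le
          (pow_pos exp_pos _)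
      · exact mul_lt_mul_of_lt_of_le_of_nonneg_of_pos (hus R hRs) (hD.valuation_le hu' R) zero_le
          (pow_pos exp_pos _)

theorem exists_form_forall_valuation_eq (hD : IsHyperplaneDivisor y D) (i₀ : σ)
    (s : Finset (Place k F)) :
    ∃ e, 0 < e ∧ ∃ w ∈ formValues k y e, ∀ P ∈ s, P.valuation w = exp (D P) ^ e := by
  classical
  induction s using Finset.strongInduction with
  | H s ih =>
    obtain rfl | ⟨P, hP⟩ := s.eq_empty_or_nonempty
    · exact ⟨1, one_pos, y i₀, coord_mem_formValues i₀, by simp⟩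
    by_cases hsep : ∀ Q ∈ s.erase P, ∃ e, ∃ u ∈ formValues k y e,
        P.valuation u = exp (D P) ^ e ∧ Q.valuation u < exp (D Q) ^ e
    · obtain ⟨a, ha, u, hu, huP, hus⟩ := hD.exists_form_forall_valuation_lt P hsep
      obtain ⟨b, hb, w, hw, hws⟩ := ih _ (Finset.erase_ssubset hP)
      obtain hwP | hwP := (hD.valuation_le hw P).eq_or_lt
      · refine ⟨b, hb, w, hw, fun Q hQ => ?_⟩
        obtain rfl | hQP := eq_or_ne Q P
        · exact hwP
        · exact hws Q (Finset.mem_erase.mpr ⟨hQP, hQ⟩)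
      · refine ⟨a * b, Nat.mul_pos ha hb, u ^ b + w ^ a, add_mem (pow_mem_formValues hu b) ?_,
          fun Q hQ => ?_⟩
        · exact mul_comm a b ▸ pow_mem_formValues hw a
        · obtain rfl | hQP := eq_or_ne Q P
          · exact Q.valuation_pow_add_pow_eq ha.ne' huP hwP
          · rw [add_comm, mul_comm]
            have hQs := Finset.mem_erase.mpr ⟨hQP, hQ⟩
            exact Q.valuation_pow_add_pow_eq hb.ne' (hws Q hQs) (hus Q hQs)
    · -- Every form that is maximal at `P` is then maximal at `Q`, so `Q` can be discarded.
      push Not at hsep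
      obtain ⟨Q, hQ, hPQ⟩ := hsep
      obtain ⟨hQP, hQs⟩ := Finset.mem_erase.mp hQ
      obtain ⟨e, he, w, hw, hws⟩ := ih _ (Finset.erase_ssubset hQs)
      refine ⟨e, he, w, hw, fun R hR => ?_⟩
      obtain rfl | hRQ := eq_or_ne R Q
      · exact (hD.valuation_le hw R).antisymm
          (hPQ e w hw (hws P (Finset.mem_erase.mpr ⟨hQP.symm, hP⟩)))
      · exact hws R (Finset.mem_erase.mpr ⟨hRQ, hR⟩)

theorem exists_form_poleDiv_eq [IsFunctionField k F] (hD : IsHyperplaneDivisor y D) (i₀ : σ) :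
    ∃ e, 0 < e ∧ ∃ w ∈ formValues k y e, poleDiv k w = e • D := by
  obtain ⟨e, he, w, hw, hval⟩ := hD.exists_form_forall_valuation_eq i₀ D.support
  refine ⟨e, he, w, hw, Finsupp.ext fun P => ?_⟩
  rw [poleDiv_apply, Finsupp.smul_apply]
  by_cases hP : D P = 0
  · have hle := hD.valuation_le hw P
    rw [hP, exp_zero, one_pow] at hle
    rw [hP, smul_zero, max_eq_right_iff]
    obtain hw0 | hw0 := eq_or_ne (P.valuation w) 0
    · rw [hw0, log_zero]
    · rwa [log_le_iff_le_exp hw0, exp_zero]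
  · rw [hval P (Finsupp.mem_support_iff.mpr hP), ← exp_nsmul, log_exp, max_eq_left]
    exact nsmul_nonneg (hD.nonneg P) e

end IsHyperplaneDivisor

variable (k) in
theorem exists_isHyperplaneDivisor [IsFunctionField k F] [Finite σ] {y : σ → F} {i₀ : σ}
    (h : y i₀ = 1) : ∃ D : Divisor k F, IsHyperplaneDivisor y D := by
  cases nonempty_fintype σ
  have hne : (Finset.univ : Finset σ).Nonempty := ⟨i₀, Finset.mem_univ _⟩
  let D : Divisor k F := Finset.univ.sup' hne fun i => poleDiv k (y i)
  have poleDiv_le (i) : poleDiv k (y i) ≤ D :=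
    Finset.le_sup' (fun i => poleDiv k (y i)) (Finset.mem_univ i)
  refine ⟨D, (poleDiv_nonneg _).trans (poleDiv_le i₀), fun P i => ?_, fun P => ?_⟩
  · exact (valuation_le_exp_poleDiv _ P).trans (exp_le_exp.mpr (poleDiv_le i P))
  · obtain ⟨i, _, hi⟩ := Finset.exists_mem_eq_sup' hne fun i => poleDiv k (y i) P
    replace hi : D P = poleDiv k (y i) P := (Finset.apply_sup'_eq_sup'_comp hne
      (fun E : Divisor k F => E P) fun _ _ => rfl).trans hi
    obtain hDP | hDP := eq_or_ne (D P) 0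
    · exact ⟨i₀, by rw [hDP, h, map_one, exp_zero]⟩
    · exact ⟨i, by rw [hi, valuation_eq_exp_poleDiv (hi ▸ hDP)]⟩

end FunctionField1

/-! ### The Hilbert function of a projectively embedded curve -/

namespace FunctionField1

open IntermediateField WithZero MvPolynomial Module

variable {k F : Type*} [Field k] [Field F] [Algebra k F] {σ : Type*} {y : σ → F}

variable (k) in
/-- Every element of `F` is a quotient of two forms of the same degree: `F` is the function field
of the curve with generic point `y`. -/
def IsFormFractionField (y : σ → F) : Prop :=
  ∀ f : F, ∃ m, ∃ a ∈ formValues k y m, ∃ b ∈ formValues k y m, b ≠ 0 ∧ f * b = a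

variable (k) in
/-- The curve with generic point `y` is normal. -/
def ChartsIntegrallyClosed (y : σ → F) : Prop :=
  ∀ j, y j ≠ 0 → ∀ f : F, IsIntegral (chart k y j) f → f ∈ chart k y j

theorem IsFormFractionField.exists_common_denominator (hy : IsFormFractionField k y)
    {ι : Type*} [Finite ι] (u : ι → F) :
    ∃ M, ∃ b : F, b ≠ 0 ∧ ∀ i, u i * b ∈ formValues k y M := by
  classical
  cases nonempty_fintype ι
  choose m a ha b hb hb0 hab using hy
  refine ⟨∑ i, m (u i), ∏ i, b (u i), Finset.prod_ne_zero_iff.mpr fun i _ => hb0 _, fun i => ?_⟩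
  rw [← Finset.mul_prod_erase _ _ (Finset.mem_univ i), ← mul_assoc, hab,
    ← Finset.add_sum_erase _ _ (Finset.mem_univ i)]
  exact mul_mem_formValues (ha _) (prod_mem_formValues _ fun j _ => hb _)

theorem mul_mem_formValues_of_forall_mul_coord_pow_mem [Finite σ] {f : F} {N d M : ℕ}
    (hf : ∀ j, f * y j ^ N ∈ formValues k y (N + d)) (hM : Nat.card σ * N < M) {g : F}
    (hg : g ∈ formValues k y M) : f * g ∈ formValues k y (M + d) := by
  cases nonempty_fintype σ
  refine formValues_le_of_monomials (T := (formValues k y (M + d)).comap (LinearMap.mulLeft k f))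
    (fun m hm => ?_) hg
  obtain ⟨j, hj⟩ : ∃ j, N ≤ m j := by
    by_contra! hlt
    have hsum : ∑ j, m j ≤ ∑ _j : σ, N := Finset.sum_le_sum fun j _ => (hlt j).le
    rw [← Finsupp.degree_eq_sum, hm, Finset.sum_const, smul_eq_mul, Finset.card_univ,
      ← Nat.card_eq_fintype_card] at hsum
    omega
  obtain ⟨m', rfl⟩ : ∃ m', m = Finsupp.single j N + m' :=
    exists_add_of_le (Finsupp.single_le_iff.mpr hj)
  rw [map_add, Finsupp.degree_single] at hm
  rw [Submodule.mem_comap, LinearMap.mulLeft_apply,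
    Finsupp.prod_add_index' (fun _ => pow_zero _) (fun _ => pow_add _),
    Finsupp.prod_single_index (h := fun i n => y i ^ n) (pow_zero _), ← mul_assoc,
    show M + d = N + d + m'.degree by omega, Finsupp.degree_apply]
  exact mul_mem_formValues (hf j) (prod_mem_formValues _ fun i _ => coord_pow_mem_formValues i _)

theorem finite_formValues [IsFunctionField k F] {D : Divisor k F} (hD : IsHyperplaneDivisor y D)
    (d : ℕ) : Module.Finite k (formValues k y d) :=
  Submodule.finiteDimensional_of_le (hD.formValues_le d)

theorem riemannRochSpace_le_of_forall_pow_mul_mem {D : Divisor k F} {w : F} {d e : ℕ}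
    (hsup : ∀ d' ≥ d, riemannRochSpace ((d' + e) • D) ≤
      riemannRochSpace (d' • D) ⊔ (riemannRochSpace (d' • D)).map (LinearMap.mulLeft k w))
    (q : ℕ) {T : Submodule k F}
    (hT : ∀ f ∈ riemannRochSpace (d • D), ∀ i ≤ q, w ^ i * f ∈ T) :
    riemannRochSpace ((d + e * q) • D) ≤ T := by
  induction q generalizing T with
  | zero => exact fun f hf => by simpa using hT f (by simpa using hf) 0 le_rfl
  | succ q ih =>
    rw [mul_add, mul_one, ← add_assoc]
    refine (hsup _ (by omega)).trans (sup_le (ih fun f hf i hi => hT f hf i (by omega)) ?_)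
    rw [Submodule.map_le_iff_le_comap]
    refine ih fun f hf i hi => ?_
    rw [Submodule.mem_comap, LinearMap.mulLeft_apply, ← mul_assoc, ← pow_succ']
    exact hT f hf _ (by omega)

section pencil

variable [IsFunctionField k F]

theorem map_mulLeft_riemannRochSpace_le (E : Divisor k F) (w : F) :
    (riemannRochSpace E).map (LinearMap.mulLeft k w) ≤ riemannRochSpace (E + poleDiv k w) := by
  rintro _ ⟨f, hf, rfl⟩ P
  rw [LinearMap.mulLeft_apply, map_mul, add_comm, Finsupp.add_apply, exp_add]
  exact mul_le_mul' (valuation_le_exp_poleDiv w P) (hf P)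

theorem riemannRochSpace_inf_map_mulLeft_le (E : Divisor k F) (w : F) :
    riemannRochSpace E ⊓ (riemannRochSpace E).map (LinearMap.mulLeft k w) ≤
      (riemannRochSpace (E - poleDiv k w)).map (LinearMap.mulLeft k w) := by
  rintro _ ⟨hf, g, hg, rfl⟩
  refine ⟨g, fun P => ?_, rfl⟩
  rw [Finsupp.sub_apply]
  obtain hP | hP := eq_or_ne (poleDiv k w P) 0
  · rw [hP, sub_zero]
    exact hg P
  · have hfP := hf P
    rw [LinearMap.mulLeft_apply, map_mul, valuation_eq_exp_poleDiv hP,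
      ← add_sub_cancel (poleDiv k w P) (E P), exp_add] at hfP
    exact le_of_mul_le_mul_left hfP exp_pos

-- The base point free pencil trick, for the pencil spanned by `1` and `w`.
theorem riemannRochSpace_add_poleDiv_le {E : Divisor k F} {w : F} (hw : w ≠ 0)
    (hE : finrank k (riemannRochSpace (E + poleDiv k w)) +
      finrank k (riemannRochSpace (E - poleDiv k w)) ≤ 2 * finrank k (riemannRochSpace E)) :
    riemannRochSpace (E + poleDiv k w) ≤
      riemannRochSpace E ⊔ (riemannRochSpace E).map (LinearMap.mulLeft k w) := by
  set L := riemannRochSpace E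
  set wL := L.map (LinearMap.mulLeft k w)
  have hle : L ⊔ wL ≤ riemannRochSpace (E + poleDiv k w) :=
    sup_le (riemannRochSpace_mono (le_add_of_nonneg_right (poleDiv_nonneg w)))
      (map_mulLeft_riemannRochSpace_le E w)
  have hwL : finrank k wL = finrank k L :=
    (Submodule.equivMapOfInjective _ (mul_right_injective₀ hw) L).finrank_eq.symm
  have hinf : finrank k ↥(L ⊓ wL) ≤ finrank k (riemannRochSpace (E - poleDiv k w)) :=
    (Submodule.finrank_mono (riemannRochSpace_inf_map_mulLeft_le E w)).trans
      (Submodule.finrank_map_le _ _)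
  have hsum := Submodule.finrank_sup_add_finrank_inf_eq L wL
  exact (Submodule.eq_of_le_of_finrank_le hle (by omega)).ge

variable {D : Divisor k F} {e : ℕ} {w : F}

theorem eventually_riemannRochSpace_le_sup (hD : 0 < D.degree) (hw : w ≠ 0)
    (hpole : poleDiv k w = e • D) :
    ∀ᶠ d : ℕ in Filter.atTop, riemannRochSpace ((d + e) • D) ≤
      riemannRochSpace (d • D) ⊔ (riemannRochSpace (d • D)).map (LinearMap.mulLeft k w) := by
  obtain ⟨d₀, hd₀⟩ := Filter.eventually_atTop.mp (eventually_finrank_nsmul_eq hD)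
  refine Filter.eventually_atTop.mpr ⟨d₀ + e, fun d hd => ?_⟩
  obtain ⟨c, rfl⟩ := Nat.exists_eq_add_of_le' (show e ≤ d by omega)
  have hsub : (c + e) • D - poleDiv k w = c • D := by rw [hpole, add_smul, add_sub_cancel_right]
  have hadd : (c + e + e) • D = (c + e) • D + poleDiv k w := by rw [hpole, add_smul]
  rw [hadd]
  refine riemannRochSpace_add_poleDiv_le hw ?_
  rw [hsub, ← hadd]
  have hrank := hd₀ (c + e) (by omega)
  have hrank_sub := hd₀ c (by omega)
  have hrank_add := hd₀ (c + e + e) (by omega)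
  push_cast at hrank hrank_add
  zify
  linarith

theorem transcendental_of_poleDiv_ne_zero (hw : poleDiv k w ≠ 0) : Transcendental k w := by
  obtain ⟨P, hP⟩ := Finsupp.ne_iff.mp hw
  rw [poleDiv_apply] at hP
  exact P.transcendental_of_valuation_ne_one (fun h => by simp [h] at hP)
    fun h => by simp [h] at hP

theorem isAlgebraic_of_mem_riemannRochSpace_zero {f : F}
    (hf : f ∈ riemannRochSpace (0 : Divisor k F)) : IsAlgebraic k f := by
  by_contra htr
  obtain ⟨P, hP⟩ := Place.exists_valuation_lt_one (k := k) (f := f⁻¹) fun halg =>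
    htr (by simpa using halg.inv)
  have hf0 : f ≠ 0 := fun h => htr (h ▸ isAlgebraic_zero)
  have hle : P.valuation f ≤ 1 := by simpa using hf P
  rw [map_inv₀, inv_lt_one₀ (P.valuation_pos hf0)] at hP
  exact hP.not_ge hle

end pencil

namespace IsHyperplaneDivisor

variable {D : Divisor k F}

theorem valuation_le_one_of_isIntegral_chart (hD : IsHyperplaneDivisor y D) {j : σ} {P : Place k F}
    (hP : P.valuation (y j) = exp (D P)) {f : F} (hf : IsIntegral (chart k y j) f) :
    P.valuation f ≤ 1 := by
  refine P.valuation_le_one_of_isIntegral (Algebra.adjoin_le ?_) hf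
  rintro _ ⟨i, rfl⟩
  refine Place.mem_subalgebra.mpr ?_
  rw [map_div₀, hP, div_le_one₀ exp_pos]
  exact hD.le P i

variable [IsFunctionField k F]

theorem degree_pos (hD : IsHyperplaneDivisor y D) (hy : IsFormFractionField k y) :
    0 < D.degree := by
  refine Divisor.degree_pos hD.nonneg fun h0 => ?_
  obtain ⟨x, hx⟩ := IsFunctionField.exists_transcendental (k := k) (F := F)
  obtain ⟨m, a, ha, b, hb, hb0, hab⟩ := hy x
  have isAlgebraic_form {c : F} (hc : c ∈ formValues k y m) : IsAlgebraic k c :=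
    isAlgebraic_of_mem_riemannRochSpace_zero (by simpa [h0] using hD.formValues_le m hc)
  refine hx ?_
  rw [eq_div_of_mul_eq hb0 hab, div_eq_mul_inv]
  exact (isAlgebraic_form ha).mul (isAlgebraic_form hb).inv

theorem exists_form_transcendental (hD : IsHyperplaneDivisor y D) (hdeg : 0 < D.degree) (i₀ : σ) :
    ∃ e, 0 < e ∧ ∃ w ∈ formValues k y e, poleDiv k w = e • D ∧ Transcendental k w := by
  obtain ⟨e, he, w, hw, hpole⟩ := hD.exists_form_poleDiv_eq i₀
  refine ⟨e, he, w, hw, hpole, transcendental_of_poleDiv_ne_zero ?_⟩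
  rw [hpole]
  refine smul_ne_zero he.ne' fun h => ?_
  simp [h, Divisor.degree_zero] at hdeg

theorem mul_le_finrank_formValues (hD : IsHyperplaneDivisor y D) {i₀ : σ} (h1 : y i₀ = 1)
    {e M : ℕ} {w : F} (hw : w ∈ formValues k y e) (hwt : Transcendental k w) {ι : Type*}
    [Finite ι] {u : ι → F} (hu : LinearIndependent k⟮w⟯ u) (huM : ∀ i, u i ∈ formValues k y M)
    {l d : ℕ} (hd : M + e * l ≤ d) : l * Nat.card ι ≤ finrank k (formValues k y d) := by
  cases nonempty_fintype ι
  have := finite_formValues hD d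
  have hmem (p : Fin l × ι) : w ^ (p.1 : ℕ) * u p.2 ∈ formValues k y d := by
    refine formValues_mono h1 ?_ (mul_mem_formValues (pow_mem_formValues hw p.1) (huM p.2))
    have : e * p.1 ≤ e * l := Nat.mul_le_mul_left e p.1.2.le
    omega
  have hli : LinearIndependent k fun p : Fin l × ι => (⟨_, hmem p⟩ : formValues k y d) :=
    .of_comp (formValues k y d).subtype <| (linearIndependent_pow_mul hwt hu).comp
      (Prod.map Fin.val id) (Fin.val_injective.prodMap Function.injective_id)
  simpa using hli.fintype_card_le_finrank

theorem exists_le_finrank_formValues (hD : IsHyperplaneDivisor y D) {i₀ : σ} (h1 : y i₀ = 1)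
    (hy : IsFormFractionField k y) :
    ∃ C : ℤ, ∀ d : ℕ, D.degree * d - C ≤ finrank k (formValues k y d) := by
  have hdeg := hD.degree_pos hy
  obtain ⟨e, he, w, hw, hpole, hwt⟩ := hD.exists_form_transcendental hdeg i₀
  have := IsFunctionField.finite_adjoin (k := k) w hwt
  have hdeg_w := degree_poleDiv hwt
  rw [hpole, Divisor.degree_nsmul] at hdeg_w
  let u := Module.finBasis k⟮w⟯ F
  obtain ⟨M, b, hb0, hb⟩ := hy.exists_common_denominator u
  have hub : LinearIndependent k⟮w⟯ fun i => u i * b :=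
    u.linearIndependent.map' (LinearMap.mulRight k⟮w⟯ b)
      (LinearMap.ker_eq_bot.mpr (mul_left_injective₀ hb0))
  refine ⟨D.degree * (M + e), fun d => ?_⟩
  obtain hd | hd := lt_or_ge d M
  · have : D.degree * d ≤ D.degree * (M + e) :=
      mul_le_mul_of_nonneg_left (by exact_mod_cast (by omega : d ≤ M + e)) hdeg.le
    linarith [Int.natCast_nonneg (finrank k (formValues k y d))]
  set l := (d - M) / e with hl
  have hcount := hD.mul_le_finrank_formValues h1 hw hwt hub hb (l := l) (d := d)
    (by have := Nat.mul_div_le (d - M) e; rw [← hl] at this; omega)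
  rw [Nat.card_fin] at hcount
  have hdl : d ≤ M + e * l + e := by
    have := Nat.lt_mul_div_succ (d - M) he
    rw [mul_add, mul_one, ← hl] at this
    omega
  have hdegl : D.degree * d ≤ D.degree * (M + e * l + e) :=
    mul_le_mul_of_nonneg_left (by exact_mod_cast hdl) hdeg.le
  zify at hcount
  rw [← hdeg_w] at hcount
  linarith

theorem eventually_finrank_formValues_le (hD : IsHyperplaneDivisor y D) (hdeg : 0 < D.degree) :
    ∀ᶠ d : ℕ in Filter.atTop,
      (finrank k (formValues k y d) : ℤ) ≤ D.degree * d + 1 - genus k F := by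
  filter_upwards [eventually_finrank_nsmul_eq hdeg] with d hd
  rw [mul_comm, ← hd]
  exact_mod_cast Submodule.finrank_mono (hD.formValues_le d)

-- Otherwise some valuation ring contains the chart but not `f / y_j ^ d`; it belongs to a place
-- at which `y_j` has the maximal pole order among the coordinates.
theorem div_pow_mem_chart (hD : IsHyperplaneDivisor y D)
    (hc : ChartsIntegrallyClosed k y) {j : σ} (hj : y j ≠ 0) {d : ℕ} {f : F}
    (hf : f ∈ riemannRochSpace (d • D)) : f / y j ^ d ∈ chart k y j := by
  by_contra hmem
  have hcl : IsIntegrallyClosedIn (chart k y j).toSubring F :=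
    Subring.isIntegrallyClosedIn_iff.mpr fun {x} hx => hc j hj x hx
  obtain ⟨V, hV, hfV⟩ := Subring.exists_le_valuationSubring_of_isIntegrallyClosedIn
    (R := (chart k y j).toSubring) hmem
  have hk (c : k) : algebraMap k F c ∈ V := hV ((chart k y j).algebraMap_mem c)
  have htop : V ≠ ⊤ := fun h => hfV (h ▸ ValuationSubring.mem_top _)
  let P : Place k F := Place.ofValuationSubring V hk htop
  have hyj := P.valuation_pos hj
  have hmax : exp (D P) ≤ P.valuation (y j) := by
    obtain ⟨i, hi⟩ := hD.eq P
    rw [← hi, ← div_le_one₀ hyj, ← map_div₀]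
    exact (P.valuation_le_one_iff _).mpr (hV (Algebra.subset_adjoin ⟨i, rfl⟩))
  refine hfV ((P.valuation_le_one_iff _).mp ?_)
  rw [map_div₀, map_pow, div_le_one₀ (pow_pos hyj d)]
  have hfP := hf P
  rw [Finsupp.smul_apply, exp_nsmul] at hfP
  exact hfP.trans (pow_le_pow_left₀ zero_le hmax d)

theorem eventually_mul_coord_pow_mem (hD : IsHyperplaneDivisor y D)
    (hc : ChartsIntegrallyClosed k y) {d : ℕ} {f : F} (hf : f ∈ riemannRochSpace (d • D)) (j : σ) :
    ∀ᶠ N : ℕ in Filter.atTop, f * y j ^ N ∈ formValues k y (N + d) := by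
  obtain hj | hj := eq_or_ne (y j) 0
  · filter_upwards [Filter.eventually_gt_atTop 0] with N hN
    rw [hj, zero_pow hN.ne', mul_zero]
    exact zero_mem _
  · obtain ⟨N₀, hN₀⟩ := exists_mul_pow_mem_formValues hj (hD.div_pow_mem_chart hc hj hf)
    filter_upwards [Filter.eventually_ge_atTop N₀] with N hN
    obtain ⟨c, rfl⟩ := Nat.exists_eq_add_of_le hN
    have hmul := mul_mem_formValues hN₀ (coord_pow_mem_formValues (k := k) j (c + d))
    rw [← add_assoc] at hmul
    convert hmul using 1
    have : y j ^ d ≠ 0 := pow_ne_zero _ hj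
    rw [pow_add, pow_add]
    field_simp

theorem chartsIntegrallyClosed_of_eventually (hD : IsHyperplaneDivisor y D)
    (h : ∀ᶠ d : ℕ in Filter.atTop, formValues k y d = riemannRochSpace (d • D)) :
    ChartsIntegrallyClosed k y := by
  intro j hj f hf
  obtain ⟨d₀, hd₀⟩ := Filter.eventually_atTop.mp h
  obtain ⟨c, hc⟩ := (poleDiv k f).exists_forall_apply_le
  have hmem : f * y j ^ (d₀ + c) ∈ riemannRochSpace ((d₀ + c) • D) := fun P => by
    rw [Finsupp.smul_apply, exp_nsmul, map_mul, map_pow]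
    obtain hP | hP := (hD.le P j).eq_or_lt
    · rw [hP]
      exact mul_le_of_le_one_left' (hD.valuation_le_one_of_isIntegral_chart hP hf)
    · have hfP : P.valuation f ≤ exp ((d₀ + c : ℕ) : ℤ) :=
        (valuation_le_exp_poleDiv f P).trans (exp_le_exp.mpr (by have := hc P; omega))
      calc P.valuation f * P.valuation (y j) ^ (d₀ + c)
          ≤ exp ((d₀ + c : ℕ) : ℤ) * exp (D P - 1) ^ (d₀ + c) :=
            mul_le_mul' hfP (pow_le_pow_left₀ zero_le (lt_exp_iff_le_exp.mp hP) _)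
        _ = exp (D P) ^ (d₀ + c) := by
            rw [← exp_nsmul, ← exp_nsmul, ← exp_add, nsmul_eq_mul, nsmul_eq_mul]
            congr 1
            ring
  rw [← hd₀ _ (Nat.le_add_right _ _)] at hmem
  simpa [hj] using FunctionField1.div_pow_mem_chart (j := j) hmem

variable [Finite σ]

theorem exists_forall_mul_coord_pow_mem (hD : IsHyperplaneDivisor y D)
    (hc : ChartsIntegrallyClosed k y) (d : ℕ) :
    ∃ N, ∀ f ∈ riemannRochSpace (d • D), ∀ j, f * y j ^ N ∈ formValues k y (N + d) := by
  let b := Module.finBasis k (riemannRochSpace (d • D))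
  obtain ⟨N, hN⟩ := (Filter.eventually_all.mpr fun i => Filter.eventually_all.mpr fun j =>
    hD.eventually_mul_coord_pow_mem hc (b i).2 j).exists
  refine ⟨N, fun f hf j => ?_⟩
  have hspan : (⊤ : Submodule k (riemannRochSpace (d • D))) ≤
      ((formValues k y (N + d)).comap (LinearMap.mulRight k (y j ^ N))).comap
        (riemannRochSpace (d • D)).subtype := by
    rw [← b.span_eq, Submodule.span_le]
    rintro _ ⟨i, rfl⟩
    exact hN i j
  exact hspan (x := ⟨f, hf⟩) trivial

theorem eventually_mul_mem_formValues (hD : IsHyperplaneDivisor y D)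
    (hc : ChartsIntegrallyClosed k y) (d : ℕ) :
    ∀ᶠ M : ℕ in Filter.atTop, ∀ f ∈ riemannRochSpace (d • D), ∀ g ∈ formValues k y M,
      f * g ∈ formValues k y (M + d) := by
  obtain ⟨N, hN⟩ := hD.exists_forall_mul_coord_pow_mem hc d
  filter_upwards [Filter.eventually_gt_atTop (Nat.card σ * N)] with M hM f hf g hg
  exact mul_mem_formValues_of_forall_mul_coord_pow_mem (hN f hf) hM hg

theorem eventually_formValues_eq (hD : IsHyperplaneDivisor y D) {i₀ : σ} (h1 : y i₀ = 1)
    (hdeg : 0 < D.degree) (hc : ChartsIntegrallyClosed k y) :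
    ∀ᶠ d : ℕ in Filter.atTop, formValues k y d = riemannRochSpace (d • D) := by
  obtain ⟨e, he, w, hw, hpole, hwt⟩ := hD.exists_form_transcendental hdeg i₀
  have hw0 : w ≠ 0 := fun h => hwt (h ▸ isAlgebraic_zero)
  obtain ⟨d₀, hd₀⟩ := Filter.eventually_atTop.mp
    (eventually_riemannRochSpace_le_sup hdeg hw0 hpole)
  obtain ⟨M, hM⟩ := Filter.eventually_atTop.mp <| (Filter.eventually_all (ι := Fin e)).mpr
    fun r => hD.eventually_mul_mem_formValues hc (d₀ + r)
  refine Filter.eventually_atTop.mpr ⟨d₀ + e + M, fun d hd => (hD.formValues_le d).antisymm ?_⟩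
  obtain ⟨q, r, hr, rfl⟩ : ∃ q r, r < e ∧ d = d₀ + r + e * q :=
    ⟨(d - d₀) / e, (d - d₀) % e, Nat.mod_lt _ he, by have := Nat.mod_add_div (d - d₀) e; omega⟩
  refine riemannRochSpace_le_of_forall_pow_mul_mem (fun d' hd' => hd₀ d' (by omega)) q
    fun f hf i hi => ?_
  rw [mul_comm _ f, add_comm (d₀ + r)]
  exact hM (e * q) (by omega) ⟨r, hr⟩ f hf _
    (formValues_mono h1 (Nat.mul_le_mul_left e hi) (pow_mem_formValues hw i))

theorem chartsIntegrallyClosed_iff (hD : IsHyperplaneDivisor y D) {i₀ : σ} (h1 : y i₀ = 1)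
    (hdeg : 0 < D.degree) :
    ChartsIntegrallyClosed k y ↔ ∀ᶠ d : ℕ in Filter.atTop,
      (finrank k (formValues k y d) : ℤ) = D.degree * d + 1 - genus k F := by
  have hrank := eventually_finrank_nsmul_eq hdeg
  refine ⟨fun hc => ?_, fun h => hD.chartsIntegrallyClosed_of_eventually ?_⟩
  · filter_upwards [hrank, hD.eventually_formValues_eq h1 hdeg hc] with d hd heq
    rw [heq, hd, mul_comm]
  · filter_upwards [hrank, h] with d hd heq
    refine Submodule.eq_of_le_of_finrank_eq (hD.formValues_le d) ?_
    rw [mul_comm, ← heq] at hd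
    exact_mod_cast hd.symm

end IsHyperplaneDivisor

end FunctionField1

/-! ### Homogeneous ideals and their affine charts -/

namespace ProjectiveModel

open MvPolynomial

variable {A σ : Type*} [CommRing A]

theorem exists_homogenization (j : σ) (f : MvPolynomial σ A) :
    ∃ d h, h.IsHomogeneous d ∧ f - h ∈ Ideal.span {X j - 1} := by
  let d := f.totalDegree
  refine ⟨d, ∑ i ∈ Finset.range (d + 1), X j ^ (d - i) * homogeneousComponent i f, ?_, ?_⟩
  · refine IsHomogeneous.sum _ _ _ fun i hi => ?_
    have hmul :=
      (isHomogeneous_X_pow (R := A) j (d - i)).mul (homogeneousComponent_isHomogeneous i f)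
    rwa [Nat.sub_add_cancel (Nat.lt_succ_iff.mp (Finset.mem_range.mp hi))] at hmul
  · nth_rw 1 [← sum_homogeneousComponent f]
    rw [← Finset.sum_sub_distrib]
    refine sum_mem fun i _ => ?_
    rw [← one_sub_mul]
    refine Ideal.mul_mem_right _ _ (Ideal.mem_span_singleton.mpr ?_)
    rw [dvd_sub_comm]
    exact sub_one_dvd_pow_sub_one (X j) (d - i)

theorem coe_decompose_homogeneousSubmodule (d : ℕ) (f : MvPolynomial σ A) :
    (DirectSum.decompose (homogeneousSubmodule σ A) f d : MvPolynomial σ A) =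
      homogeneousComponent d f :=
  decomposition.decompose'_apply f d

variable (I : Ideal (MvPolynomial σ A))

/-- The ideal of the affine chart `X j ≠ 0` of the projective scheme defined by `I`, with the chart
realized as the hyperplane `X j = 1` of affine space. -/
noncomputable def chartIdeal (j : σ) : Ideal (MvPolynomial σ A) := I ⊔ Ideal.span {X j - 1}

/-- The saturation of `I` with respect to the variables. -/
noncomputable def saturation : Ideal (MvPolynomial σ A) where
  carrier := {g | ∀ j, ∃ N, X j ^ N * g ∈ I}
  zero_mem' j := ⟨0, by simp⟩
  add_mem' {f g} hf hg j := by
    obtain ⟨N, hN⟩ := hf j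
    obtain ⟨M, hM⟩ := hg j
    refine ⟨N + M, ?_⟩
    have : X j ^ (N + M) * (f + g) = X j ^ M * (X j ^ N * f) + X j ^ N * (X j ^ M * g) := by ring
    rw [this]
    exact add_mem (I.mul_mem_left _ hN) (I.mul_mem_left _ hM)
  smul_mem' c g hg j := by
    obtain ⟨N, hN⟩ := hg j
    refine ⟨N, ?_⟩
    rw [smul_eq_mul, mul_left_comm]
    exact I.mul_mem_left _ hN

variable {I}

theorem mem_saturation_of_mem {g : MvPolynomial σ A} (hg : g ∈ I) : g ∈ saturation I :=
  fun _ => ⟨0, by rwa [pow_zero, one_mul]⟩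

theorem mem_chartIdeal_of_X_pow_mul_mem {j : σ} {N : ℕ} {g : MvPolynomial σ A}
    (hg : X j ^ N * g ∈ I) : g ∈ chartIdeal I j := by
  rw [← sub_sub_cancel (X j ^ N * g) g, ← sub_one_mul]
  exact sub_mem (Ideal.mem_sup_left hg) (Ideal.mem_sup_right (Ideal.mul_mem_right _ _
    (Ideal.mem_span_singleton.mpr (sub_one_dvd_pow_sub_one (X j) N))))

theorem mem_chartIdeal_of_map_eq_zero {B : Type*} [CommRing B] {φ : MvPolynomial σ A →+* B} {j : σ}
    (hj : φ (X j) = 1)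
    (hφ : ∀ d g, g.IsHomogeneous d → φ g = 0 → ∃ N : ℕ, X j ^ N * g ∈ I)
    {f : MvPolynomial σ A} (hf : φ f = 0) : f ∈ chartIdeal I j := by
  obtain ⟨d, h, hh, hfh⟩ := exists_homogenization j f
  have hker : Ideal.span {X j - 1} ≤ RingHom.ker φ := by
    rw [Ideal.span_singleton_le_iff_mem, RingHom.mem_ker, map_sub, hj, map_one, sub_self]
  have hφh : φ h = 0 := by
    have := hker hfh
    rwa [RingHom.mem_ker, map_sub, hf, zero_sub, neg_eq_zero] at this
  obtain ⟨N, hN⟩ := hφ d h hh hφh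
  rw [← sub_add_cancel f h]
  exact add_mem (Ideal.mem_sup_right hfh) (mem_chartIdeal_of_X_pow_mul_mem hN)

theorem exists_forall_X_pow_mul_mem [IsNoetherianRing A] [Finite σ] :
    ∃ N, ∀ g ∈ saturation I, ∀ j, X j ^ N * g ∈ I := by
  obtain ⟨s, hs⟩ := (isNoetherianRing_iff_ideal_fg _).mp inferInstance (saturation I)
  have eventually_mem (g : s) (j : σ) : ∀ᶠ N : ℕ in Filter.atTop, X j ^ N * g.1 ∈ I := by
    have hg : g.1 ∈ saturation I := hs ▸ Ideal.subset_span g.2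
    obtain ⟨N, hN⟩ := hg j
    filter_upwards [Filter.eventually_ge_atTop N] with M hM
    rw [← Nat.sub_add_cancel hM, pow_add, mul_assoc]
    exact I.mul_mem_left _ hN
  obtain ⟨N, hN⟩ :=
    (Filter.eventually_all.mpr fun g => Filter.eventually_all.mpr (eventually_mem g)).exists
  refine ⟨N, fun g hg j => ?_⟩
  rw [← hs] at hg
  induction hg using Submodule.span_induction with
  | mem g hg => exact hN ⟨g, hg⟩ j
  | zero => simp
  | add f g _ _ hf hg => exact mul_add (X j ^ N) f g ▸ add_mem hf hg
  | smul c g _ hg => exact mul_left_comm (X j ^ N) c g ▸ I.mul_mem_left c hg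

theorem exists_totalDegree_le_forall_sub_mul_mem [Finite σ] (N : ℕ) (f : MvPolynomial σ A) :
    ∃ l : MvPolynomial σ A, l.totalDegree ≤ Nat.card σ * N ∧
      ∀ g, (∀ j, X j ^ N * g ∈ I) → (f - l) * g ∈ I := by
  cases nonempty_fintype σ
  induction f using MvPolynomial.induction_on' with
  | monomial m c =>
    by_cases hm : m.degree ≤ Nat.card σ * N
    · exact ⟨monomial m c, (totalDegree_monomial_le m c).trans hm, by simp⟩
    refine ⟨0, by simp, fun g hg => ?_⟩
    obtain ⟨j, hj⟩ : ∃ j, N ≤ m j := by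
      by_contra! hlt
      refine hm ?_
      rw [Finsupp.degree_eq_sum]
      exact (Finset.sum_le_card_nsmul _ _ N fun j _ => (hlt j).le).trans (by simp)
    obtain ⟨q, hq⟩ : (X j ^ N : MvPolynomial σ A) ∣ monomial m c := by
      rw [X_pow_eq_monomial]
      exact monomial_dvd_monomial.mpr ⟨.inr (Finsupp.single_le_iff.mpr hj), one_dvd c⟩
    rw [sub_zero, hq, mul_right_comm]
    exact I.mul_mem_right _ (hg j)
  | add p q hp hq =>
    obtain ⟨l, hl, hlI⟩ := hp
    obtain ⟨l', hl', hlI'⟩ := hq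
    refine ⟨l + l', (totalDegree_add _ _).trans (max_le hl hl'), fun g hg => ?_⟩
    rw [add_sub_add_comm, add_mul]
    exact add_mem (hlI g hg) (hlI' g hg)

theorem eventually_mem_of_mem_saturation [IsNoetherianRing A] [Finite σ]
    (hI : I.IsHomogeneous (homogeneousSubmodule σ A)) :
    ∀ᶠ d : ℕ in Filter.atTop,
      ∀ g : MvPolynomial σ A, g.IsHomogeneous d → g ∈ saturation I → g ∈ I := by
  obtain ⟨N, hN⟩ := exists_forall_X_pow_mul_mem (I := I)
  obtain ⟨s, hs⟩ := (isNoetherianRing_iff_ideal_fg _).mp inferInstance (saturation I)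
  choose l hl hlI using exists_totalDegree_le_forall_sub_mul_mem (I := I) N
  filter_upwards [Filter.eventually_gt_atTop (Nat.card σ * N + s.sup totalDegree)]
    with d hd g hgd hg
  rw [← hs, Submodule.mem_span_finset] at hg
  obtain ⟨c, -, rfl⟩ := hg
  have hsub : ∑ a ∈ s, c a • a - ∑ a ∈ s, l (c a) * a ∈ I := by
    rw [← Finset.sum_sub_distrib]
    refine sum_mem fun a ha => ?_
    rw [smul_eq_mul, ← sub_mul]
    exact hlI (c a) a (hN a (hs ▸ Ideal.subset_span ha))
  have hlow : homogeneousComponent d (∑ a ∈ s, l (c a) * a) = 0 := by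
    rw [map_sum]
    refine Finset.sum_eq_zero fun a ha => homogeneousComponent_eq_zero _ _ ?_
    calc (l (c a) * a).totalDegree ≤ (l (c a)).totalDegree + a.totalDegree := totalDegree_mul _ _
      _ ≤ Nat.card σ * N + s.sup totalDegree := add_le_add (hl _) (Finset.le_sup ha)
      _ < d := hd
  have hcomp := hI d hsub
  rwa [coe_decompose_homogeneousSubmodule, map_sub, hlow, sub_zero,
    homogeneousComponent_of_mem hgd, if_pos rfl] at hcomp

end ProjectiveModel

namespace FunctionField1

open MvPolynomial ProjectiveModel

variable {k F σ : Type*} [Field k] [Field F] [Algebra k F]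

/-- `y` is the generic point, in projective coordinates, of the integral projective scheme over `k`
defined by the ideal `I`, and `F` is its function field. -/
structure IsGenericPoint (I : Ideal (MvPolynomial σ k)) (y : σ → F) : Prop where
  exists_eq_one : ∃ i, y i = 1
  isFormFractionField : IsFormFractionField k y
  aeval_eq_zero_iff : ∀ d (g : MvPolynomial σ k), g.IsHomogeneous d →
    (aeval y g = 0 ↔ g ∈ saturation I)

namespace IsGenericPoint

variable {I : Ideal (MvPolynomial σ k)} {y : σ → F}

theorem ker_aeval_div (h : IsGenericPoint I y) (hI : I.IsHomogeneous (homogeneousSubmodule σ k))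
    {j : σ} (hj : y j ≠ 0) :
    RingHom.ker (aeval (R := k) fun i => y i / y j) = chartIdeal I j := by
  have hj1 : aeval (R := k) (fun i => y i / y j) (X j) = 1 := by rw [aeval_X, div_self hj]
  refine le_antisymm (fun f hf => ?_) (sup_le (fun f hf => ?_) ?_)
  · refine mem_chartIdeal_of_map_eq_zero (φ := (aeval (R := k) fun i => y i / y j).toRingHom)
      hj1 (fun d g hg hg0 => ?_) hf
    change aeval _ g = 0 at hg0
    rw [aeval_div_of_isHomogeneous y j hg, div_eq_zero_iff, or_iff_left (pow_ne_zero _ hj),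
      h.aeval_eq_zero_iff d g hg] at hg0
    exact hg0 j
  · rw [RingHom.mem_ker, ← sum_homogeneousComponent f, map_sum]
    refine Finset.sum_eq_zero fun d _ => ?_
    have hd := homogeneousComponent_isHomogeneous d f
    have hmem : homogeneousComponent d f ∈ I := coe_decompose_homogeneousSubmodule d f ▸ hI d hf
    rw [aeval_div_of_isHomogeneous y j hd,
      (h.aeval_eq_zero_iff d _ hd).mpr (mem_saturation_of_mem hmem), zero_div]
  · rw [Ideal.span_singleton_le_iff_mem, RingHom.mem_ker, map_sub, hj1, map_one, sub_self]

/-- The coordinate ring of a chart of an integral projective scheme, as a subring of the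
function field. -/
noncomputable def chartEquiv (h : IsGenericPoint I y)
    (hI : I.IsHomogeneous (homogeneousSubmodule σ k)) {j : σ} (hj : y j ≠ 0) :
    (MvPolynomial σ k ⧸ chartIdeal I j) ≃ₐ[k] chart k y j :=
  (Ideal.quotientEquivAlgOfEq k (h.ker_aeval_div hI hj).symm).trans
    ((Ideal.quotientKerEquivRange (aeval (R := k) fun i => y i / y j)).trans
      (Subalgebra.equivOfEq _ _ (Algebra.adjoin_range_eq_range_aeval k _).symm))

theorem chartIdeal_eq_top (h : IsGenericPoint I y) {j : σ} (hj : y j = 0) :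
    chartIdeal I j = ⊤ := by
  obtain ⟨N, hN⟩ :=
    (h.aeval_eq_zero_iff 1 (X j) (isHomogeneous_X k j)).mp (by rw [aeval_X, hj]) j
  rw [← pow_succ, ← mul_one (X j ^ _)] at hN
  exact (Ideal.eq_top_iff_one _).mpr (mem_chartIdeal_of_X_pow_mul_mem hN)

end IsGenericPoint

end FunctionField1

/-! ### Comparison of the fibres over a discrete valuation ring -/

namespace ProjectiveModel

open MvPolynomial Module

section LinearAlgebra

variable {A : Type*} [CommRing A]

theorem span_range_eq_span_image_of_span_eq_top (R : Type*) [CommRing R] [Algebra A R]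
    {Q U : Type*} [AddCommGroup Q] [Module A Q] [AddCommGroup U] [Module A U] [Module R U]
    [IsScalarTower A R U] {s : Set Q} (hs : Submodule.span A s = ⊤) (φ : Q →ₗ[A] U) :
    Submodule.span R (Set.range φ) = Submodule.span R (φ '' s) := by
  rw [← LinearMap.coe_range, LinearMap.range_eq_map, ← hs, Submodule.map_span,
    Submodule.span_span_of_tower]

theorem finiteDimensional_span_range (k : Type*) [Field k] [Algebra A k] {M U : Type*}
    [AddCommGroup M] [Module A M] [Module.Finite A M] [AddCommGroup U] [Module A U] [Module k U]
    [IsScalarTower A k U] (φ : M →ₗ[A] U) :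
    FiniteDimensional k (Submodule.span k (Set.range φ)) := by
  obtain ⟨s, hs⟩ := Module.Finite.fg_top (R := A) (M := M)
  rw [span_range_eq_span_image_of_span_eq_top k hs]
  exact FiniteDimensional.span_of_finite k (s.finite_toSet.image φ)

theorem finrank_span_range_of_injective (K : Type*) [Field K] [Algebra A K] [IsFractionRing A K]
    {ι Q V : Type*} [Finite ι] [AddCommGroup Q] [Module A Q] [AddCommGroup V] [Module A V]
    [Module K V] [IsScalarTower A K V] (b : Basis ι A Q) {φ : Q →ₗ[A] V}
    (hφ : Function.Injective φ) : finrank K (Submodule.span K (Set.range φ)) = Nat.card ι := by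
  cases nonempty_fintype ι
  have hli : LinearIndependent K (φ ∘ b) := (LinearIndependent.iff_fractionRing A K).mp
    (b.linearIndependent.map' φ (LinearMap.ker_eq_bot.mpr hφ))
  rw [span_range_eq_span_image_of_span_eq_top K b.span_eq, ← Set.range_comp,
    finrank_span_eq_card hli, Nat.card_eq_fintype_card]

variable {κ : Type*} [Field κ] [Algebra A κ] {π : A}

theorem finrank_span_range_of_ker_eq (hsurj : Function.Surjective (algebraMap A κ))
    (hker : ∀ a : A, algebraMap A κ a = 0 ↔ π ∣ a) {ι Q U : Type*} [Finite ι] [AddCommGroup Q]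
    [Module A Q] [AddCommGroup U] [Module A U] [Module κ U] [IsScalarTower A κ U]
    (b : Basis ι A Q) {φ : Q →ₗ[A] U} (hφ : ∀ q, φ q = 0 → ∃ q', q = π • q') :
    finrank κ (Submodule.span κ (Set.range φ)) = Nat.card ι := by
  cases nonempty_fintype ι
  have hli : LinearIndependent κ (φ ∘ b) := by
    rw [Fintype.linearIndependent_iff]
    intro c hc i
    choose a ha using fun i => hsurj (c i)
    obtain ⟨q, hq⟩ := hφ (∑ i, a i • b i) (by
      rw [map_sum, ← hc]
      refine Finset.sum_congr rfl fun i _ => ?_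
      rw [map_smul, ← ha, algebraMap_smul, Function.comp_apply])
    have hai : a i = π * b.repr q i := by
      have hrepr := congrArg (fun q => b.repr q i) hq
      simpa only [b.repr_sum_self, map_smul, Finsupp.smul_apply, smul_eq_mul] using hrepr
    rw [← ha, hker, hai]
    exact dvd_mul_right _ _
  rw [span_range_eq_span_image_of_span_eq_top κ b.span_eq, ← Set.range_comp,
    finrank_span_eq_card hli, Nat.card_eq_fintype_card]

theorem mem_span_image_iff (hsurj : Function.Surjective (algebraMap A κ)) {M V : Type*}
    [AddCommGroup M] [Module A M] [AddCommGroup V] [Module A V] [Module κ V] [IsScalarTower A κ V]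
    (e : M →ₗ[A] V) (N : Submodule A M) {v : V} :
    v ∈ Submodule.span κ (e '' N) ↔ v ∈ N.map e := by
  rw [← Submodule.restrictScalars_mem A, Submodule.restrictScalars_span A κ hsurj,
    Submodule.span_image, Submodule.span_eq]

theorem finrank_map_mkQ_add_finrank {V : Type*} [AddCommGroup V] [Module κ V]
    {W' W : Submodule κ V} [FiniteDimensional κ W] (h : W' ≤ W) :
    finrank κ (W.map W'.mkQ) + finrank κ W' = finrank κ W := by
  rw [← LinearMap.finrank_range_add_finrank_ker (W'.mkQ.domRestrict W),
    LinearMap.range_domRestrict, LinearMap.ker_domRestrict, Submodule.ker_mkQ]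
  exact congrArg _ (Submodule.submoduleOfEquivOfLe h).finrank_eq.symm

-- Both sides count the rank of the free module `M ⧸ ker e₁`: its reduction modulo `π` is the
-- quotient of the image of `e₂` by the image of `ker e₁`.
theorem finrank_generic_add_finrank_image_ker {K : Type*} [Field K] [Algebra A K]
    [IsFractionRing A K] [IsDomain A] [IsPrincipalIdealRing A]
    (hsurj : Function.Surjective (algebraMap A κ)) (hker : ∀ a : A, algebraMap A κ a = 0 ↔ π ∣ a)
    {M V₁ V₂ : Type*} [AddCommGroup M] [Module A M] [Module.Finite A M]
    [AddCommGroup V₁] [Module A V₁] [Module K V₁] [IsScalarTower A K V₁]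
    [AddCommGroup V₂] [Module A V₂] [Module κ V₂] [IsScalarTower A κ V₂]
    (e₁ : M →ₗ[A] V₁) (e₂ : M →ₗ[A] V₂)
    (h : ∀ m, e₂ m = 0 → ∃ u m', e₁ u = 0 ∧ m = u + π • m') :
    finrank K (Submodule.span K (Set.range e₁)) +
      finrank κ (Submodule.span κ (e₂ '' LinearMap.ker e₁)) =
      finrank κ (Submodule.span κ (Set.range e₂)) := by
  have : Module.IsTorsionFree A V₁ := Module.IsTorsionFree.trans_faithfulSMul A K V₁
  let b := Module.finBasis A (LinearMap.range e₁)
  set W := Submodule.span κ (Set.range e₂)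
  set W' := Submodule.span κ (e₂ '' LinearMap.ker e₁)
  have : FiniteDimensional κ W := finiteDimensional_span_range κ e₂
  let ψ : M →ₗ[A] V₂ ⧸ W' := (W'.mkQ.restrictScalars A).comp e₂
  let φ : (M ⧸ LinearMap.ker e₁) →ₗ[A] V₂ ⧸ W' := (LinearMap.ker e₁).liftQ ψ fun u hu =>
    (Submodule.Quotient.mk_eq_zero W').mpr (Submodule.subset_span ⟨u, hu, rfl⟩)
  have hφ (q) (hq : φ q = 0) : ∃ q', q = π • q' := by
    obtain ⟨m, rfl⟩ := Submodule.Quotient.mk_surjective _ q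
    obtain ⟨u, hu, hum⟩ := (mem_span_image_iff hsurj e₂ (LinearMap.ker e₁)).mp
      ((Submodule.Quotient.mk_eq_zero W').mp hq)
    obtain ⟨u', m', hu', hm'⟩ := h (m - u) (by rw [map_sub, hum, sub_self])
    refine ⟨Submodule.Quotient.mk m', ?_⟩
    rw [← Submodule.Quotient.mk_smul, Submodule.Quotient.eq,
      show m - π • m' = u' + u by rw [sub_eq_iff_eq_add.mp hm']; abel]
    exact add_mem hu' hu
  have hrange : W.map W'.mkQ = Submodule.span κ (Set.range φ) := by
    have hφψ : LinearMap.range φ = LinearMap.range ψ := Submodule.range_liftQ _ _ _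
    rw [← LinearMap.coe_range, hφψ, LinearMap.coe_range, Submodule.map_span, ← Set.range_comp]
    rfl
  have hsubtype : Set.range e₁ = Set.range (LinearMap.range e₁).subtype := Subtype.range_coe.symm
  rw [← finrank_map_mkQ_add_finrank (Submodule.span_mono (Set.image_subset_range _ _) : W' ≤ W),
    hrange, finrank_span_range_of_ker_eq hsurj hker (b.map e₁.quotKerEquivRange.symm) hφ, hsubtype,
    finrank_span_range_of_injective K b Subtype.val_injective]

end LinearAlgebra

variable {A σ : Type*} [CommRing A]

theorem exists_eq_add_C_mul_of_map_mem_map {κ : Type*} [CommRing κ] [Algebra A κ] {π : A}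
    (hsurj : Function.Surjective (algebraMap A κ)) (hker : ∀ a : A, algebraMap A κ a = 0 ↔ π ∣ a)
    {I : Ideal (MvPolynomial σ A)} (hI : I.IsHomogeneous (homogeneousSubmodule σ A))
    {d : ℕ} {f : MvPolynomial σ A} (hf : f.IsHomogeneous d)
    (h : map (algebraMap A κ) f ∈ I.map (map (algebraMap A κ))) :
    ∃ u ∈ I, u.IsHomogeneous d ∧ ∃ s : MvPolynomial σ A, s.IsHomogeneous d ∧ f = u + C π * s := by
  have hker_map : RingHom.ker (map (σ := σ) (algebraMap A κ)) = Ideal.span {C π} := by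
    rw [ker_map, show RingHom.ker (algebraMap A κ) = Ideal.span {π} from
      Ideal.ext fun a => by rw [RingHom.mem_ker, hker, Ideal.mem_span_singleton], Ideal.map_span,
      Set.image_singleton]
  have hmem : f ∈ I ⊔ Ideal.span {C π} := by
    rw [← hker_map, ← Ideal.comap_map_of_surjective' _ (map_surjective _ hsurj)]
    exact h
  obtain ⟨u, hu, v, hv, rfl⟩ := Submodule.mem_sup.mp hmem
  obtain ⟨s, rfl⟩ := Ideal.mem_span_singleton.mp hv
  refine ⟨homogeneousComponent d u, coe_decompose_homogeneousSubmodule d u ▸ hI d hu,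
    homogeneousComponent_isHomogeneous d u, homogeneousComponent d s,
    homogeneousComponent_isHomogeneous d s, ?_⟩
  have hcomp := homogeneousComponent_of_mem (m := d) hf
  rw [if_pos rfl, map_add, homogeneousComponent_C_mul] at hcomp
  exact hcomp.symm

end ProjectiveModel

namespace FunctionField1

open MvPolynomial ProjectiveModel Module

theorem le_of_eventually_mul_le_mul_add {a b c : ℤ}
    (h : ∀ᶠ d : ℕ in Filter.atTop, a * (d : ℤ) ≤ b * d + c) : a ≤ b := by
  by_contra! hlt
  obtain ⟨d, hd, hcd⟩ := (h.and (Filter.eventually_gt_atTop c.toNat)).exists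
  have : (b + 1) * (d : ℤ) ≤ a * d := mul_le_mul_of_nonneg_right hlt (Int.natCast_nonneg d)
  have : c < d := by omega
  linarith

variable {A σ : Type*} [CommRing A]

variable (A) in
/-- Evaluation at `y` of the forms of degree `d` with coefficients in `A`. -/
noncomputable def evalForms {F : Type*} [Field F] [Algebra A F] (y : σ → F) (d : ℕ) :
    homogeneousSubmodule σ A d →ₗ[A] F :=
  (aeval y).toLinearMap ∘ₗ (homogeneousSubmodule σ A d).subtype

theorem evalForms_apply {F : Type*} [Field F] [Algebra A F] (y : σ → F) {d : ℕ}
    (f : homogeneousSubmodule σ A d) : evalForms A y d f = aeval y f.1 := rfl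

theorem span_range_evalForms {k F : Type*} [Field k] [Algebra A k] [Field F] [Algebra k F]
    [Algebra A F] [IsScalarTower A k F] (y : σ → F) (d : ℕ) :
    Submodule.span k (Set.range (evalForms A y d)) = formValues k y d := by
  refine le_antisymm (Submodule.span_le.mpr ?_) (formValues_le_of_monomials fun m hm => ?_)
  · rintro _ ⟨⟨f, hf⟩, rfl⟩
    exact mem_formValues.mpr ⟨map (algebraMap A k) f, IsHomogeneous.map hf _,
      aeval_map_algebraMap k y f⟩
  · refine Submodule.subset_span ⟨⟨monomial m 1, isHomogeneous_monomial 1 hm⟩, ?_⟩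
    rw [evalForms_apply, aeval_monomial, map_one, one_mul]

variable (A) in
/-- The values at `y₂` of the forms of degree `d` over `A` that vanish at `y₁`. It vanishes when
`y₂` specializes `y₁`, that is, when `y₂` lies on the closure of `y₁` in the projective space
over `A`. -/
noncomputable def vanishingValues {F₁ F₂ : Type*} (κ : Type*) [Field F₁] [Algebra A F₁] [Field F₂]
    [Algebra A F₂] [Field κ] [Algebra κ F₂] (y₁ : σ → F₁) (y₂ : σ → F₂) (d : ℕ) :
    Submodule κ F₂ :=
  Submodule.span κ (evalForms A y₂ d '' LinearMap.ker (evalForms A y₁ d))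

section vanishingValues

variable {κ F₁ F₂ : Type*} [Field F₁] [Algebra A F₁] [Field κ] [Field F₂]
  [Algebra κ F₂] [Algebra A F₂] {y₁ : σ → F₁} {y₂ : σ → F₂}

theorem vanishingValues_eq_bot {d : ℕ}
    (h : ∀ t : MvPolynomial σ A, t.IsHomogeneous d → aeval y₁ t = 0 → aeval y₂ t = 0) :
    vanishingValues A κ y₁ y₂ d = ⊥ := by
  refine Submodule.span_eq_bot.mpr ?_
  rintro _ ⟨⟨t, ht⟩, ht0, rfl⟩
  exact h t ht ht0

variable [Algebra A κ] [IsScalarTower A κ F₂]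

theorem vanishingValues_le_formValues (y₁ : σ → F₁) (y₂ : σ → F₂) (d : ℕ) :
    vanishingValues A κ y₁ y₂ d ≤ formValues κ y₂ d := by
  rw [← span_range_evalForms (A := A)]
  exact Submodule.span_mono (Set.image_subset_range _ _)

theorem finrank_formValues_le_finrank_vanishingValues [IsFunctionField κ F₂] {D : Divisor κ F₂}
    (hD : IsHyperplaneDivisor y₂ D) {e : ℕ} {t : MvPolynomial σ A} (ht : t.IsHomogeneous e)
    (ht₁ : aeval y₁ t = 0) (ht₂ : aeval y₂ t ≠ 0) (d : ℕ) :
    finrank κ (formValues κ y₂ d) ≤ finrank κ (vanishingValues A κ y₁ y₂ (d + e)) := by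
  have hle : (formValues κ y₂ d).map (LinearMap.mulRight κ (aeval y₂ t)) ≤
      vanishingValues A κ y₁ y₂ (d + e) := by
    rw [← span_range_evalForms (A := A), Submodule.map_span]
    refine Submodule.span_mono ?_
    rintro _ ⟨_, ⟨⟨f, hf⟩, rfl⟩, rfl⟩
    refine ⟨⟨f * t, IsHomogeneous.mul hf ht⟩, ?_, map_mul (aeval (R := A) y₂) f t⟩
    rw [SetLike.mem_coe, LinearMap.mem_ker, evalForms_apply, map_mul, ht₁, mul_zero]
  have := finite_formValues hD (d + e)
  have := Submodule.finiteDimensional_of_le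
    (vanishingValues_le_formValues (A := A) (κ := κ) y₁ y₂ (d + e))
  rw [(Submodule.equivMapOfInjective (LinearMap.mulRight κ (aeval y₂ t))
    (mul_left_injective₀ ht₂) (formValues κ y₂ d)).finrank_eq]
  exact Submodule.finrank_mono hle

end vanishingValues

theorem IsGenericPoint.aeval_eq_zero_of_mem {K F : Type*} [Field K] [Algebra A K] [Field F]
    [Algebra K F] [Algebra A F] [IsScalarTower A K F] {I : Ideal (MvPolynomial σ A)} {y : σ → F}
    (h : IsGenericPoint (I.map (map (algebraMap A K))) y) {d : ℕ} {f : MvPolynomial σ A}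
    (hf : f.IsHomogeneous d) (hfI : f ∈ I) : aeval y f = 0 := by
  rw [← aeval_map_algebraMap K, h.aeval_eq_zero_iff d _ (hf.map _)]
  exact mem_saturation_of_mem (Ideal.mem_map_of_mem _ hfI)

section Reduction

variable [Finite σ] {κ F₂ : Type*} [Field κ] [Algebra A κ] [Field F₂] [Algebra κ F₂] [Algebra A F₂]
  [IsScalarTower A κ F₂] {I : Ideal (MvPolynomial σ A)} {y₂ : σ → F₂} {π : A}

theorem IsGenericPoint.eventually_exists_eq_add_C_mul
    (h₂ : IsGenericPoint (I.map (map (algebraMap A κ))) y₂)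
    (hsurj : Function.Surjective (algebraMap A κ)) (hker : ∀ a : A, algebraMap A κ a = 0 ↔ π ∣ a)
    (hI : I.IsHomogeneous (homogeneousSubmodule σ A))
    (hI₂ : (I.map (map (algebraMap A κ))).IsHomogeneous (homogeneousSubmodule σ κ)) :
    ∀ᶠ d : ℕ in Filter.atTop, ∀ f : MvPolynomial σ A, f.IsHomogeneous d → aeval y₂ f = 0 →
      ∃ u ∈ I, u.IsHomogeneous d ∧
        ∃ s : MvPolynomial σ A, s.IsHomogeneous d ∧ f = u + C π * s := by
  filter_upwards [eventually_mem_of_mem_saturation hI₂] with d hd f hf hf0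
  rw [← aeval_map_algebraMap κ, h₂.aeval_eq_zero_iff d _ (hf.map _)] at hf0
  exact exists_eq_add_C_mul_of_map_mem_map hsurj hker hI hf (hd _ (hf.map _) hf0)

variable {K F₁ : Type*} [Field K] [Algebra A K] [Field F₁] [Algebra K F₁] [Algebra A F₁]
  [IsScalarTower A K F₁] {y₁ : σ → F₁}

variable [IsFractionRing A K] [IsDomain A] [IsDiscreteValuationRing A]

theorem eventually_finrank_formValues_add_finrank_vanishingValues
    (h₁ : IsGenericPoint (I.map (map (algebraMap A K))) y₁)
    (h₂ : IsGenericPoint (I.map (map (algebraMap A κ))) y₂)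
    (hsurj : Function.Surjective (algebraMap A κ)) (hker : ∀ a : A, algebraMap A κ a = 0 ↔ π ∣ a)
    (hI : I.IsHomogeneous (homogeneousSubmodule σ A))
    (hI₂ : (I.map (map (algebraMap A κ))).IsHomogeneous (homogeneousSubmodule σ κ)) :
    ∀ᶠ d : ℕ in Filter.atTop, finrank K (formValues K y₁ d) +
      finrank κ (vanishingValues A κ y₁ y₂ d) = finrank κ (formValues κ y₂ d) := by
  filter_upwards [h₂.eventually_exists_eq_add_C_mul hsurj hker hI hI₂] with d hd
  have : Module.Finite A (homogeneousSubmodule σ A d) :=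
    Module.Finite.iff_fg.mpr (homogeneousSubmodule_fg σ A d)
  rw [← span_range_evalForms (A := A), ← span_range_evalForms (A := A)]
  refine finrank_generic_add_finrank_image_ker hsurj hker _ _ ?_
  rintro ⟨f, hf⟩ hf0
  obtain ⟨u, huI, hu, s, hs, rfl⟩ := hd f hf hf0
  exact ⟨⟨u, hu⟩, ⟨s, hs⟩, h₁.aeval_eq_zero_of_mem hu huI,
    Subtype.ext (congrArg (u + ·) (C_mul' (a := π) (p := s)))⟩

-- A form vanishing at `y₁` but not at `y₂` would bound the Hilbert function of the generic fibre.
theorem aeval_eq_zero_of_aeval_eq_zero [IsFunctionField K F₁] [IsFunctionField κ F₂]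
    (h₁ : IsGenericPoint (I.map (map (algebraMap A K))) y₁)
    (h₂ : IsGenericPoint (I.map (map (algebraMap A κ))) y₂)
    (hsurj : Function.Surjective (algebraMap A κ)) (hker : ∀ a : A, algebraMap A κ a = 0 ↔ π ∣ a)
    (hI : I.IsHomogeneous (homogeneousSubmodule σ A))
    (hI₂ : (I.map (map (algebraMap A κ))).IsHomogeneous (homogeneousSubmodule σ κ))
    {e : ℕ} {t : MvPolynomial σ A} (ht : t.IsHomogeneous e) (ht₁ : aeval y₁ t = 0) :
    aeval y₂ t = 0 := by
  by_contra ht₂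
  obtain ⟨i₁, hi₁⟩ := h₁.exists_eq_one
  obtain ⟨i₂, hi₂⟩ := h₂.exists_eq_one
  obtain ⟨D₁, hD₁⟩ := exists_isHyperplaneDivisor K hi₁
  obtain ⟨D₂, hD₂⟩ := exists_isHyperplaneDivisor κ hi₂
  obtain ⟨C₁, hC₁⟩ := hD₁.exists_le_finrank_formValues hi₁ h₁.isFormFractionField
  obtain ⟨C₂, hC₂⟩ := hD₂.exists_le_finrank_formValues hi₂ h₂.isFormFractionField
  have hdeg₂ := hD₂.degree_pos h₂.isFormFractionField
  refine (hD₁.degree_pos h₁.isFormFractionField).not_ge (le_of_eventually_mul_le_mul_add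
    (c := C₁ + C₂ + D₂.degree * e + 1 - genus κ F₂) ?_)
  filter_upwards [(Filter.tendsto_add_atTop_nat e).eventually
      (eventually_finrank_formValues_add_finrank_vanishingValues h₁ h₂ hsurj hker hI hI₂),
    (Filter.tendsto_add_atTop_nat e).eventually (hD₂.eventually_finrank_formValues_le hdeg₂)]
    with d hadd hle
  have hvan := finrank_formValues_le_finrank_vanishingValues (A := A) hD₂ ht ht₁ ht₂ d
  have hmono : D₁.degree * d ≤ D₁.degree * (d + e) :=
    mul_le_mul_of_nonneg_left (by omega) (hD₁.degree_pos h₁.isFormFractionField).le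
  have hC₁d := hC₁ (d + e)
  have hC₂d := hC₂ d
  push_cast at hC₁d hle
  zify at hadd hvan
  linarith

-- Nakayama's lemma for the module of forms of degree `d` that vanish at `y₁`.
theorem eventually_mem_of_aeval_eq_zero [IsFunctionField K F₁] [IsFunctionField κ F₂]
    (h₁ : IsGenericPoint (I.map (map (algebraMap A K))) y₁)
    (h₂ : IsGenericPoint (I.map (map (algebraMap A κ))) y₂) (hπ : Irreducible π)
    (hsurj : Function.Surjective (algebraMap A κ)) (hker : ∀ a : A, algebraMap A κ a = 0 ↔ π ∣ a)
    (hI : I.IsHomogeneous (homogeneousSubmodule σ A))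
    (hI₂ : (I.map (map (algebraMap A κ))).IsHomogeneous (homogeneousSubmodule σ κ)) :
    ∀ᶠ d : ℕ in Filter.atTop, ∀ t : MvPolynomial σ A, t.IsHomogeneous d → aeval y₁ t = 0 →
      t ∈ I := by
  have hπ₁ : algebraMap A F₁ π ≠ 0 := by
    rw [IsScalarTower.algebraMap_apply A K F₁]
    exact (map_ne_zero _).mpr ((map_ne_zero_iff _ (IsFractionRing.injective A K)).mpr hπ.ne_zero)
  filter_upwards [h₂.eventually_exists_eq_add_C_mul hsurj hker hI hI₂] with d hd t ht ht₁
  let M := homogeneousSubmodule σ A d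
  have : Module.Finite A M := Module.Finite.iff_fg.mpr (homogeneousSubmodule_fg σ A d)
  let N : Submodule A M := LinearMap.ker (evalForms A y₁ d)
  let N' : Submodule A M := (I.restrictScalars A).comap M.subtype
  have hNak : N ≤ N' ⊔ Ideal.span {π} • N := by
    rintro ⟨s, hs⟩ hs₁
    obtain ⟨u, huI, hu, s', hs', rfl⟩ := hd s hs
      (aeval_eq_zero_of_aeval_eq_zero h₁ h₂ hsurj hker hI hI₂ hs hs₁)
    have hs'₁ : aeval y₁ s' = 0 := by
      rw [LinearMap.mem_ker, evalForms_apply, map_add, h₁.aeval_eq_zero_of_mem hu huI, zero_add,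
        map_mul, aeval_C] at hs₁
      exact (mul_eq_zero.mp hs₁).resolve_left hπ₁
    refine Submodule.mem_sup.mpr ⟨⟨u, hu⟩, huI, π • ⟨s', hs'⟩, ?_,
      Subtype.ext (congrArg (u + ·) (C_mul' (a := π) (p := s')).symm)⟩
    exact Submodule.smul_mem_smul (Ideal.mem_span_singleton_self π) hs'₁
  have hrad : Ideal.span {π} ≤ (⊥ : Ideal A).jacobson := by
    rw [← (IsDiscreteValuationRing.irreducible_iff_uniformizer π).mp hπ]
    exact IsLocalRing.maximalIdeal_le_jacobson ⊥
  exact Submodule.le_of_le_smul_of_le_jacobson_bot (IsNoetherian.noetherian N) hrad hNak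
    (x := ⟨t, ht⟩) ht₁

theorem eventually_mem_of_C_mul_mem [IsFunctionField K F₁] [IsFunctionField κ F₂]
    (h₁ : IsGenericPoint (I.map (map (algebraMap A K))) y₁)
    (h₂ : IsGenericPoint (I.map (map (algebraMap A κ))) y₂) (hπ : Irreducible π)
    (hsurj : Function.Surjective (algebraMap A κ)) (hker : ∀ a : A, algebraMap A κ a = 0 ↔ π ∣ a)
    (hI : I.IsHomogeneous (homogeneousSubmodule σ A))
    (hI₂ : (I.map (map (algebraMap A κ))).IsHomogeneous (homogeneousSubmodule σ κ)) :
    ∀ᶠ d : ℕ in Filter.atTop, ∀ f : MvPolynomial σ A, f.IsHomogeneous d →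
      ∀ a : A, a ≠ 0 → C a * f ∈ I → f ∈ I := by
  filter_upwards [eventually_mem_of_aeval_eq_zero h₁ h₂ hπ hsurj hker hI hI₂]
    with d hd f hf a ha haf
  refine hd f hf ?_
  have haf₁ := h₁.aeval_eq_zero_of_mem ((isHomogeneous_C σ a).mul hf) haf
  rw [map_mul, aeval_C, IsScalarTower.algebraMap_apply A K F₁] at haf₁
  exact (mul_eq_zero.mp haf₁).resolve_left
    ((map_ne_zero _).mpr ((map_ne_zero_iff _ (IsFractionRing.injective A K)).mpr ha))

theorem chartsIntegrallyClosed_of_genus_eq [IsFunctionField K F₁] [IsFunctionField κ F₂]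
    (h₁ : IsGenericPoint (I.map (map (algebraMap A K))) y₁)
    (h₂ : IsGenericPoint (I.map (map (algebraMap A κ))) y₂)
    (hsurj : Function.Surjective (algebraMap A κ)) (hker : ∀ a : A, algebraMap A κ a = 0 ↔ π ∣ a)
    (hI : I.IsHomogeneous (homogeneousSubmodule σ A))
    (hI₂ : (I.map (map (algebraMap A κ))).IsHomogeneous (homogeneousSubmodule σ κ))
    (hc : ChartsIntegrallyClosed K y₁) (hg : genus κ F₂ = genus K F₁) :
    ChartsIntegrallyClosed κ y₂ := by
  obtain ⟨i₁, hi₁⟩ := h₁.exists_eq_one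
  obtain ⟨i₂, hi₂⟩ := h₂.exists_eq_one
  obtain ⟨D₁, hD₁⟩ := exists_isHyperplaneDivisor K hi₁
  obtain ⟨D₂, hD₂⟩ := exists_isHyperplaneDivisor κ hi₂
  have hdeg₁ := hD₁.degree_pos h₁.isFormFractionField
  have hdeg₂ := hD₂.degree_pos h₂.isFormFractionField
  have hrank : ∀ᶠ d : ℕ in Filter.atTop, (finrank κ (formValues κ y₂ d) : ℤ) =
      D₁.degree * d + 1 - genus K F₁ := by
    filter_upwards [(hD₁.chartsIntegrallyClosed_iff hi₁ hdeg₁).mp hc,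
      eventually_finrank_formValues_add_finrank_vanishingValues h₁ h₂ hsurj hker hI hI₂]
      with d hd hadd
    rw [← hd, ← hadd, vanishingValues_eq_bot fun t ht => aeval_eq_zero_of_aeval_eq_zero h₁ h₂ hsurj
      hker hI hI₂ ht, finrank_bot, add_zero]
  have hdeg : D₁.degree = D₂.degree := by
    obtain ⟨C, hC⟩ := hD₂.exists_le_finrank_formValues hi₂ h₂.isFormFractionField
    apply le_antisymm
    · refine le_of_eventually_mul_le_mul_add (c := 0) ?_
      filter_upwards [hrank, hD₂.eventually_finrank_formValues_le hdeg₂] with d hd hle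
      linarith
    · refine le_of_eventually_mul_le_mul_add (c := C + 1 - genus K F₁) ?_
      filter_upwards [hrank] with d hd
      linarith [hC d]
  rw [hD₂.chartsIntegrallyClosed_iff hi₂ hdeg₂, ← hdeg, hg]
  exact hrank

end Reduction

end FunctionField1

/-! ### Smoothness of normal affine curves over perfect fields -/

namespace FunctionField1

section Dedekind

open Polynomial

variable {k R : Type*} [Field k] [CommRing R] [Algebra k R]

theorem exists_maximalIdeal_localization_eq_span [IsDedekindDomain R] {q : Ideal R} [q.IsPrime]
    (hq : q ≠ ⊥) : ∃ t ∈ q, t ≠ 0 ∧ IsLocalRing.maximalIdeal (Localization.AtPrime q) =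
      Ideal.span {algebraMap R (Localization.AtPrime q) t} := by
  have := IsLocalization.AtPrime.isDiscreteValuationRing_of_dedekind_domain R hq
    (Localization.AtPrime q)
  obtain ⟨ϖ, hϖ⟩ := IsDiscreteValuationRing.exists_irreducible (Localization.AtPrime q)
  obtain ⟨⟨t, s⟩, hts⟩ := IsLocalization.surj q.primeCompl ϖ
  have hs := IsLocalization.map_units (Localization.AtPrime q) s
  have hspan : IsLocalRing.maximalIdeal (Localization.AtPrime q) =
      Ideal.span {algebraMap R (Localization.AtPrime q) t} := by
    rw [hϖ.maximalIdeal_eq, ← show _ = algebraMap R (Localization.AtPrime q) t from hts,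
      Ideal.span_singleton_mul_right_unit hs]
  refine ⟨t, ?_, ?_, hspan⟩
  · rw [← IsLocalization.AtPrime.to_map_mem_maximal_iff (Localization.AtPrime q) q, hspan]
    exact Ideal.mem_span_singleton_self _
  · rintro rfl
    rw [map_zero] at hts
    exact hϖ.ne_zero ((IsUnit.mul_left_eq_zero hs).mp hts)

theorem transcendental_of_not_isUnit [IsDomain R] {t : R} (ht0 : t ≠ 0) (ht : ¬ IsUnit t) :
    Transcendental k t := fun halg => by
  obtain ⟨r, hr, hdvd⟩ := halg.exists_nonzero_dvd (mem_nonZeroDivisors_of_ne_zero ht0)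
  exact ht (isUnit_of_dvd_unit hdvd ((isUnit_iff_ne_zero.mpr hr).map (algebraMap k R)))

theorem finite_residueField [Algebra.FiniteType k R] (q : Ideal R) [q.IsMaximal] :
    Module.Finite k q.ResidueField := by
  let := Ideal.Quotient.field q
  have := finite_of_finite_type_of_isJacobsonRing k (R ⧸ q)
  exact Module.Finite.of_surjective (IsScalarTower.toAlgHom k (R ⧸ q) q.ResidueField).toLinearMap
    q.bijective_algebraMap_quotient_residueField.surjective

theorem isUnramifiedAt_of_maximalIdeal_eq_span [PerfectField k] [Algebra.FiniteType k R]
    {P : Type*} [CommRing P] [Algebra k P] [Algebra P R] [IsScalarTower k P R] {q : Ideal R}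
    [q.IsMaximal] {t : P} (ht : algebraMap P R t ∈ q)
    (hspan : IsLocalRing.maximalIdeal (Localization.AtPrime q) =
      Ideal.span {algebraMap P (Localization.AtPrime q) t}) : Algebra.IsUnramifiedAt P q := by
  let p := q.under P
  let := Localization.AtPrime.algebraOfLiesOver p q
  have : Algebra.FiniteType P R := .of_restrictScalars_finiteType k _ _
  have : Algebra.IsSeparable p.ResidueField q.ResidueField := by
    have := finite_residueField (k := k) q
    have : Algebra.IsAlgebraic p.ResidueField q.ResidueField := .tower_top (K := k) _
    have : Algebra.IsAlgebraic k p.ResidueField := .tower_bot k _ q.ResidueField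
    have : PerfectField p.ResidueField := Algebra.IsAlgebraic.perfectField k
    infer_instance
  rw [Algebra.isUnramifiedAt_iff_map_eq P p q]
  refine ⟨this, le_antisymm ?_ ?_⟩
  · rw [IsScalarTower.algebraMap_eq P R, ← Ideal.map_map,
      ← Localization.AtPrime.map_eq_maximalIdeal]
    exact Ideal.map_mono Ideal.map_comap_le
  · rw [hspan, Ideal.span_singleton_le_iff_mem]
    exact Ideal.mem_map_of_mem _ ht

-- A local uniformizer makes `R` étale over the affine line near a closed point.
theorem isSmoothAt_of_ne_bot [PerfectField k] [Algebra.FiniteType k R] [IsDedekindDomain R]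
    {q : Ideal R} [q.IsPrime] (hq : q ≠ ⊥) : Algebra.IsSmoothAt k q := by
  obtain ⟨t, htq, ht0, hspan⟩ := exists_maximalIdeal_localization_eq_span hq
  have htr : Transcendental k t := transcendental_of_not_isUnit ht0 fun hu =>
    Ideal.IsPrime.ne_top ‹_› (Ideal.eq_top_of_isUnit_mem q htq hu)
  let : Algebra k[X] R := (aeval t).toAlgebra
  have : IsScalarTower k k[X] R := .of_algebraMap_eq fun c => ((aeval t).commutes c).symm
  have hX : algebraMap k[X] R X = t := aeval_X t
  have : Algebra.FiniteType k[X] R := .of_restrictScalars_finiteType k _ _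
  have : Algebra.FinitePresentation k[X] R := Algebra.FinitePresentation.of_finiteType.mp this
  have : FaithfulSMul k[X] R :=
    (faithfulSMul_iff_algebraMap_injective _ _).mpr (transcendental_iff_injective.mp htr)
  have : Module.IsTorsionFree k[X] R := inferInstance
  have : q.IsMaximal := Ideal.IsPrime.isMaximal ‹_› hq
  have : Algebra.IsUnramifiedAt k[X] q :=
    isUnramifiedAt_of_maximalIdeal_eq_span (k := k) (t := X) (hX ▸ htq)
      (by rw [IsScalarTower.algebraMap_apply k[X] R, hX, hspan])
  have : Algebra.IsEtaleAt k[X] q := Algebra.IsEtaleAt.of_isUnramifiedAt_of_flat q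
  have : Algebra.FormallySmooth k[X] (Localization.AtPrime q) := inferInstance
  exact .comp k k[X] _

theorem isSmoothAt_bot [PerfectField k] [Algebra.FiniteType k R] [IsDomain R] :
    Algebra.IsSmoothAt k (⊥ : Ideal R) := by
  have : Algebra.EssFiniteType R (FractionRing R) := .of_isLocalization _ (nonZeroDivisors R)
  have : Algebra.EssFiniteType k (FractionRing R) := .comp k R _
  have : Algebra.FormallySmooth k (FractionRing R) := inferInstance
  have hcompl : (⊥ : Ideal R).primeCompl = nonZeroDivisors R := by
    ext x
    rw [Ideal.mem_primeCompl_iff, Ideal.mem_bot, mem_nonZeroDivisors_iff_ne_zero]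
  have : IsLocalization (⊥ : Ideal R).primeCompl (FractionRing R) := by
    rw [hcompl]
    infer_instance
  exact .of_equiv ((IsLocalization.algEquiv (⊥ : Ideal R).primeCompl (FractionRing R)
    (Localization.AtPrime (⊥ : Ideal R))).restrictScalars k)

theorem smooth_of_isDedekindDomain [PerfectField k] [Algebra.FiniteType k R]
    [IsDedekindDomain R] : Algebra.Smooth k R := by
  have : Algebra.FinitePresentation k R := Algebra.FinitePresentation.of_finiteType.mp ‹_›
  refine ⟨Algebra.smoothLocus_eq_univ_iff.mp (Set.eq_univ_iff_forall.mpr ?_), this⟩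
  rintro ⟨q, _⟩
  by_cases hq : q = ⊥
  · subst hq
    exact isSmoothAt_bot
  · exact isSmoothAt_of_ne_bot hq

end Dedekind

variable {k F : Type*} [Field k] [Field F] [Algebra k F] [IsFunctionField k F]

theorem dimensionLEOne_subalgebra (O : Subalgebra k F) : Ring.DimensionLEOne O := by
  refine ⟨fun {q} hq0 hq => ?_⟩
  obtain ⟨x, hxq, hx0⟩ := Submodule.exists_mem_ne_zero_of_ne_bot hq0
  have hx : Transcendental k (x : F) :=
    (transcendental_algebraMap_iff (R := k) (S := O) (A := F) Subtype.val_injective).mpr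
      (transcendental_of_not_isUnit hx0 fun hu =>
        hq.ne_top (Ideal.eq_top_of_isUnit_mem q hxq hu))
  have := finite_quotient_span O hx
  have hle : Ideal.span {x} ≤ q := (Ideal.span_singleton_le_iff_mem q).mpr hxq
  have : Module.Finite k (O ⧸ q) := Module.Finite.of_surjective
    (Ideal.Quotient.factorₐ k hle).toLinearMap (Ideal.Quotient.factor_surjective hle)
  have : Algebra.IsIntegral k (O ⧸ q) := inferInstance
  exact Ideal.Quotient.maximal_of_isField q
    (isField_of_isIntegral_of_isField' (R := k) (Field.toIsField k))

theorem isDedekindDomain_subalgebra {O : Subalgebra k F}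
    (hO : ∀ f : F, IsIntegral O f → f ∈ O) : IsDedekindDomain O := by
  have := isNoetherianRing_subalgebra O
  have := dimensionLEOne_subalgebra O
  have : IsIntegrallyClosed O := by
    rw [isIntegrallyClosed_iff (FractionRing O)]
    intro x hx
    let φ : FractionRing O →ₐ[O] F := IsFractionRing.liftAlgHom (g := Algebra.ofId O F)
      Subtype.val_injective
    exact ⟨⟨φ x, hO _ (hx.map φ)⟩, φ.toRingHom.injective (φ.commutes _)⟩
  exact {}

theorem ChartsIntegrallyClosed.smooth {σ : Type*} [Finite σ] {y : σ → F} [PerfectField k]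
    (h : ChartsIntegrallyClosed k y) {j : σ} (hj : y j ≠ 0) : Algebra.Smooth k (chart k y j) := by
  have := isDedekindDomain_subalgebra (h j hj)
  have : Algebra.FiniteType k (chart k y j) := by
    rw [← Subalgebra.fg_iff_finiteType]
    exact Subalgebra.fg_def.mpr ⟨_, Set.finite_range _, rfl⟩
  exact smooth_of_isDedekindDomain

end FunctionField1

/-! ### Smoothness from the fibres over a discrete valuation ring -/

namespace ProjectiveModel

open MvPolynomial
open scoped TensorProduct

section Fibers

variable {A R : Type*} [CommRing A] [CommRing R] [Algebra A R]

theorem formallySmooth_tensorProduct_of_comp_eq {B L : Type*} [CommRing B] [Algebra A B]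
    [CommRing L] [Algebra A L] (φ : B →+* L) (hφ : φ.comp (algebraMap A B) = algebraMap A L)
    [Algebra.FormallySmooth B (B ⊗[A] R)] : Algebra.FormallySmooth L (L ⊗[A] R) := by
  let := φ.toAlgebra
  have : IsScalarTower A B L := .of_algebraMap_eq' hφ.symm
  exact .of_equiv (Algebra.TensorProduct.cancelBaseChange A B L L R)

theorem smooth_of_formallySmooth_fibers [IsDomain A] [IsDiscreteValuationRing A]
    [Algebra.FiniteType A R] [Module.IsTorsionFree A R] (K : Type*) {κ : Type*} [Field K]
    [Algebra A K] [IsFractionRing A K] [Field κ] [Algebra A κ] {π : A} (hπ : Irreducible π)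
    (hsurj : Function.Surjective (algebraMap A κ)) (hker : ∀ a : A, algebraMap A κ a = 0 ↔ π ∣ a)
    [Algebra.FormallySmooth K (K ⊗[A] R)] [Algebra.FormallySmooth κ (κ ⊗[A] R)] :
    Algebra.Smooth A R := by
  have : Algebra.FinitePresentation A R := Algebra.FinitePresentation.of_finiteType.mp ‹_›
  refine .of_formallySmooth_fiber fun P hP => ?_
  by_cases hP0 : P = ⊥
  · have hinj : Function.Injective (algebraMap A P.ResidueField) := by
      rw [injective_iff_map_eq_zero]
      intro a ha
      rwa [Ideal.algebraMap_residueField_eq_zero, hP0, Ideal.mem_bot] at ha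
    exact formallySmooth_tensorProduct_of_comp_eq (IsFractionRing.lift (K := K) hinj)
      (IsLocalization.lift_comp _)
  · have hPπ : P = Ideal.span {π} := by
      rw [← hπ.maximalIdeal_eq]
      exact IsLocalRing.eq_maximalIdeal (hP.isMaximal hP0)
    have hle : RingHom.ker (algebraMap A κ) ≤ RingHom.ker (algebraMap A P.ResidueField) := by
      intro a ha
      rw [RingHom.mem_ker, hker] at ha
      rw [RingHom.mem_ker, Ideal.algebraMap_residueField_eq_zero, hPπ]
      exact Ideal.mem_span_singleton.mpr ha
    exact formallySmooth_tensorProduct_of_comp_eq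
      ((algebraMap A κ).liftOfSurjective hsurj ⟨algebraMap A P.ResidueField, hle⟩)
      (RingHom.liftOfSurjective_comp _ _ _)

end Fibers

variable {A σ : Type*} [CommRing A] (I : Ideal (MvPolynomial σ A)) (j : σ)

/-- The coordinate ring of the affine chart `X j ≠ 0` of the projective scheme defined by `I`. -/
abbrev ChartRing : Type _ := MvPolynomial σ A ⧸ chartIdeal I j

theorem map_chartIdeal {B : Type*} [CommRing B] (φ : A →+* B) :
    (chartIdeal I j).map (map φ) = chartIdeal (I.map (map φ)) j := by
  rw [chartIdeal, Ideal.map_sup, Ideal.map_span, Set.image_singleton, map_sub, map_X, map_one,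
    chartIdeal]

theorem map_algebraTensorAlgEquiv_map_includeRight (B : Type*) [CommRing B] [Algebra A B]
    (J : Ideal (MvPolynomial σ A)) :
    (J.map (Algebra.TensorProduct.includeRight : _ →ₐ[A] B ⊗[A] MvPolynomial σ A)).map
      (algebraTensorAlgEquiv (σ := σ) A B : B ⊗[A] MvPolynomial σ A →+* MvPolynomial σ B) =
      J.map (map (algebraMap A B)) := by
  have hcomp : (algebraTensorAlgEquiv (σ := σ) A B : _ →+* MvPolynomial σ B).comp
      (Algebra.TensorProduct.includeRight : _ →ₐ[A] B ⊗[A] MvPolynomial σ A).toRingHom =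
      map (algebraMap A B) :=
    RingHom.ext fun f => (algebraTensorAlgEquiv_tmul A B 1 f).trans (one_smul B _)
  rw [← hcomp, ← Ideal.map_map]
  rfl

/-- The coordinate rings of the charts commute with base change. -/
noncomputable def baseChangeChartRing (B : Type*) [CommRing B] [Algebra A B] :
    B ⊗[A] ChartRing I j ≃ₐ[B] ChartRing (I.map (map (algebraMap A B))) j :=
  (Algebra.TensorProduct.tensorQuotientEquiv B (MvPolynomial σ A) B (chartIdeal I j)).trans <|
    Ideal.quotientEquivAlg _ _ (algebraTensorAlgEquiv A B) <| by
      rw [map_algebraTensorAlgEquiv_map_includeRight, map_chartIdeal]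

theorem smooth_chartRing [IsDomain A] [IsDiscreteValuationRing A] [Finite σ]
    [Module.IsTorsionFree A (ChartRing I j)] (K : Type*) {κ : Type*} [Field K] [Algebra A K]
    [IsFractionRing A K] [Field κ] [Algebra A κ] {π : A} (hπ : Irreducible π)
    (hsurj : Function.Surjective (algebraMap A κ)) (hker : ∀ a : A, algebraMap A κ a = 0 ↔ π ∣ a)
    [Algebra.Smooth K (ChartRing (I.map (map (algebraMap A K))) j)]
    [Algebra.Smooth κ (ChartRing (I.map (map (algebraMap A κ))) j)] :
    Algebra.Smooth A (ChartRing I j) :=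
  have : Algebra.FormallySmooth K (K ⊗[A] ChartRing I j) :=
    .of_equiv (baseChangeChartRing I j K).symm
  have : Algebra.FormallySmooth κ (κ ⊗[A] ChartRing I j) :=
    .of_equiv (baseChangeChartRing I j κ).symm
  smooth_of_formallySmooth_fibers K hπ hsurj hker

end ProjectiveModel

/-! ### The standard charts of a projective scheme -/

namespace ProjectiveModel

open MvPolynomial HomogeneousLocalization

theorem eval₂_mul_of_isHomogeneous {A B σ : Type*} [CommSemiring A] [CommSemiring B] (f : A →+* B)
    (c : B) (y : σ → B) {d : ℕ} {g : MvPolynomial σ A} (hg : g.IsHomogeneous d) :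
    eval₂ f (fun i => c * y i) g = c ^ d * eval₂ f y g := by
  rw [eval₂_eq, eval₂_eq, Finset.mul_sum]
  refine Finset.sum_congr rfl fun m hm => ?_
  have hd : m.degree = d := by
    rw [Finsupp.degree_eq_weight_one]
    exact hg (mem_support_iff.mp hm)
  simp_rw [mul_pow]
  rw [Finset.prod_mul_distrib, Finset.prod_pow_eq_pow_sum, ← Finsupp.degree_apply, hd,
    mul_left_comm]

variable {A σ : Type*} [CommRing A] (I : HomogeneousIdeal (homogeneousSubmodule σ A))

/-- The grading of the homogeneous coordinate ring of the projective scheme defined by `I`. -/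
noncomputable abbrev quotGrading : ℕ → Submodule A (MvPolynomial σ A ⧸ I.toIdeal) :=
  GradedQuotient.grading (homogeneousSubmodule σ A) I

variable {I} in
theorem mk_mem_quotGrading {d : ℕ} {g : MvPolynomial σ A} (hg : g.IsHomogeneous d) :
    Ideal.Quotient.mk I.toIdeal g ∈ quotGrading I d :=
  ⟨g, hg, rfl⟩

variable (j : σ)

/-- The `j`-th coordinate, as an element of the homogeneous coordinate ring. -/
noncomputable def coord : MvPolynomial σ A ⧸ I.toIdeal :=
  Ideal.Quotient.mk I.toIdeal (X j)

theorem coord_mem : coord I j ∈ quotGrading I 1 :=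
  mk_mem_quotGrading (isHomogeneous_X A j)

/-- The fraction `g / X j ^ d` for a form `g` of degree `d`. -/
noncomputable def awayFraction {d : ℕ} (g : MvPolynomial σ A) (hg : g.IsHomogeneous d) :
    Away (quotGrading I) (coord I j) :=
  Away.mk (quotGrading I) (coord_mem I j) d (Ideal.Quotient.mk I.toIdeal g)
    (by rw [smul_eq_mul, mul_one]; exact mk_mem_quotGrading hg)

theorem val_awayFraction {d : ℕ} (g : MvPolynomial σ A) (hg : g.IsHomogeneous d) :
    (awayFraction I j g hg).val =
      Localization.mk 1 ⟨coord I j, Submonoid.mem_powers _⟩ ^ d *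
        algebraMap _ _ (Ideal.Quotient.mk I.toIdeal g) := by
  rw [awayFraction, Away.val_mk, Localization.mk_pow, ← Localization.mk_one_eq_algebraMap,
    Localization.mk_mul, one_pow, one_mul, mul_one]
  rfl

/-- The structure map of the chart `X j ≠ 0`. -/
noncomputable def awayConst : A →+* Away (quotGrading I) (coord I j) :=
  (fromZeroRingHom (quotGrading I) _).comp (algebraMap A (quotGrading I 0))

/-- Dehomogenization with respect to the `j`-th coordinate. -/
noncomputable def awayHom : MvPolynomial σ A →+* Away (quotGrading I) (coord I j) :=
  eval₂Hom (awayConst I j) fun i => awayFraction I j (X i) (isHomogeneous_X A i)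

theorem awayHom_C (a : A) : awayHom I j (C a) = awayConst I j a :=
  eval₂Hom_C _ _ _

theorem awayHom_of_isHomogeneous {d : ℕ} {g : MvPolynomial σ A} (hg : g.IsHomogeneous d) :
    awayHom I j g = awayFraction I j g hg := by
  let L := Localization (Submonoid.powers (coord I j))
  let v : Away (quotGrading I) (coord I j) →+* L := algebraMap _ _
  let ι : MvPolynomial σ A →+* L :=
    (algebraMap (MvPolynomial σ A ⧸ I.toIdeal) L).comp (Ideal.Quotient.mk I.toIdeal)
  let c : L := Localization.mk 1 ⟨coord I j, Submonoid.mem_powers _⟩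
  have hX (i : σ) : v (awayFraction I j (X i) (isHomogeneous_X A i)) = c * ι (X i) := by
    rw [← pow_one c]
    exact val_awayFraction I j (X i) (isHomogeneous_X A i)
  have hconst : v.comp (awayConst I j) = ι.comp C :=
    RingHom.ext fun _ => Localization.mk_one_eq_algebraMap _
  have hι : eval₂Hom (ι.comp C) (fun i => ι (X i)) = ι := by
    ext <;> simp
  refine val_injective _ ?_
  calc v (eval₂ (awayConst I j) _ g)
      = eval₂ (ι.comp C) (fun i => c * ι (X i)) g := by
        rw [hom_eval₂, hconst]
        exact congrArg (fun y => eval₂ _ y g) (funext hX)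
    _ = c ^ d * ι g := by
        rw [eval₂_mul_of_isHomogeneous _ _ _ hg, ← coe_eval₂Hom, hι]
    _ = (awayFraction I j g hg).val := (val_awayFraction I j g hg).symm

variable {j} in
theorem exists_X_pow_mul_mem_of_awayHom_eq_zero {d : ℕ} {g : MvPolynomial σ A}
    (hg : g.IsHomogeneous d) (h : awayHom I j g = 0) : ∃ N : ℕ, X j ^ N * g ∈ I.toIdeal := by
  rw [awayHom_of_isHomogeneous I j hg] at h
  have hval := congrArg val h
  rw [awayFraction, Away.val_mk, val_zero, Localization.mk_eq_mk',
    IsLocalization.mk'_eq_zero_iff] at hval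
  obtain ⟨⟨_, N, rfl⟩, hN⟩ := hval
  refine ⟨N, Ideal.Quotient.eq_zero_iff_mem.mp ?_⟩
  rw [map_mul, map_pow]
  exact hN

theorem awayHom_X_self : awayHom I j (X j) = 1 := by
  rw [awayHom_of_isHomogeneous I j (isHomogeneous_X A j)]
  refine val_injective _ ?_
  rw [awayFraction, Away.val_mk, val_one]
  simp_rw [pow_one]
  exact Localization.mk_self (⟨coord I j, Submonoid.mem_powers _⟩ : Submonoid.powers (coord I j))

theorem ker_awayHom : RingHom.ker (awayHom I j) = chartIdeal I.toIdeal j := by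
  refine le_antisymm (fun f hf => ?_) (sup_le (fun f hf => ?_) ?_)
  · exact mem_chartIdeal_of_map_eq_zero (awayHom_X_self I j)
      (fun _ _ => exists_X_pow_mul_mem_of_awayHom_eq_zero I) hf
  · rw [RingHom.mem_ker, ← sum_homogeneousComponent f, map_sum]
    refine Finset.sum_eq_zero fun d _ => ?_
    have hmem : homogeneousComponent d f ∈ I.toIdeal := by
      rw [← coe_decompose_homogeneousSubmodule]
      exact I.isHomogeneous d hf
    rw [awayHom_of_isHomogeneous I j (homogeneousComponent_isHomogeneous d f)]
    refine val_injective _ ?_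
    rw [val_awayFraction, Ideal.Quotient.eq_zero_iff_mem.mpr hmem, map_zero, mul_zero, val_zero]
  · rw [Ideal.span_singleton_le_iff_mem, RingHom.mem_ker, map_sub, awayHom_X_self, map_one,
      sub_self]

variable {j} in
theorem mem_chartIdeal_iff {d : ℕ} {g : MvPolynomial σ A} (hg : g.IsHomogeneous d) :
    g ∈ chartIdeal I.toIdeal j ↔ ∃ N : ℕ, X j ^ N * g ∈ I.toIdeal := by
  refine ⟨fun h => ?_, fun ⟨_, hN⟩ => mem_chartIdeal_of_X_pow_mul_mem hN⟩
  rw [← ker_awayHom] at h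
  exact exists_X_pow_mul_mem_of_awayHom_eq_zero I hg h

theorem awayHom_surjective : Function.Surjective (awayHom I j) := by
  intro x
  obtain ⟨n, _, ⟨g, hg, rfl⟩, rfl⟩ := Away.mk_surjective (quotGrading I) (coord_mem I j) x
  rw [smul_eq_mul, mul_one] at hg
  exact ⟨g, awayHom_of_isHomogeneous I j hg⟩

/-- The two descriptions of a standard chart of `Proj`: as the hyperplane section `X j = 1` of the
affine cone, and as the degree-zero part of the localization away from `X j`. -/
noncomputable def chartRingEquivAway :
    ChartRing I.toIdeal j ≃+* Away (quotGrading I) (coord I j) :=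
  (Ideal.quotEquivOfEq (ker_awayHom I j).symm).trans
    (RingHom.quotientKerEquivOfSurjective (awayHom_surjective I j))

theorem chartRingEquivAway_comp_algebraMap :
    (chartRingEquivAway I j : ChartRing I.toIdeal j →+* _).comp (algebraMap A _) =
      awayConst I j :=
  RingHom.ext fun a => awayHom_C I j a

theorem mem_chartIdeal_of_C_mul_mem {a : A}
    (h : ∀ᶠ d in Filter.atTop, ∀ f : MvPolynomial σ A, f.IsHomogeneous d →
      C a * f ∈ I.toIdeal → f ∈ I.toIdeal)
    {f : MvPolynomial σ A} (hf : C a * f ∈ chartIdeal I.toIdeal j) :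
    f ∈ chartIdeal I.toIdeal j := by
  obtain ⟨d₀, hd₀⟩ := Filter.eventually_atTop.mp h
  obtain ⟨d, g, hg, hfg⟩ := exists_homogenization j f
  have hfg' : f - g ∈ chartIdeal I.toIdeal j := Ideal.mem_sup_right hfg
  have hag : C a * g ∈ chartIdeal I.toIdeal j := by
    rw [← sub_sub_cancel (C a * f) (C a * g), ← mul_sub]
    exact sub_mem hf (Ideal.mul_mem_left _ _ hfg')
  obtain ⟨N, hN⟩ := (mem_chartIdeal_iff I (hg.C_mul a)).mp hag
  have hmem : X j ^ (d₀ + N) * g ∈ I.toIdeal := by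
    refine hd₀ (d₀ + N + d) (by omega) _ ((isHomogeneous_X_pow j _).mul hg) ?_
    rw [mul_left_comm, pow_add, mul_assoc]
    exact Ideal.mul_mem_left _ _ hN
  rw [← sub_add_cancel f g]
  exact add_mem hfg' (mem_chartIdeal_of_X_pow_mul_mem hmem)

theorem isTorsionFree_chartRing [IsDomain A]
    (h : ∀ᶠ d in Filter.atTop, ∀ f : MvPolynomial σ A, f.IsHomogeneous d →
      ∀ a : A, a ≠ 0 → C a * f ∈ I.toIdeal → f ∈ I.toIdeal) :
    Module.IsTorsionFree A (ChartRing I.toIdeal j) := by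
  refine .of_smul_eq_zero fun a x hax => or_iff_not_imp_left.mpr fun ha => ?_
  obtain ⟨f, rfl⟩ := Ideal.Quotient.mk_surjective x
  refine Ideal.Quotient.eq_zero_iff_mem.mpr
    (mem_chartIdeal_of_C_mul_mem I j (h.mono fun d hd f hf => hd f hf a ha) ?_)
  rw [← Ideal.Quotient.eq_zero_iff_mem, C_mul']
  exact hax

end ProjectiveModel

/-! ### Dimension and transcendence degree -/

namespace FunctionField1

open MvPolynomial IntermediateField

theorem ringKrullDim_le_of_isIntegral (P R : Type*) [CommRing P] [CommRing R] [Algebra P R]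
    [Algebra.IsIntegral P R] [FaithfulSMul P R] : ringKrullDim P ≤ ringKrullDim R := by
  refine iSup_le fun l => ?_
  have hbot : (⊥ : Ideal R).comap (algebraMap P R) ≤ l.head.asIdeal := by
    rw [← RingHom.ker_eq_comap_bot,
      (RingHom.injective_iff_ker_eq_bot _).mp (FaithfulSMul.algebraMap_injective P R)]
    exact bot_le
  obtain ⟨q, -, hq, hql⟩ := Ideal.exists_ideal_over_prime_of_isIntegral l.head.asIdeal ⊥ hbot
  have : q.LiesOver l.head.asIdeal := ⟨hql.symm⟩
  obtain ⟨L, hL, -⟩ := Ideal.exists_ltSeries_of_hasGoingUp l q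
  exact hL ▸ Order.LTSeries.length_le_krullDim L

variable {k R F : Type*} [Field k] [CommRing R] [IsDomain R] [Field F] [Algebra k R] [Algebra k F]
  [Algebra R F] [IsScalarTower k R F] [IsFractionRing R F]

theorem trdeg_le_of_ringKrullDim_le [Algebra.FiniteType k R] {n : ℕ} (hR : ringKrullDim R ≤ n) :
    Algebra.trdeg k F ≤ n := by
  obtain ⟨s, g, hg, hint⟩ := exists_integral_inj_algHom_of_fg k R
  let P := MvPolynomial (Fin s) k
  let : Algebra P R := g.toRingHom.toAlgebra
  have : IsScalarTower k P R := .of_algHom g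
  have : Algebra.IsIntegral P R := ⟨hint⟩
  have : FaithfulSMul P R := (faithfulSMul_iff_algebraMap_injective _ _).mpr hg
  have hs : s ≤ n := by
    have hP := (ringKrullDim_le_of_isIntegral P R).trans hR
    rw [MvPolynomial.ringKrullDim_of_isNoetherianRing, ringKrullDim_eq_zero_of_field, zero_add,
      Nat.card_fin] at hP
    exact_mod_cast hP
  have : Algebra.IsAlgebraic R F := IsLocalization.isAlgebraic F (nonZeroDivisors R)
  have hPR := lift_trdeg_add_eq k P R
  have hRF := lift_trdeg_add_eq k R F
  rw [trdeg_eq_zero (R := P) (A := R), MvPolynomial.trdeg_of_isDomain] at hPR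
  rw [trdeg_eq_zero (R := R) (A := F)] at hRF
  simp only [Cardinal.mk_fin, Cardinal.lift_natCast, Cardinal.lift_zero, add_zero,
    Cardinal.nat_eq_lift_iff] at hPR
  rw [← hPR, Cardinal.lift_natCast, Cardinal.lift_zero, add_zero, Cardinal.nat_eq_lift_iff] at hRF
  rw [← hRF]
  exact_mod_cast hs

theorem isFunctionField_of_ringKrullDim_le_one [Algebra.FiniteType k R] (hR : ringKrullDim R ≤ 1)
    (hF : ¬ Algebra.IsAlgebraic k F) : IsFunctionField k F where
  exists_transcendental := by
    rw [Algebra.isAlgebraic_def] at hF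
    push Not at hF
    exact hF
  finite_adjoin x hx := by
    have htrdeg : Algebra.trdeg k F ≤ 1 := by
      exact_mod_cast trdeg_le_of_ringKrullDim_le (k := k) (F := F) (n := 1) (by exact_mod_cast hR)
    have hbasis : IsTranscendenceBasis k fun _ : Unit => x :=
      (algebraicIndependent_unique_type_iff.mpr hx).isTranscendenceBasis_of_lift_trdeg_le_of_finite
        (by simpa using htrdeg)
    have := hbasis.isAlgebraic_field
    rw [Set.range_const] at this
    have : Algebra.EssFiniteType R F := .of_isLocalization F (nonZeroDivisors R)
    have : Algebra.EssFiniteType k F := .comp k R F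
    have : Algebra.EssFiniteType k⟮x⟯ F := .of_comp k _ F
    exact Algebra.finite_of_essFiniteType_of_isAlgebraic

end FunctionField1

/-! ### Function fields of curves -/

namespace AlgebraicCurve

theorem isIntegrallyClosed_of_isRegularLocalRing {R : Type*} [CommRing R] [IsDomain R]
    [IsRegularLocalRing R] (hR : ringKrullDim R ≤ 1) : IsIntegrallyClosed R := by
  rw [← (IsRegularLocalRing.iff_finrank_cotangentSpace R).mp inferInstance] at hR
  have hR' := ((tfae_of_isNoetherianRing_of_isLocalRing_of_isDomain R).out 5 3).mp
    (by exact_mod_cast hR)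
  exact hR'.1

universe u

section Dimension

variable (X : Scheme.{u})

theorem krullDim_eq_topologicalKrullDim : Order.krullDim X = topologicalKrullDim X :=
  Order.krullDim_eq_of_orderIso (irreducibleSetEquivPoints (α := X)).symm

theorem ringKrullDim_stalk_le (x : X) :
    ringKrullDim (X.presheaf.stalk x) ≤ topologicalKrullDim X := by
  rw [ringKrullDim_stalk_eq_coheight, ← krullDim_eq_topologicalKrullDim]
  exact Order.coheight_le_krullDim x

variable {X}

theorem topologicalKrullDim_le_zero (h : ∀ x : X, IsField (X.presheaf.stalk x)) :
    topologicalKrullDim X ≤ 0 := by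
  rw [← krullDim_eq_topologicalKrullDim, Order.krullDim_eq_iSup_coheight]
  refine iSup_le fun x => ?_
  rw [← ringKrullDim_stalk_eq_coheight]
  exact (ringKrullDim_eq_zero_of_isField (h x)).le

theorem ringKrullDim_section_le {U : X.Opens} (hU : IsAffineOpen U) :
    ringKrullDim Γ(X, U) ≤ topologicalKrullDim X := by
  rw [← PrimeSpectrum.topologicalKrullDim_eq_ringKrullDim]
  exact hU.fromSpec.isOpenEmbedding.isInducing.topologicalKrullDim_le

theorem isIntegrallyClosed_section [IsIntegral X] {U : X.Opens} [Nonempty U]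
    (hU : IsAffineOpen U) (h : ∀ x : X, IsIntegrallyClosed (X.presheaf.stalk x)) :
    IsIntegrallyClosed Γ(X, U) := by
  refine IsIntegrallyClosed.of_localization_maximal fun P _ hP => ?_
  let x := hU.fromSpec ⟨P, hP.isPrime⟩
  have hx : x ∈ U := (hU.isoSpec.inv ⟨P, hP.isPrime⟩).2
  let : Algebra Γ(X, U) (X.presheaf.stalk x) :=
    TopCat.Presheaf.algebra_section_stalk X.presheaf ⟨x, hx⟩
  have : IsLocalization.AtPrime (X.presheaf.stalk x) P :=
    hU.isLocalization_stalk' ⟨P, hP.isPrime⟩ hx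
  have := h x
  exact .of_equiv (IsLocalization.algEquiv P.primeCompl (X.presheaf.stalk x)
    (Localization.AtPrime P)).toRingEquiv

end Dimension

section Constants

variable {A : Type u} [CommRing A] {X : Scheme.{u}} (f : X ⟶ Spec (.of A))

/-- The ring homomorphism from `A` to the sections over `U` of an `A`-scheme. -/
noncomputable def sectionConstants (U : X.Opens) : A →+* Γ(X, U) :=
  ((Scheme.ΓSpecIso (.of A)).inv ≫ f.appLE ⊤ U le_top).hom

/-- The ring homomorphism from `A` to the local ring at `x` of an `A`-scheme. At the generic point
this is `constantsHom`. -/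
noncomputable def stalkConstants (x : X) : A →+* X.presheaf.stalk x :=
  ((Scheme.ΓSpecIso (.of A)).inv ≫ f.appTop ≫ X.presheaf.germ ⊤ x trivial).hom

theorem germ_comp_sectionConstants {U : X.Opens} {x : X} (hx : x ∈ U) :
    (X.presheaf.germ U x hx).hom.comp (sectionConstants f U) = stalkConstants f x :=
  congrArg (fun g => ((Scheme.ΓSpecIso (.of A)).inv ≫ f.appTop ≫ g).hom)
    (X.presheaf.germ_res (homOfLE le_top) x hx)

theorem stalkSpecializes_comp_stalkConstants {x y : X} (h : x ⤳ y) :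
    (X.presheaf.stalkSpecializes h).hom.comp (stalkConstants f y) = stalkConstants f x :=
  congrArg (fun g => ((Scheme.ΓSpecIso (.of A)).inv ≫ f.appTop ≫ g).hom)
    (X.presheaf.germ_stalkSpecializes (U := ⊤) trivial h)

theorem stalkMap_comp_stalkConstants {U : Scheme.{u}} (g : U ⟶ X) (x : U) :
    (g.stalkMap x).hom.comp (stalkConstants f (g x)) = stalkConstants (g ≫ f) x := by
  rw [stalkConstants, stalkConstants, Scheme.Hom.comp_appTop, Category.assoc]
  exact congrArg (fun h => ((Scheme.ΓSpecIso (.of A)).inv ≫ f.appTop ≫ h).hom)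
    (g.germ_stalkMap ⊤ x trivial)

theorem finiteType_sectionConstants [LocallyOfFiniteType f] {U : X.Opens} (hU : IsAffineOpen U) :
    (sectionConstants f U).FiniteType :=
  (f.finiteType_appLE (isAffineOpen_top _) hU le_top).comp (.of_surjective _
    (Scheme.ΓSpecIso (.of A)).symm.commRingCatIsoToRingEquiv.surjective)

end Constants

variable {k : Type} [Field k] {X : Scheme.{0}} {f : X ⟶ Spec (.of k)}

theorem isField_stalk_of_isIntegral_constantsHom [IsIntegral X] (hf : (constantsHom f).IsIntegral)
    (x : X) : IsField (X.presheaf.stalk x) := by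
  let : Algebra k X.functionField := (constantsHom f).toAlgebra
  let : Algebra k (X.presheaf.stalk x) := (stalkConstants f x).toAlgebra
  have : IsScalarTower k (X.presheaf.stalk x) X.functionField :=
    .of_algebraMap_eq' (stalkSpecializes_comp_stalkConstants f
      ((genericPoint_spec X).specializes trivial)).symm
  have : Algebra.IsIntegral k (X.presheaf.stalk x) := by
    refine ⟨fun a => ?_⟩
    rw [← isIntegral_algebraMap_iff
      (IsFractionRing.injective (X.presheaf.stalk x) X.functionField)]
    exact hf _
  exact isField_of_isIntegral_of_isField' (Field.toIsField k)

namespace IsCurve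

theorem not_isIntegral_constantsHom (hf : IsCurve f) :
    haveI := hf.isIntegral
    ¬ (constantsHom f).IsIntegral := by
  have := hf.isIntegral
  intro hint
  have hdim := topologicalKrullDim_le_zero (isField_stalk_of_isIntegral_constantsHom hint)
  rw [hf.dim_eq_one] at hdim
  exact absurd hdim (by decide)

theorem isFunctionField (hf : IsCurve f) :
    haveI := hf.isIntegral
    letI : Algebra k X.functionField := (constantsHom f).toAlgebra
    FunctionField1.IsFunctionField k X.functionField := by
  have := hf.isIntegral
  have := hf.locallyOfFiniteType
  obtain ⟨U, hU, hηU, -⟩ :=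
    exists_isAffineOpen_mem_and_subset (X := X) (x := genericPoint X) (U := ⊤) trivial
  have : Nonempty U := ⟨⟨_, hηU⟩⟩
  let : Algebra k X.functionField := (constantsHom f).toAlgebra
  let : Algebra k Γ(X, U) := (sectionConstants f U).toAlgebra
  have : IsScalarTower k Γ(X, U) X.functionField :=
    .of_algebraMap_eq' (germ_comp_sectionConstants f hηU).symm
  have : Algebra.FiniteType k Γ(X, U) := finiteType_sectionConstants f hU
  have := functionField_isFractionRing_of_isAffineOpen X U hU
  exact FunctionField1.isFunctionField_of_ringKrullDim_le_one (R := Γ(X, U))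
    ((ringKrullDim_section_le hU).trans hf.dim_eq_one.le)
    fun _ => hf.not_isIntegral_constantsHom (algebraMap_isIntegral_iff.mpr inferInstance)

end IsCurve

end AlgebraicCurve

/-! ### Generic points in homogeneous coordinates -/

namespace FunctionField1

open MvPolynomial ProjectiveModel

variable {k F σ : Type*} [Field k] [Field F] [Algebra k F] {y : σ → F}

theorem IsFormFractionField.isFractionRing_chart (hy : IsFormFractionField k y) {j : σ}
    (hj : y j ≠ 0) : IsFractionRing (chart k y j) F := by
  have hmem {m : ℕ} {c : F} (hc : c ∈ formValues k y m) : c / y j ^ m ∈ chart k y j := by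
    obtain ⟨g, hg, rfl⟩ := mem_formValues.mp hc
    rw [← aeval_div_of_isHomogeneous y j hg, chart, Algebra.adjoin_range_eq_range_aeval]
    exact ⟨g, rfl⟩
  refine .of_field _ _ fun f => ?_
  obtain ⟨m, a, ha, b, hb, hb0, hfb⟩ := hy f
  refine ⟨⟨_, hmem ha⟩, ⟨_, hmem hb⟩, ?_⟩
  change f = a / y j ^ m / (b / y j ^ m)
  rw [div_div_div_cancel_right₀ (pow_ne_zero m hj), ← hfb, mul_div_cancel_right₀ _ hb0]

theorem isFormFractionField_of_forall_mul_aeval_eq {i : σ} (hi : y i = 1)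
    (h : ∀ f : F, ∃ p q : MvPolynomial σ k, aeval y q ≠ 0 ∧ f * aeval y q = aeval y p) :
    IsFormFractionField k y := by
  have hhom (p : MvPolynomial σ k) : ∃ d, aeval y p ∈ formValues k y d := by
    obtain ⟨d, p', hp', hpp'⟩ := exists_homogenization i p
    refine ⟨d, mem_formValues.mpr ⟨p', hp', ?_⟩⟩
    obtain ⟨c, hc⟩ := Ideal.mem_span_singleton.mp hpp'
    rw [eq_comm, ← sub_eq_zero, ← map_sub, hc, map_mul, map_sub, aeval_X, hi, map_one, sub_self,
      zero_mul]
  have hone (d : ℕ) : (1 : F) ∈ formValues k y d :=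
    mem_formValues.mpr ⟨X i ^ d, isHomogeneous_X_pow i d, by rw [map_pow, aeval_X, hi, one_pow]⟩
  intro f
  obtain ⟨p, q, hq, hpq⟩ := h f
  obtain ⟨d, hd⟩ := hhom p
  obtain ⟨e, he⟩ := hhom q
  refine ⟨d + e, aeval y p, ?_, aeval y q, ?_, hq, hpq⟩
  · rw [← mul_one (aeval y p)]
    exact mul_mem_formValues hd (hone e)
  · rw [← one_mul (aeval y q)]
    exact mul_mem_formValues (hone d) he

namespace IsGenericPoint

variable {I : Ideal (MvPolynomial σ k)}

theorem chartsIntegrallyClosed (h : IsGenericPoint I y)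
    (hI : I.IsHomogeneous (homogeneousSubmodule σ k))
    (hc : ∀ j, chartIdeal I j ≠ ⊤ → IsIntegrallyClosed (ChartRing I j)) :
    ChartsIntegrallyClosed k y := by
  intro j hj f hf
  have := h.isFormFractionField.isFractionRing_chart hj
  have : Nontrivial (ChartRing I j) := (h.chartEquiv hI hj).toEquiv.nontrivial
  have := hc j (Ideal.Quotient.nontrivial_iff.mp this)
  have : IsIntegrallyClosed (chart k y j) := .of_equiv (h.chartEquiv hI hj).toRingEquiv
  obtain ⟨z, rfl⟩ := IsIntegrallyClosed.isIntegral_iff.mp hf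
  exact z.2

theorem smooth_chartRing [IsFunctionField k F] [PerfectField k] [Finite σ]
    (h : IsGenericPoint I y) (hI : I.IsHomogeneous (homogeneousSubmodule σ k))
    (hc : ChartsIntegrallyClosed k y) (j : σ) : Algebra.Smooth k (ChartRing I j) := by
  by_cases hj : y j = 0
  · have : Subsingleton (ChartRing I j) :=
      Ideal.Quotient.subsingleton_iff.mpr (h.chartIdeal_eq_top hj)
    infer_instance
  · have := hc.smooth hj
    exact .of_equiv (h.chartEquiv hI hj).symm

end IsGenericPoint

variable {I : HomogeneousIdeal (homogeneousSubmodule σ k)}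

theorem isGenericPoint_of_ker_aeval_div {i : σ} (hi : y i = 1) (hI : chartIdeal I.toIdeal i ≠ ⊤)
    (hy : IsFormFractionField k y)
    (h : ∀ j, chartIdeal I.toIdeal j ≠ ⊤ → y j ≠ 0 ∧
      RingHom.ker (aeval (R := k) fun l => y l / y j) = chartIdeal I.toIdeal j) :
    IsGenericPoint I.toIdeal y := by
  have haeval {j : σ} (hj : chartIdeal I.toIdeal j ≠ ⊤) {d : ℕ} {g : MvPolynomial σ k}
      (hg : g.IsHomogeneous d) : aeval y g = 0 ↔ g ∈ chartIdeal I.toIdeal j := by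
    obtain ⟨hj0, hker⟩ := h j hj
    rw [← hker, RingHom.mem_ker, aeval_div_of_isHomogeneous y j hg, div_eq_zero_iff,
      or_iff_left (pow_ne_zero d hj0)]
  refine ⟨⟨i, hi⟩, hy, fun d g hg => ⟨fun hg0 j => ?_, fun hsat => ?_⟩⟩
  · rw [← mem_chartIdeal_iff I hg]
    by_cases hj : chartIdeal I.toIdeal j = ⊤
    · exact hj ▸ Submodule.mem_top
    · exact (haeval hj hg).mp hg0
  · exact (haeval hI hg).mpr ((mem_chartIdeal_iff I hg).mpr (hsat i))

end FunctionField1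

/-! ### The projective scheme of a homogeneous ideal -/

namespace ProjectiveModel

open MvPolynomial HomogeneousLocalization AlgebraicCurve FunctionField1

universe u

section

variable {A σ : Type u} [CommRing A] (I : HomogeneousIdeal (homogeneousSubmodule σ A)) (j : σ)

/-- The structure morphism of the projective scheme cut out by `I`. -/
noncomputable def structMor : Proj (quotGrading I) ⟶ Spec (.of A) :=
  Proj.toSpecZero (quotGrading I) ≫
    Spec.map (CommRingCat.ofHom (algebraMap A (quotGrading I 0)))

/-- The open subscheme `X j ≠ 0` of the projective scheme cut out by `I`. -/
noncomputable abbrev chartOpen : (Proj (quotGrading I)).Opens :=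
  Proj.basicOpen (quotGrading I) (coord I j)

theorem isAffineOpen_chartOpen : IsAffineOpen (chartOpen I j) :=
  Proj.isAffineOpen_basicOpen _ _ (coord_mem I j) one_pos

theorem iSup_chartOpen : ⨆ j, chartOpen I j = ⊤ := by
  refine Proj.iSup_basicOpen_eq_top' _ _ (fun j => ⟨1, coord_mem I j⟩) (eq_top_iff.mpr ?_)
  rintro x -
  obtain ⟨g, rfl⟩ := Ideal.Quotient.mk_surjective x
  induction g using MvPolynomial.induction_on with
  | C a =>
    exact (Algebra.adjoin _ _).algebraMap_mem
      (⟨Ideal.Quotient.mk _ (C a), mk_mem_quotGrading (isHomogeneous_C σ a)⟩ : quotGrading I 0)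
  | add p q hp hq => rw [map_add]; exact add_mem hp hq
  | mul_X p i hp => rw [map_mul]; exact mul_mem hp (Algebra.subset_adjoin ⟨i, rfl⟩)

theorem chartOpen_ι_structMor : (chartOpen I j).ι ≫ structMor I =
    Proj.basicOpenToSpec (quotGrading I) (coord I j) ≫
      Spec.map (CommRingCat.ofHom (awayConst I j)) := by
  have hawayι : Proj.awayι (quotGrading I) (coord I j) (coord_mem I j) one_pos ≫ structMor I =
      Spec.map (CommRingCat.ofHom (awayConst I j)) := by
    rw [structMor, Proj.awayι_toSpecZero_assoc, ← Spec.map_comp]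
    rfl
  rw [← hawayι, ← Proj.basicOpenIsoSpec_inv_ι, Category.assoc,
    ← Proj.basicOpenIsoSpec_hom _ _ (coord_mem I j) one_pos, Iso.hom_inv_id_assoc]

theorem smooth_structMor (h : ∀ j, Algebra.Smooth A (ChartRing I.toIdeal j)) :
    Smooth (structMor I) := by
  have : IsZariskiLocalAtSource @Smooth.{u} :=
    HasRingHomProperty.instIsZariskiLocalAtSource (Q := RingHom.Smooth)
  rw [IsZariskiLocalAtSource.iff_of_iSup_eq_top (P := @Smooth.{u}) _ (iSup_chartOpen I)]
  intro j
  rw [chartOpen_ι_structMor, ← Proj.basicOpenIsoSpec_hom _ _ (coord_mem I j) one_pos]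
  refine IsZariskiLocalAtSource.comp (P := @Smooth.{u}) ?_ _
  rw [HasRingHomProperty.Spec_iff (P := @Smooth.{u}), CommRingCat.hom_ofHom,
    ← chartRingEquivAway_comp_algebraMap]
  exact RingHom.Smooth.respectsIso.1 (algebraMap A (ChartRing I.toIdeal j))
    (chartRingEquivAway I j) (RingHom.smooth_algebraMap.mpr (h j))

/-- The coordinate ring of a standard chart is its ring of sections. -/
noncomputable def chartRingEquivSection :
    ChartRing I.toIdeal j ≃+* Γ(Proj (quotGrading I), chartOpen I j) :=
  (chartRingEquivAway I j).trans (Proj.basicOpenIsoAway (quotGrading I) (coord I j)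
    (coord_mem I j) one_pos).commRingCatIsoToRingEquiv

theorem sectionConstants_structMor : sectionConstants (structMor I) (chartOpen I j) =
    (chartRingEquivSection I j : _ →+* _).comp (algebraMap A (ChartRing I.toIdeal j)) := by
  let U := chartOpen I j
  have htop : (Scheme.ΓSpecIso (.of A)).inv ≫ (U.ι ≫ structMor I).appTop =
      CommRingCat.ofHom (awayConst I j) ≫ Proj.awayToSection (quotGrading I) (coord I j) ≫
        U.topIso.inv := by
    rw [chartOpen_ι_structMor, Scheme.Hom.comp_appTop, ← Scheme.ΓSpecIso_inv_naturality_assoc]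
    congr 1
    rw [Iso.inv_comp_eq]
    exact Proj.basicOpenToSpec_app_top _ _
  have hsection : (Scheme.ΓSpecIso (.of A)).inv ≫ (structMor I).appLE ⊤ U le_top =
      CommRingCat.ofHom (awayConst I j) ≫ Proj.awayToSection (quotGrading I) (coord I j) := by
    rw [← cancel_mono U.topIso.inv, Category.assoc, Category.assoc, ← htop,
      Scheme.Hom.comp_appTop]
    congr 1
  rw [sectionConstants, hsection, ← chartRingEquivAway_comp_algebraMap]
  rfl

variable {I j} {x : Proj (quotGrading I)}

/-- The germ at `x` of a regular function on a standard chart. -/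
noncomputable def chartGerm (hx : x ∈ chartOpen I j) :
    ChartRing I.toIdeal j →+* (Proj (quotGrading I)).presheaf.stalk x :=
  ((Proj (quotGrading I)).presheaf.germ _ x hx).hom.comp (chartRingEquivSection I j)

theorem chartGerm_comp_algebraMap (hx : x ∈ chartOpen I j) :
    (chartGerm hx).comp (algebraMap A _) = stalkConstants (structMor I) x := by
  rw [← germ_comp_sectionConstants _ hx, sectionConstants_structMor, chartGerm, RingHom.comp_assoc]

theorem chartGerm_mk (hx : x ∈ chartOpen I j) (g : MvPolynomial σ A) :
    chartGerm hx (Ideal.Quotient.mk _ g) = (Proj.stalkIso (quotGrading I) x).inv.hom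
      (HomogeneousLocalization.mapId _ (Submonoid.powers_le.mpr hx) (awayHom I j g)) :=
  congrArg (fun f => f.hom (awayHom I j g))
    (ProjectiveSpectrum.Proj.awayToSection_germ (quotGrading I) (coord I j) x hx)

theorem chartGerm_mk_X {i : σ} (hi : x ∈ chartOpen I i) (hj : x ∈ chartOpen I j) (l : σ) :
    chartGerm hi (Ideal.Quotient.mk _ (X l)) =
      chartGerm hj (Ideal.Quotient.mk _ (X l)) * chartGerm hi (Ideal.Quotient.mk _ (X j)) := by
  rw [chartGerm_mk, chartGerm_mk, chartGerm_mk, ← map_mul]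
  congr 1
  rw [awayHom_of_isHomogeneous I i (isHomogeneous_X A l),
    awayHom_of_isHomogeneous I i (isHomogeneous_X A j),
    awayHom_of_isHomogeneous I j (isHomogeneous_X A l)]
  refine val_injective _ ?_
  rw [val_mul]
  change Localization.mk _ _ = Localization.mk _ _ * Localization.mk _ _
  rw [Localization.mk_mul, Localization.mk_eq_mk_iff]
  refine Localization.r_of_eq ?_
  change (coord I j ^ 1 * coord I i ^ 1) * coord I l = coord I i ^ 1 * (coord I l * coord I j)
  ring

theorem chartIdeal_eq_top_of_chartOpen_eq_bot (h : chartOpen I j = ⊥) :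
    chartIdeal I.toIdeal j = ⊤ := by
  have : Subsingleton Γ(Proj (quotGrading I), chartOpen I j) := by
    rw [h]
    infer_instance
  exact Ideal.Quotient.subsingleton_iff.mp (chartRingEquivSection I j).toEquiv.subsingleton

theorem isIntegrallyClosed_chartRing [IsIntegral (Proj (quotGrading I))]
    (h : ∀ x : Proj (quotGrading I), IsIntegrallyClosed ((Proj (quotGrading I)).presheaf.stalk x))
    (hj : chartIdeal I.toIdeal j ≠ ⊤) : IsIntegrallyClosed (ChartRing I.toIdeal j) := by
  have : Nonempty (chartOpen I j) := Set.Nonempty.to_subtype <|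
    (TopologicalSpace.Opens.ne_bot_iff_nonempty _).mp fun hbot =>
      hj (chartIdeal_eq_top_of_chartOpen_eq_bot hbot)
  have := isIntegrallyClosed_section (isAffineOpen_chartOpen I j) h
  exact .of_equiv (chartRingEquivSection I j).symm

theorem genericPoint_mem_chartOpen [IsIntegral (Proj (quotGrading I))]
    (hj : chartIdeal I.toIdeal j ≠ ⊤) : genericPoint (Proj (quotGrading I)) ∈ chartOpen I j := by
  refine ((genericPoint_spec _).mem_open_set_iff (chartOpen I j).isOpen).mpr ?_
  rw [Set.univ_inter]
  exact (TopologicalSpace.Opens.ne_bot_iff_nonempty _).mp fun hbot =>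
    hj (chartIdeal_eq_top_of_chartOpen_eq_bot hbot)

theorem chartGerm_injective [IsIntegral (Proj (quotGrading I))] (hx : x ∈ chartOpen I j) :
    Function.Injective (chartGerm hx) :=
  (germ_injective_of_isIntegral _ x hx).comp (chartRingEquivSection I j).injective

theorem exists_mul_chartGerm_eq [IsIntegral (Proj (quotGrading I))]
    (hη : genericPoint (Proj (quotGrading I)) ∈ chartOpen I j)
    (f : (Proj (quotGrading I)).functionField) :
    ∃ a b, chartGerm hη b ≠ 0 ∧ f * chartGerm hη b = chartGerm hη a := by
  have : Nonempty (chartOpen I j) := ⟨⟨_, hη⟩⟩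
  have := functionField_isFractionRing_of_isAffineOpen _ _ (isAffineOpen_chartOpen I j)
  have hgerm (s : Γ(Proj (quotGrading I), chartOpen I j)) :
      chartGerm hη ((chartRingEquivSection I j).symm s) =
        algebraMap _ (Proj (quotGrading I)).functionField s :=
    congrArg ((Proj (quotGrading I)).presheaf.germ _ _ hη).hom
      ((chartRingEquivSection I j).apply_symm_apply s)
  obtain ⟨a, b, hb, rfl⟩ :=
    IsFractionRing.div_surjective (A := Γ(Proj (quotGrading I), chartOpen I j)) f
  have hb0 := IsFractionRing.to_map_ne_zero_of_mem_nonZeroDivisors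
    (K := (Proj (quotGrading I)).functionField) hb
  refine ⟨(chartRingEquivSection I j).symm a, (chartRingEquivSection I j).symm b, ?_, ?_⟩
  · rwa [hgerm]
  · rw [hgerm, hgerm, div_mul_cancel₀ _ hb0]

end

section GenericPoint

variable {k σ F : Type} [Field k] [Field F] [Algebra k F]
  {I : HomogeneousIdeal (homogeneousSubmodule σ k)} [IsIntegral (Proj (quotGrading I))]
  (e : (Proj (quotGrading I)).functionField ≃+* F)
  (he : ∀ c, e (constantsHom (structMor I) c) = algebraMap k F c)

/-- The embedding of the coordinate ring of a standard chart of an integral projective scheme into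
a field `F` that is identified with the function field by `e`. -/
noncomputable def chartToField {j : σ}
    (hj : genericPoint (Proj (quotGrading I)) ∈ chartOpen I j) :
    ChartRing I.toIdeal j →ₐ[k] F :=
  { (e : _ →+* F).comp (chartGerm hj) with
    commutes' c := (congrArg e (DFunLike.congr_fun (chartGerm_comp_algebraMap hj) c)).trans (he c) }

variable {i j : σ} (hj : genericPoint (Proj (quotGrading I)) ∈ chartOpen I j)

theorem aeval_chartToField_mk_X (g : MvPolynomial σ k) :
    aeval (fun l => chartToField e he hj (Ideal.Quotient.mk _ (X l))) g =
      chartToField e he hj (Ideal.Quotient.mk _ g) :=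
  congrArg (fun φ : MvPolynomial σ k →ₐ[k] F => φ g)
    (aeval_unique ((chartToField e he hj).comp (Ideal.Quotient.mkₐ k _))).symm

theorem chartToField_injective : Function.Injective (chartToField e he hj) :=
  e.injective.comp (chartGerm_injective hj)

theorem chartToField_mk_X_self : chartToField e he hj (Ideal.Quotient.mk _ (X j)) = 1 := by
  have : Ideal.Quotient.mk (chartIdeal I.toIdeal j) (X j) = Ideal.Quotient.mk _ 1 :=
    Ideal.Quotient.eq.mpr (Ideal.mem_sup_right (Ideal.subset_span rfl))
  rw [this, map_one, map_one]

theorem chartToField_mk_X (hi : genericPoint (Proj (quotGrading I)) ∈ chartOpen I i)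
    (hj : genericPoint (Proj (quotGrading I)) ∈ chartOpen I j) (l : σ) :
    chartToField e he hi (Ideal.Quotient.mk _ (X l)) =
      chartToField e he hj (Ideal.Quotient.mk _ (X l)) *
        chartToField e he hi (Ideal.Quotient.mk _ (X j)) :=
  (congrArg e (chartGerm_mk_X hi hj l)).trans (map_mul e _ _)

theorem chartToField_mk_X_ne_zero
    (hi : genericPoint (Proj (quotGrading I)) ∈ chartOpen I i)
    (hj : genericPoint (Proj (quotGrading I)) ∈ chartOpen I j) :
    chartToField e he hi (Ideal.Quotient.mk _ (X j)) ≠ 0 := by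
  have h := chartToField_mk_X e he hi hj i
  rw [chartToField_mk_X_self] at h
  exact right_ne_zero_of_mul (h ▸ one_ne_zero)

theorem ker_aeval_chartToField_div
    (hi : genericPoint (Proj (quotGrading I)) ∈ chartOpen I i)
    (hj : genericPoint (Proj (quotGrading I)) ∈ chartOpen I j) :
    RingHom.ker (aeval (R := k) fun l => chartToField e he hi (Ideal.Quotient.mk _ (X l)) /
      chartToField e he hi (Ideal.Quotient.mk _ (X j))) = chartIdeal I.toIdeal j := by
  ext g
  have hdiv (l : σ) : chartToField e he hi (Ideal.Quotient.mk _ (X l)) /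
      chartToField e he hi (Ideal.Quotient.mk _ (X j)) =
      chartToField e he hj (Ideal.Quotient.mk _ (X l)) := by
    rw [chartToField_mk_X e he hi hj l,
      mul_div_cancel_right₀ _ (chartToField_mk_X_ne_zero e he hi hj)]
  simp_rw [hdiv]
  rw [RingHom.mem_ker, aeval_chartToField_mk_X, ← Ideal.Quotient.eq_zero_iff_mem]
  exact map_eq_zero_iff _ (chartToField_injective e he hj)

theorem isFormFractionField_chartToField :
    IsFormFractionField k fun l => chartToField e he hj (Ideal.Quotient.mk _ (X l)) := by
  refine isFormFractionField_of_forall_mul_aeval_eq (chartToField_mk_X_self e he hj) fun f => ?_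
  obtain ⟨a, b, hb, hab⟩ := exists_mul_chartGerm_eq hj (e.symm f)
  obtain ⟨p, rfl⟩ := Ideal.Quotient.mk_surjective a
  obtain ⟨q, rfl⟩ := Ideal.Quotient.mk_surjective b
  refine ⟨p, q, ?_, ?_⟩
  · rw [aeval_chartToField_mk_X]
    exact e.map_ne_zero_iff.mpr hb
  · rw [aeval_chartToField_mk_X, aeval_chartToField_mk_X, ← e.apply_symm_apply f]
    exact (map_mul e _ _).symm.trans (congrArg e hab)

theorem exists_isGenericPoint (e : (Proj (quotGrading I)).functionField ≃+* F)
    (he : ∀ c, e (constantsHom (structMor I) c) = algebraMap k F c) :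
    ∃ y : σ → F, FunctionField1.IsGenericPoint I.toIdeal y := by
  have hη : genericPoint (Proj (quotGrading I)) ∈ ⨆ j, chartOpen I j :=
    iSup_chartOpen I ▸ TopologicalSpace.Opens.mem_top _
  obtain ⟨i, hi⟩ := TopologicalSpace.Opens.mem_iSup.mp hη
  have hI : chartIdeal I.toIdeal i ≠ ⊤ :=
    Ideal.Quotient.nontrivial_iff.mp (chartToField e he hi).toRingHom.domain_nontrivial
  exact ⟨_, isGenericPoint_of_ker_aeval_div (chartToField_mk_X_self e he hi) hI
    (isFormFractionField_chartToField e he hi) fun j hj =>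
      have hj := genericPoint_mem_chartOpen hj
      ⟨chartToField_mk_X_ne_zero e he hi hj, ker_aeval_chartToField_div e he hi hj⟩⟩

end GenericPoint

end ProjectiveModel

/-! ### Function fields of birational schemes -/

namespace AlgebraicCurve

variable {k : Type} [Field k] {X Y : Scheme.{0}}

theorem exists_functionField_equiv_of_isOpenImmersion [IrreducibleSpace X] [IrreducibleSpace Y]
    (g : Y ⟶ X) [IsOpenImmersion g] (f : X ⟶ Spec (.of k)) :
    ∃ e : X.functionField ≃+* Y.functionField,
      ∀ c, e (constantsHom f c) = constantsHom (g ≫ f) c := by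
  suffices h : ∀ x : X, g (genericPoint Y) = x → ∃ e : X.presheaf.stalk x ≃+* Y.functionField,
      ∀ c, e (stalkConstants f x c) = constantsHom (g ≫ f) c from
    h _ (genericPoint_eq_of_isOpenImmersion g)
  rintro _ rfl
  exact ⟨(asIso (g.stalkMap (genericPoint Y))).commRingCatIsoToRingEquiv,
    DFunLike.congr_fun (stalkMap_comp_stalkConstants f g (genericPoint Y))⟩

theorem exists_functionField_equiv_of_birationalOver [IsIntegral X] [IsIntegral Y]
    {sX : X ⟶ Spec (.of k)} {sY : Y ⟶ Spec (.of k)} (h : Scheme.BirationalOver sX sY) :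
    ∃ e : X.functionField ≃+* Y.functionField, ∀ c, e (constantsHom sX c) = constantsHom sY c := by
  obtain ⟨f, hf⟩ := h
  have : Nonempty f.source := f.dense_source.nonempty.to_subtype
  obtain ⟨e₁, he₁⟩ := exists_functionField_equiv_of_isOpenImmersion f.source.ι sX
  obtain ⟨e₂, he₂⟩ := exists_functionField_equiv_of_isOpenImmersion (f.iso.hom ≫ f.target.ι) sY
  have hover : (f.iso.hom ≫ f.target.ι) ≫ sY = f.source.ι ≫ sX := (Category.assoc _ _ _).trans hf
  refine ⟨e₁.trans e₂.symm, fun c => ?_⟩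
  rw [RingEquiv.trans_apply, RingEquiv.symm_apply_eq, he₁, he₂, hover]

theorem IsCurve.isIntegrallyClosed_stalk {f : X ⟶ Spec (.of k)} (hf : IsCurve f) {x : X}
    (hx : IsNonsingularAt X x) : IsIntegrallyClosed (X.presheaf.stalk x) :=
  have := hf.isIntegral
  have : IsRegularLocalRing (X.presheaf.stalk x) := hx
  isIntegrallyClosed_of_isRegularLocalRing
    ((ringKrullDim_stalk_le X x).trans hf.dim_eq_one.le)

end AlgebraicCurve

/-! ### The local ring `ℤ_(p)` -/

namespace ProjectiveModel

open MvPolynomial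

theorem toIdeal_idealOver {n : ℕ} (J : Equations n) (A : Type) [CommRing A] :
    (idealOver J A).toIdeal = J.toIdeal.map (map (Int.castRingHom A)) := rfl

theorem map_idealOver {n : ℕ} (J : Equations n) (A B : Type) [CommRing A] [CommRing B]
    [Algebra A B] :
    (idealOver J A).toIdeal.map (map (algebraMap A B)) = (idealOver J B).toIdeal := by
  rw [toIdeal_idealOver, toIdeal_idealOver, Ideal.map_map]
  congr 1
  ext <;> simp

variable (p : ℕ) [Fact p.Prime]

instance isDiscreteValuationRing_zAt : IsDiscreteValuationRing (ZAt p) := by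
  have := isPrime_span p
  exact IsLocalization.AtPrime.isDiscreteValuationRing_of_dedekind_domain ℤ
    (P := Ideal.span {(p : ℤ)})
    (by simpa using (Fact.out : p.Prime).ne_zero) (ZAt p)

theorem irreducible_natCast_zAt : Irreducible (p : ZAt p) := by
  have := isPrime_span p
  rw [IsDiscreteValuationRing.irreducible_iff_uniformizer,
    ← Localization.AtPrime.map_eq_maximalIdeal, Ideal.map_span]
  simp

/-- The embedding of `ℤ_(p)` into its fraction field `ℚ`. -/
noncomputable instance algebraZAtRat : Algebra (ZAt p) ℚ :=
  haveI := isPrime_span p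
  (IsLocalization.lift (M := (Ideal.span {(p : ℤ)}).primeCompl) (g := Int.castRingHom ℚ)
    fun y => ((Int.cast_ne_zero (n := y)).mpr fun h => y.2 (h ▸ zero_mem _)).isUnit).toAlgebra

/-- The reduction map from `ℤ_(p)` to its residue field `𝔽_p`. -/
noncomputable instance algebraZAtZMod : Algebra (ZAt p) (ZMod p) :=
  haveI := isPrime_span p
  (IsLocalization.lift (M := (Ideal.span {(p : ℤ)}).primeCompl) (g := Int.castRingHom (ZMod p))
    fun y => IsUnit.mk0 _ fun h => y.2 <| Ideal.mem_span_singleton.mpr <|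
      (ZMod.intCast_zmod_eq_zero_iff_dvd _ _).mp h).toAlgebra

instance isFractionRing_zAt_rat : IsFractionRing (ZAt p) ℚ := by
  have := isPrime_span p
  have := IsScalarTower.of_algebraMap_eq' (R := ℤ) (S := ZAt p) (A := ℚ) (RingHom.ext_int _ _)
  exact IsFractionRing.isFractionRing_of_isDomain_of_isLocalization
    (Ideal.span {(p : ℤ)}).primeCompl (ZAt p) ℚ

theorem algebraMap_zAt_zmod_surjective : Function.Surjective (algebraMap (ZAt p) (ZMod p)) := by
  intro x
  obtain ⟨m, rfl⟩ := ZMod.intCast_surjective x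
  exact ⟨m, map_intCast _ m⟩

theorem algebraMap_zAt_zmod_eq_zero_iff (a : ZAt p) :
    algebraMap (ZAt p) (ZMod p) a = 0 ↔ (p : ZAt p) ∣ a := by
  have hmax := RingHom.ker_isMaximal_of_surjective _ (algebraMap_zAt_zmod_surjective p)
  rw [← RingHom.mem_ker, IsLocalRing.eq_maximalIdeal hmax,
    (IsDiscreteValuationRing.irreducible_iff_uniformizer _).mp (irreducible_natCast_zAt p),
    Ideal.mem_span_singleton]

end ProjectiveModel

/-! ### Good reduction over a discrete valuation ring -/

namespace FunctionField1

open MvPolynomial ProjectiveModel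

theorem smooth_chartRing_of_genus_eq {A K κ F₁ F₂ σ : Type*} [CommRing A] [IsDomain A]
    [IsDiscreteValuationRing A] [Field K] [PerfectField K] [Algebra A K] [IsFractionRing A K]
    [Field κ] [PerfectField κ] [Algebra A κ] [Field F₁] [Algebra K F₁] [IsFunctionField K F₁]
    [Field F₂] [Algebra κ F₂] [IsFunctionField κ F₂] [Finite σ]
    {I : HomogeneousIdeal (homogeneousSubmodule σ A)}
    {I₁ : HomogeneousIdeal (homogeneousSubmodule σ K)}
    {I₂ : HomogeneousIdeal (homogeneousSubmodule σ κ)}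
    {y₁ : σ → F₁} {y₂ : σ → F₂} {π : A}
    (h₁ : IsGenericPoint I₁.toIdeal y₁) (h₂ : IsGenericPoint I₂.toIdeal y₂)
    (hI₁ : I.toIdeal.map (map (algebraMap A K)) = I₁.toIdeal)
    (hI₂ : I.toIdeal.map (map (algebraMap A κ)) = I₂.toIdeal) (hπ : Irreducible π)
    (hsurj : Function.Surjective (algebraMap A κ)) (hker : ∀ a : A, algebraMap A κ a = 0 ↔ π ∣ a)
    (hc₁ : ChartsIntegrallyClosed K y₁) (hgenus : genus κ F₂ = genus K F₁) (j : σ) :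
    Algebra.Smooth A (ChartRing I.toIdeal j) ∧ Algebra.Smooth κ (ChartRing I₂.toIdeal j) := by
  let : Algebra A F₁ := ((algebraMap K F₁).comp (algebraMap A K)).toAlgebra
  let : Algebra A F₂ := ((algebraMap κ F₂).comp (algebraMap A κ)).toAlgebra
  have : IsScalarTower A K F₁ := .of_algebraMap_eq fun _ => rfl
  have : IsScalarTower A κ F₂ := .of_algebraMap_eq fun _ => rfl
  have hI₁' := I₁.isHomogeneous
  have hI₂' := I₂.isHomogeneous
  rw [← hI₁] at h₁ hI₁'
  rw [← hI₂] at h₂ hI₂' ⊢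
  have hc₂ : ChartsIntegrallyClosed κ y₂ :=
    chartsIntegrallyClosed_of_genus_eq h₁ h₂ hsurj hker I.isHomogeneous hI₂' hc₁ hgenus
  have := h₁.smooth_chartRing hI₁' hc₁ j
  have := h₂.smooth_chartRing hI₂' hc₂ j
  have := isTorsionFree_chartRing I j
    (eventually_mem_of_C_mul_mem h₁ h₂ hπ hsurj hker I.isHomogeneous hI₂')
  exact ⟨smooth_chartRing I.toIdeal j K hπ hsurj hker, h₂.smooth_chartRing hI₂' hc₂ j⟩

end FunctionField1

open AlgebraicCurve FunctionField1 MvPolynomial ProjectiveModel in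
theorem mainTheorem5_general {A K κ σ : Type} [CommRing A] [IsDomain A] [IsDiscreteValuationRing A]
    [Field K] [PerfectField K] [Algebra A K] [IsFractionRing A K]
    [Field κ] [PerfectField κ] [Algebra A κ] [Finite σ] {π : A} (hπ : Irreducible π)
    (hsurj : Function.Surjective (algebraMap A κ)) (hker : ∀ a : A, algebraMap A κ a = 0 ↔ π ∣ a)
    {I : HomogeneousIdeal (homogeneousSubmodule σ A)}
    {I₁ : HomogeneousIdeal (homogeneousSubmodule σ K)}
    {I₂ : HomogeneousIdeal (homogeneousSubmodule σ κ)}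
    (hI₁ : I.toIdeal.map (map (algebraMap A K)) = I₁.toIdeal)
    (hI₂ : I.toIdeal.map (map (algebraMap A κ)) = I₂.toIdeal)
    {Y : Scheme.{0}} {sY : Y ⟶ Spec (.of K)} (hY : IsCurve sY)
    (hX : IsCurve (structMor I₁)) (hXns : ∀ x, IsNonsingularAt (Proj (quotGrading I₁)) x)
    (hXY : Scheme.BirationalOver (structMor I₁) sY) (hred : IsCurve (structMor I₂))
    (hgenus : geometricGenus (structMor I₂) hred = geometricGenus sY hY) :
    Smooth (structMor I) ∧ Smooth (structMor I₂) := by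
  have := hY.isIntegral
  have := hX.isIntegral
  have := hred.isIntegral
  let : Algebra K Y.functionField := (constantsHom sY).toAlgebra
  let : Algebra κ (Proj (quotGrading I₂)).functionField := (constantsHom (structMor I₂)).toAlgebra
  have := hY.isFunctionField
  have := hred.isFunctionField
  obtain ⟨e, he⟩ := exists_functionField_equiv_of_birationalOver hXY
  obtain ⟨y₁, h₁⟩ := exists_isGenericPoint e he
  obtain ⟨y₂, h₂⟩ := exists_isGenericPoint (I := I₂) (RingEquiv.refl _) fun _ => rfl
  have hc₁ : ChartsIntegrallyClosed K y₁ := h₁.chartsIntegrallyClosed I₁.isHomogeneous fun j =>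
    isIntegrallyClosed_chartRing fun x => hX.isIntegrallyClosed_stalk (hXns x)
  have hs (j : σ) := smooth_chartRing_of_genus_eq h₁ h₂ hI₁ hI₂ hπ hsurj hker hc₁ hgenus j
  exact ⟨smooth_structMor I fun j => (hs j).1, smooth_structMor I₂ fun j => (hs j).2⟩

theorem mainTheorem5 {n : ℕ} (J : ProjectiveModel.Equations n) (p : ℕ) [Fact p.Prime]
    -- `Y` is a geometrically irreducible curve over `ℚ`
    {Y : Scheme.{0}} (sY : Y ⟶ Spec (.of ℚ))
    (hY : AlgebraicCurve.IsCurve sY) (hYgeom : GeometricallyIrreducible sY)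
    -- `X = V(J)_ℚ` is a nonsingular projective curve that is birational to `Y` over `ℚ`
    (hX : AlgebraicCurve.IsCurve (ProjectiveModel.toSpec J ℚ))
    (hXns : ∀ x : ProjectiveModel.scheme J ℚ, AlgebraicCurve.IsNonsingularAt _ x)
    (hXY : Scheme.BirationalOver (ProjectiveModel.toSpec J ℚ) sY)
    -- the reduction `V(J)_{𝔽_p}` is an integral curve
    (hred : AlgebraicCurve.IsCurve (ProjectiveModel.toSpec J (ZMod p)))
    -- it has a nonsingular `𝔽_p`-point
    (hpt : ∃ s : Spec (.of (ZMod p)) ⟶ ProjectiveModel.scheme J (ZMod p),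
      s ≫ ProjectiveModel.toSpec J (ZMod p) = 𝟙 _ ∧
      ∀ z, AlgebraicCurve.IsNonsingularAt (ProjectiveModel.scheme J (ZMod p)) (s z))
    -- its geometric genus is the genus of `Y`
    (hgenus : AlgebraicCurve.geometricGenus (ProjectiveModel.toSpec J (ZMod p)) hred =
      AlgebraicCurve.geometricGenus sY hY) :
    ProjectiveModel.HasGoodReduction J p ∧ Smooth (ProjectiveModel.toSpec J (ZMod p)) :=
  mainTheorem5_general (ProjectiveModel.irreducible_natCast_zAt p)
    (ProjectiveModel.algebraMap_zAt_zmod_surjective p)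
    (ProjectiveModel.algebraMap_zAt_zmod_eq_zero_iff p) (ProjectiveModel.map_idealOver J _ ℚ)
    (ProjectiveModel.map_idealOver J _ (ZMod p)) hY hX hXns hXY hred hgenus
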